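/- **Setting.** Let $n,m,q\ge 0$ be integers, $Y\in\mathbb R^m$, $X\in\mathbb R^{m\times q}$, $\beta\in\mathbb R^q$, $A\in\mathbb R^{m\times n}$, $K\in\mathbb R^{n\times n}$ invertible, $h\in\mathbb R^n$, $\mu\in\mathbb R$, $\sigma>0$, $\sigma_\epsilon>0$, and put $B=AK^{-1}$. For real $p,a,b$ let $\mathrm{GIG}(p,a,b)$ be the probability distribution on $(0,\infty)$ with density proportional to $x^{p-1}\exp\{-\tfrac12(ax+b/x)\}$ (whenever this function is integrable). Consider the hierarchical model $$Y\mid M,V\sim N\bigl(X\beta+B(M-\mu h),\,\sigma_\epsilon^2 I\bigr),\qquad M\mid V\sim N\bigl(\mu V,\ \mathrm{diag}(\sigma^2V)\bigr),\qquad V_i\overset{\text{ind.}}{\sim}\mathrm{GIG}(p,a,b),\quad i=1,\dots,n,$$ and let $\pi$ be the posterior distribution of $V$ given $Y$, a distribution on $(0,\infty)^n$. With $\rho=\sigma^2/\sigma_\epsilon^2$, $\bar Q=\rho B^\top B+\mathrm{diag}(V)^{-1}$ and $\bar m=\rho B^\top(Y-X\beta+\mu Bh)+\mu\mathbf 1$,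 the (non-centered) Gibbs sampler alternates the updates $$M\mid V,Y\sim N(\bar Q^{-1}\bar m,\ \sigma^2\bar Q^{-1}),\qquad \tilde V_i\mid M,Y\overset{\text{ind.}}{\sim}\mathrm{GIG}\Bigl(p-\tfrac12,\ a+\tfrac{\mu^2}{\sigma^2},\ b+\tfrac{M_i^2}{\sigma^2}\Bigr),\quad i=1,\dots,n,$$ so that the $V$-marginal chain $(V^{(t)})_{t\ge0}$ on $(0,\infty)^n$ has the transition density $k(V,\tilde V)=\int_{\mathbb R^n}\pi(\tilde V\mid M,Y)\,\pi(M\mid V,Y)\,dM$. Let $P$ be its transition kernel. **Null-smallness.** Let $r=\dim\mathrm{Null}(A)$, let the columns of $U\in\mathbb R^{n\times r}$ be an orthonormal basis of $\mathrm{Null}(A)$, $G=U^\top K^\top KU$ and $z=U^\top K^\top\mathbf 1$. The null-smallness assumption says that $r=0$ or $$\frac{|\mu|}{\sqrt{\sigma^2a+\mu^2}}\sqrt{z^\top G^{-1}z}<1 .$$ **Theorem 2.8.** In each of the following regimes the chain $(V^{(t)})$ is geometrically ergodic: 1. $a>0$, $b>0$, $p\in\mathbb R$; 2. $a>0$, $b=0$,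 $p>\tfrac12$; 3. $a>0$, $b=0$, $0<p\le\tfrac12$, and null-smallness holds; 4. $a=0$, $b>0$, $p<0$, $\mu=0$; 5. $a=0$, $b>0$, $p<0$, $\mu\ne0$, and null-smallness holds. Here *geometrically ergodic* means: $P$ is a Markov kernel, $\pi$ is a probability measure with $\pi P=\pi$, and there is $\gamma\in(0,1)$ such that for every probability measure $\nu\ll\pi$ on $(0,\infty)^n$ with $\int(d\nu/d\pi)^2\,d\pi<\infty$ there is a constant $C(\nu)<\infty$ with $$\|\nu P^t-\pi\|_{\mathrm{TV}}\le C(\nu)\,\gamma^t\qquad\text{for all integers } t\ge0 .$$ -/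

import Mathlib

open MeasureTheory ProbabilityTheory Matrix
open scoped ENNReal

noncomputable section

/-! ### Distributions -/

/-- The Lebesgue density at `x` of the Gaussian distribution `N(c, Q⁻¹)` on `ℝ^ι` with mean `c` and
(positive definite) precision matrix `Q`. -/
def gaussianDensity {ι : Type} [Fintype ι] [DecidableEq ι]
    (Q : Matrix ι ι ℝ) (c x : ι → ℝ) : ℝ :=
  √(Q.det / (2 * Real.pi) ^ Fintype.card ι) * Real.exp (-(1 / 2) * ((x - c) ⬝ᵥ (Q *ᵥ (x - c))))

/-- Lebesgue measure on `(0, ∞)`. -/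
def lebPos : Measure (Set.Ioi (0 : ℝ)) := (volume : Measure ℝ).comap Subtype.val

instance : SigmaFinite lebPos := by
  refine SigmaFinite.of_map _ (f := Subtype.val) measurable_subtype_coe.aemeasurable ?_
  rw [lebPos, map_comap_subtype_coe measurableSet_Ioi]
  infer_instance

/-- The unnormalised density `x^(p-1) exp(-(a x + b / x) / 2)` of `GIG(p, a, b)` on `(0, ∞)`. -/
def gigKernel (p a b : ℝ) (x : Set.Ioi (0 : ℝ)) : ℝ≥0∞ :=
  ENNReal.ofReal ((x : ℝ) ^ (p - 1) * Real.exp (-(1 / 2) * (a * (x : ℝ) + b / (x : ℝ))))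

/-- The density of the generalised inverse Gaussian distribution `GIG(p, a, b)` with respect to
Lebesgue measure on `(0, ∞)`. The normalising integral is finite exactly when `a, b > 0`, or
`a = 0`, `b > 0`, `p < 0` (inverse Gamma), or `a > 0`, `b = 0`, `p > 0` (Gamma); for `a, b > 0` it
equals `2 K_p(√(a b)) (b / a)^(p / 2)`. -/
def gigDensity (p a b : ℝ) (x : Set.Ioi (0 : ℝ)) : ℝ≥0∞ :=
  gigKernel p a b x / ∫⁻ y, gigKernel p a b y ∂lebPos

/-! ### The linear latent non-Gaussian model, non-centered parameterisation -/

/-- The space `(0, ∞)ⁿ` of mixing variables, with the product `σ`-algebra. -/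
abbrev MixSpace (n : ℕ) : Type := Fin n → Set.Ioi (0 : ℝ)

/-- Lebesgue measure on `(0, ∞)ⁿ`. -/
def lebMix (n : ℕ) : Measure (MixSpace n) := Measure.pi fun _ => lebPos

instance (n : ℕ) : SigmaFinite (lebMix n) := by
  unfold lebMix
  infer_instance

/-- The vector in `ℝⁿ` underlying a point of `(0, ∞)ⁿ`. -/
def MixSpace.toVec {n : ℕ} (V : MixSpace n) : Fin n → ℝ := fun i => (V i : ℝ)

/-- The fixed data and parameters of the model: `n` latent variables, `m` observations, `q`
regression coefficients. -/
structure LLnGM (n m q : ℕ) where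
  /-- observed data -/
  Y : Fin m → ℝ
  /-- design matrix -/
  X : Matrix (Fin m) (Fin q) ℝ
  /-- regression coefficients -/
  β : Fin q → ℝ
  /-- observation matrix -/
  A : Matrix (Fin m) (Fin n) ℝ
  /-- operator matrix -/
  K : Matrix (Fin n) (Fin n) ℝ
  /-- fixed vector that shifts the latent field -/
  h : Fin n → ℝ
  /-- skewness parameter -/
  μ : ℝ
  /-- scale of the latent noise -/
  σ : ℝ
  /-- standard deviation of the measurement noise -/
  σε : ℝ
  /-- first parameter of the `GIG(p, a, b)` mixing distribution -/
  p : ℝ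
  /-- second parameter of the `GIG(p, a, b)` mixing distribution -/
  a : ℝ
  /-- third parameter of the `GIG(p, a, b)` mixing distribution -/
  b : ℝ

namespace LLnGM

variable {n m q : ℕ} (S : LLnGM n m q)

/-- `B = A K⁻¹`. -/
def B : Matrix (Fin m) (Fin n) ℝ := S.A * S.K⁻¹

/-- Density of `Y ∣ M ∼ N(X β + A K⁻¹ (M - μ h), σ_ε² I)` at the observed data. -/
def likelihood (M : Fin n → ℝ) : ℝ :=
  gaussianDensity ((S.σε ^ 2)⁻¹ • (1 : Matrix (Fin m) (Fin m) ℝ))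
    (S.X *ᵥ S.β + S.B *ᵥ (M - S.μ • S.h)) S.Y

/-- Density of `M ∣ V ∼ N(μ V, diag(σ² V))`. -/
def latentDensity (V : MixSpace n) (M : Fin n → ℝ) : ℝ :=
  gaussianDensity (Matrix.diagonal fun i => (S.σ ^ 2 * V.toVec i)⁻¹) (S.μ • V.toVec) M

/-- Density of the prior `V_i ∼ GIG(p, a, b)`, independent over `i`. -/
def priorDensity (V : MixSpace n) : ℝ≥0∞ := ∏ i, gigDensity S.p S.a S.b (V i)

/-- Joint density of `(V, M, Y)` at the observed data, as a function of `(V, M)`. -/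
def jointDensity (V : MixSpace n) (M : Fin n → ℝ) : ℝ≥0∞ :=
  S.priorDensity V * ENNReal.ofReal (S.latentDensity V M) * ENNReal.ofReal (S.likelihood M)

/-- The density of the law of `(V, Y)` at the observed data, as a function of `V`. -/
def marginalDensity (V : MixSpace n) : ℝ≥0∞ := ∫⁻ M : Fin n → ℝ, S.jointDensity V M

/-- The posterior distribution of `V` given `Y`. -/
def posterior : Measure (MixSpace n) :=
  (lebMix n).withDensity fun V => S.marginalDensity V / ∫⁻ V', S.marginalDensity V' ∂lebMix n

/-! ### The Gibbs sampler -/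

/-- `ρ = σ² / σ_ε²`. -/
def ρ : ℝ := S.σ ^ 2 / S.σε ^ 2

/-- `Q̄ = ρ Bᵀ B + D_V⁻¹`. -/
def Qbar (V : MixSpace n) : Matrix (Fin n) (Fin n) ℝ :=
  S.ρ • (S.Bᵀ * S.B) + Matrix.diagonal fun i => (V.toVec i)⁻¹

/-- `m̄ = ρ Bᵀ (Y - X β + μ B h) + μ 1`. -/
def mbar : Fin n → ℝ :=
  S.ρ • (S.Bᵀ *ᵥ (S.Y - S.X *ᵥ S.β + S.μ • (S.B *ᵥ S.h))) + S.μ • (1 : Fin n → ℝ)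

/-- Density of the first Gibbs update `M ∣ V, Y ∼ N(Q̄⁻¹ m̄, σ² Q̄⁻¹)`. -/
def condM (V : MixSpace n) (M : Fin n → ℝ) : ℝ :=
  gaussianDensity ((S.σ ^ 2)⁻¹ • S.Qbar V) ((S.Qbar V)⁻¹ *ᵥ S.mbar) M

/-- Density of the second Gibbs update: independently over `i`,
`Ṽ_i ∣ M_i ∼ GIG(p - 1/2, a + (μ/σ)², b + (M_i/σ)²)`. -/
def condV (M : Fin n → ℝ) (V' : MixSpace n) : ℝ≥0∞ :=
  ∏ i, gigDensity (S.p - 1 / 2) (S.a + (S.μ / S.σ) ^ 2) (S.b + (M i / S.σ) ^ 2) (V' i)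

/-- Transition density of the `V`-marginal chain,
`k(V, Ṽ) = ∫ π(Ṽ ∣ M, Y) π(M ∣ V, Y) dM`. -/
def transitionDensity (V V' : MixSpace n) : ℝ≥0∞ :=
  ∫⁻ M : Fin n → ℝ, S.condV M V' * ENNReal.ofReal (S.condM V M)

end LLnGM

/-! ### Measurability -/

theorem measurable_det_of_entries {α ι : Type} [MeasurableSpace α] [Fintype ι] [DecidableEq ι]
    {F : α → Matrix ι ι ℝ} (hF : ∀ i j, Measurable fun x => F x i j) :
    Measurable fun x => (F x).det := by
  simp only [Matrix.det_apply]
  refine Finset.measurable_sum _ fun s _ => ?_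
  exact (Finset.measurable_prod _ fun i _ => hF (s i) i).const_smul (Equiv.Perm.sign s)

theorem measurable_inv_of_entries {α ι : Type} [MeasurableSpace α] [Fintype ι] [DecidableEq ι]
    {F : α → Matrix ι ι ℝ} (hF : ∀ i j, Measurable fun x => F x i j) (i j : ι) :
    Measurable fun x => (F x)⁻¹ i j := by
  simp only [Matrix.inv_def, Ring.inverse_eq_inv', Matrix.smul_apply, smul_eq_mul,
    Matrix.adjugate_apply]
  refine (measurable_det_of_entries hF).inv.mul (measurable_det_of_entries fun k l => ?_)
  by_cases hk : k = j
  · subst hk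
    simp only [Matrix.updateRow_self]
    exact measurable_const
  · simp only [Matrix.updateRow_ne hk]
    exact hF k l

theorem measurable_gaussianDensity {α ι : Type} [MeasurableSpace α] [Fintype ι] [DecidableEq ι]
    {Q : α → Matrix ι ι ℝ} {c x : α → ι → ℝ} (hQ : ∀ i j, Measurable fun t => Q t i j)
    (hc : ∀ i, Measurable fun t => c t i) (hx : ∀ i, Measurable fun t => x t i) :
    Measurable fun t => gaussianDensity (Q t) (c t) (x t) := by
  have h1 : Measurable fun t => (Q t).det := measurable_det_of_entries hQ
  have h2 : Measurable fun t => (x t - c t) ⬝ᵥ (Q t *ᵥ (x t - c t)) := by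
    simp only [dotProduct, Matrix.mulVec, Pi.sub_apply]
    exact Finset.measurable_sum _ fun i _ => ((hx i).sub (hc i)).mul
      (Finset.measurable_sum _ fun j _ => (hQ i j).mul ((hx j).sub (hc j)))
  exact (h1.div_const _).sqrt.mul (h2.const_mul _).exp

theorem measurable_gigKernel (p a : ℝ) :
    Measurable fun t : ℝ × Set.Ioi (0 : ℝ) => gigKernel p a t.1 t.2 := by
  unfold gigKernel
  fun_prop

theorem measurable_gigDensity (p a : ℝ) :
    Measurable fun t : ℝ × Set.Ioi (0 : ℝ) => gigDensity p a t.1 t.2 := by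
  have h := (measurable_gigKernel p a).lintegral_prod_right' (ν := lebPos)
  exact (measurable_gigKernel p a).div (h.comp measurable_fst)

namespace LLnGM

variable {n m q : ℕ} (S : LLnGM n m q)

theorem measurable_condM :
    Measurable fun t : MixSpace n × (Fin n → ℝ) => S.condM t.1 t.2 := by
  have hQ : ∀ i j, Measurable fun t : MixSpace n × (Fin n → ℝ) => S.Qbar t.1 i j := by
    intro i j
    simp only [Qbar, Matrix.add_apply, Matrix.diagonal_apply, MixSpace.toVec]
    refine measurable_const.add ?_
    by_cases hij : i = j
    · simp only [hij, if_true]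
      fun_prop
    · simp only [hij, if_false]
      exact measurable_const
  refine measurable_gaussianDensity (fun i j => ?_) (fun i => ?_) (fun i => by fun_prop)
  · simp only [Matrix.smul_apply, smul_eq_mul]
    exact (hQ i j).const_mul _
  · simp only [Matrix.mulVec, dotProduct]
    exact Finset.measurable_sum _ fun j _ => (measurable_inv_of_entries hQ i j).mul_const _

theorem measurable_condV :
    Measurable fun t : (Fin n → ℝ) × MixSpace n => S.condV t.1 t.2 := by
  refine Finset.measurable_prod _ fun i _ => ?_
  exact (measurable_gigDensity _ _).comp
    (f := fun t : (Fin n → ℝ) × MixSpace n => (S.b + (t.1 i / S.σ) ^ 2, t.2 i)) (by fun_prop)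

theorem measurable_transitionDensity :
    Measurable fun t : MixSpace n × MixSpace n => S.transitionDensity t.1 t.2 := by
  have h : Measurable fun z : (MixSpace n × MixSpace n) × (Fin n → ℝ) =>
      S.condV z.2 z.1.2 * ENNReal.ofReal (S.condM z.1.1 z.2) :=
    (S.measurable_condV.comp (f := fun z : (MixSpace n × MixSpace n) × (Fin n → ℝ) =>
      (z.2, z.1.2)) (by fun_prop)).mul
    (S.measurable_condM.comp (f := fun z : (MixSpace n × MixSpace n) × (Fin n → ℝ) =>
      (z.1.1, z.2)) (by fun_prop)).ennreal_ofReal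
  exact h.lintegral_prod_right'

/-- The transition kernel of the `V`-marginal chain `(V^(t))` of the Gibbs sampler,
`P(V, dṼ) = k(V, Ṽ) dṼ` on `(0, ∞)ⁿ`. -/
def gibbsKernel : Kernel (MixSpace n) (MixSpace n) where
  toFun V := (lebMix n).withDensity (S.transitionDensity V)
  measurable' := by
    refine Measure.measurable_of_measurable_coe _ fun s hs => ?_
    simp only [withDensity_apply _ hs]
    exact S.measurable_transitionDensity.lintegral_prod_right' (ν := (lebMix n).restrict s)

/-- The null-smallness assumption: with `U` an orthonormal basis of `Null(A)` (as the columns of an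
`n × r` matrix, `r = dim Null(A)`), `G = Uᵀ Kᵀ K U` and `z = Uᵀ Kᵀ 1`, either `r = 0` or
`|μ| / √(σ² a + μ²) * √(zᵀ G⁻¹ z) < 1`. The condition does not depend on the choice of `U`. -/
def NullSmallness : Prop :=
  ∃ (r : ℕ) (U : Matrix (Fin n) (Fin r) ℝ),
    Uᵀ * U = 1 ∧ LinearMap.range U.mulVecLin = LinearMap.ker S.A.mulVecLin ∧
    (r = 0 ∨
      let G : Matrix (Fin r) (Fin r) ℝ := Uᵀ * S.Kᵀ * S.K * U
      let z : Fin r → ℝ := (Uᵀ * S.Kᵀ) *ᵥ (1 : Fin n → ℝ)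
      |S.μ| / √(S.σ ^ 2 * S.a + S.μ ^ 2) * √(z ⬝ᵥ (G⁻¹ *ᵥ z)) < 1)

end LLnGM

/-! ### Geometric ergodicity -/

/-- Total variation distance `sup_A |ν₁(A) - ν₂(A)|` over measurable sets `A`. -/
def tvDist {α : Type} [MeasurableSpace α] (ν₁ ν₂ : Measure α) : ℝ :=
  ⨆ s : {s : Set α // MeasurableSet s}, |ν₁.real s - ν₂.real s|

/-- The chain with transition kernel `P` is geometrically ergodic with stationary distribution `π`:
`P` is a Markov kernel, `π` is an invariant probability measure, and there is a rate `γ ∈ (0, 1)`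
such that every initial probability measure `ν ≪ π` with `∫ (dν/dπ)² dπ < ∞` satisfies
`‖ν Pᵗ - π‖_TV ≤ C(ν) γᵗ` for all `t`, with a finite constant `C(ν)`. -/
structure IsGeometricallyErgodic {α : Type} [MeasurableSpace α]
    (P : Kernel α α) (π : Measure α) : Prop where
  isMarkovKernel : IsMarkovKernel P
  isProbabilityMeasure : IsProbabilityMeasure π
  invariant : P.Invariant π
  geometric : ∃ γ : ℝ, 0 < γ ∧ γ < 1 ∧ ∀ ν : Measure α, IsProbabilityMeasure ν → ν ≪ π →
    ∫⁻ x, (ν.rnDeriv π x) ^ 2 ∂π < ∞ →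
    ∃ C : ℝ, 0 < C ∧ ∀ t : ℕ, tvDist (ν.bind (P ^ t)) π ≤ C * γ ^ t

end

/-! The proof combines a geometric drift condition with a minorization on sublevel sets of the drift
function and concludes by Harris' theorem (`isGeometricallyErgodic_of_drift_of_minorization`).
Invariance of the posterior holds because the joint density of `(V, M)` factors through both Gibbs
updates (`invariant_posterior`).

Given `M`, the coordinates of the new `V` are independent `GIG` variables, and the law of the `i`-th
one depends on `M i` alone. Given `V`, each `M i` is a one-dimensional Gaussian. A drift function `W
V = ∑ w (V i)` therefore needs only one-dimensional moment bounds: a function `f` dominating the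
`GIG` mean of `w` given `M i = y`, and a bound of the Gaussian means of `f` by `lam * W + C`.
Bounded `f` keeps the `GIG` parameter `b + (y/σ)²` in a range with a common positive density
minorant, which gives the minorization (`isGeometricallyErgodic_of_bounds`).

The choice of `w` follows the regime. For `a > 0` the mean `w = x` is controlled: the `GIG` mean
grows in `|y|` with slope `1/√(σ² a + μ²)`, while the Gaussian means are bounded, in `ℓ¹` norm, by
`|μ| ∑ V i` plus a constant, so the product of the rates is below one. If moreover `b = 0` and `p ≤
1/2`, a negative power `x ^ (-p/2)` is added to keep the chain away from zero. Gaussian negative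
moments are largest for centred variables, and strict log-convexity of `Γ` makes the combined factor
less than one. For `a = 0`, `μ = 0` the update is inverse Gamma, `w` is a small power, the Gaussian
means are bounded, and the factor is again a ratio of Gamma values below one. For `a = 0`, `μ ≠ 0`
the slope argument degenerates to rate one. With `w = x²` only the projection `v` of the vector `1`
onto `Null(B)` produces growing means, at rate `|v|²`, and null-smallness says exactly that `|v| <
1`.

The linear algebra rests on the energy identity for `(r BᵀB + diag(v)⁻¹)⁻¹` and on
`exists_ridge_inv_bound`: solutions with right-hand side orthogonal to `Null(B)` are bounded
uniformly in the diagonal. -/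

open MeasureTheory ProbabilityTheory Matrix
open scoped ENNReal

noncomputable section

/-! ### Harris' theorem -/

section Harris

open Filter Topology

variable {α : Type} [MeasurableSpace α]

/-- The geometric drift condition `P W ≤ lam W + C`. -/
def GeometricDrift (P : Kernel α α) (W : α → ℝ) (lam C : ℝ) : Prop :=
  ∀ x, ∫⁻ y, ENNReal.ofReal (W y) ∂P x ≤ ENNReal.ofReal (lam * W x + C)

theorem GeometricDrift.integrable {P : Kernel α α} {W : α → ℝ} {lam C : ℝ}
    (h : GeometricDrift P W lam C) (hW : Measurable W) (hW0 : ∀ x, 0 ≤ W x) (x : α) :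
    Integrable W (P x) := by
  refine ⟨hW.aestronglyMeasurable, ?_⟩
  rw [hasFiniteIntegral_iff_ofReal (Eventually.of_forall hW0)]
  exact (h x).trans_lt ENNReal.ofReal_lt_top

theorem GeometricDrift.integral_le {P : Kernel α α} {W : α → ℝ} {lam C : ℝ}
    (h : GeometricDrift P W lam C) (hW : Measurable W) (hW0 : ∀ x, 0 ≤ W x)
    (hl : 0 ≤ lam) (hC : 0 ≤ C) (x : α) : ∫ y, W y ∂P x ≤ lam * W x + C := by
  have h1 := h x
  rw [← ofReal_integral_eq_lintegral_ofReal (h.integrable hW hW0 x) (Eventually.of_forall hW0)] at h1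
  exact (ENNReal.ofReal_le_ofReal_iff (by have := hW0 x; positivity)).1 h1

theorem isMarkovKernel_pow (P : Kernel α α) [IsMarkovKernel P] (t : ℕ) :
    IsMarkovKernel (P ^ t) := by
  induction t with
  | zero => exact inferInstanceAs (IsMarkovKernel Kernel.id)
  | succ t ih => exact inferInstanceAs (IsMarkovKernel ((P ^ t : Kernel α α) ∘ₖ P))

/-- The constant `C / (1 - lam)` is the fixed point of `c ↦ lam * c + C`, so the additive error does
not grow with `t`. -/
theorem GeometricDrift.pow {P : Kernel α α} [IsMarkovKernel P] {W : α → ℝ} {lam C : ℝ}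
    (h : GeometricDrift P W lam C) (hW : Measurable W) (hW0 : ∀ x, 0 ≤ W x)
    (hl : 0 ≤ lam) (hl1 : lam < 1) (hC : 0 ≤ C) (t : ℕ) :
    GeometricDrift (P ^ t) W (lam ^ t) (C / (1 - lam)) := by
  have h1 : 0 < 1 - lam := by linarith
  induction t with
  | zero =>
    intro x
    change ∫⁻ y, ENNReal.ofReal (W y) ∂(Kernel.id x) ≤ _
    rw [Kernel.id_apply, lintegral_dirac' _ hW.ennreal_ofReal]
    apply ENNReal.ofReal_le_ofReal
    have : 0 ≤ C / (1 - lam) := by positivity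
    simp [this]
  | succ t ih =>
    intro x
    have e : P ^ (t + 1) = P ∘ₖ (P ^ t) := pow_succ' P t
    rw [e, Kernel.lintegral_comp _ _ _ hW.ennreal_ofReal]
    calc ∫⁻ y, ∫⁻ z, ENNReal.ofReal (W z) ∂(P y) ∂((P ^ t) x)
        ≤ ∫⁻ y, (ENNReal.ofReal lam * ENNReal.ofReal (W y) + ENNReal.ofReal C) ∂((P ^ t) x) := by
          refine lintegral_mono fun y => (h y).trans_eq ?_
          have := hW0 y
          rw [ENNReal.ofReal_add (by positivity) (by positivity), ENNReal.ofReal_mul (by positivity)]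
      _ = ENNReal.ofReal lam * ∫⁻ y, ENNReal.ofReal (W y) ∂((P ^ t) x) + ENNReal.ofReal C := by
          have := isMarkovKernel_pow P t
          rw [lintegral_add_right _ measurable_const, lintegral_const_mul _ hW.ennreal_ofReal]
          simp
      _ ≤ ENNReal.ofReal lam * ENNReal.ofReal (lam ^ t * W x + C / (1 - lam))
            + ENNReal.ofReal C := by gcongr; exact ih x
      _ = _ := by
          have := hW0 x
          rw [← ENNReal.ofReal_mul (by positivity), ← ENNReal.ofReal_add (by positivity)
            (by positivity)]
          congr 1
          field_simp
          ring

/-- Integrability of `W` under `π` is not known beforehand, so the drift inequality cannot simply be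
integrated. Truncating at `N`, using invariance under `P ^ t` and letting `t → ∞` by dominated
convergence removes the term `lam ^ t * W`; then `N → ∞`. -/
theorem GeometricDrift.lintegral_invariant_le {P : Kernel α α} [IsMarkovKernel P] {W : α → ℝ}
    {lam C : ℝ} (h : GeometricDrift P W lam C) (hW : Measurable W) (hW0 : ∀ x, 0 ≤ W x)
    (hl : 0 ≤ lam) (hl1 : lam < 1) (hC : 0 ≤ C) {π : Measure α} [IsProbabilityMeasure π]
    (hπ : ∀ t : ℕ, (P ^ t).Invariant π) :
    ∫⁻ x, ENNReal.ofReal (W x) ∂π ≤ ENNReal.ofReal (C / (1 - lam)) := by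
  have hm := hW.ennreal_ofReal
  have key : ∀ N : ℕ, ∫⁻ x, min (ENNReal.ofReal (W x)) N ∂π ≤ ENNReal.ofReal (C / (1 - lam)) := by
    intro N
    have hb : ∀ t : ℕ, ∫⁻ x, min (ENNReal.ofReal (W x)) N ∂π
        ≤ ∫⁻ x, min (ENNReal.ofReal (lam ^ t * W x + C / (1 - lam))) N ∂π := by
      intro t
      have := isMarkovKernel_pow P t
      conv_lhs => rw [← hπ t]
      rw [Measure.lintegral_bind (Kernel.aemeasurable _) (hm.min measurable_const).aemeasurable]
      refine lintegral_mono fun x => le_min ?_ ?_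
      · exact (lintegral_mono fun y => min_le_left _ _).trans (h.pow hW hW0 hl hl1 hC t x)
      · exact (lintegral_mono fun y => min_le_right _ _).trans
          (by rw [lintegral_const]; exact mul_le_of_le_one_right' prob_le_one)
    have ht : Tendsto (fun t : ℕ => ∫⁻ x, min (ENNReal.ofReal (lam ^ t * W x + C / (1 - lam))) N ∂π)
        atTop (𝓝 (∫⁻ _, min (ENNReal.ofReal (C / (1 - lam))) N ∂π)) := by
      refine tendsto_lintegral_of_dominated_convergence (fun _ => (N : ℝ≥0∞)) (fun t => ?_)
        (fun t => ae_of_all _ fun x => min_le_right _ _)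
        (by rw [lintegral_const, measure_univ, mul_one]; exact ENNReal.natCast_ne_top N)
        (ae_of_all _ fun x => ?_)
      · exact ((hW.const_mul _).add_const _).ennreal_ofReal.min measurable_const
      · refine Tendsto.min (ENNReal.tendsto_ofReal ?_) tendsto_const_nhds
        have := ((tendsto_pow_atTop_nhds_zero_of_lt_one hl hl1).mul_const (W x)).add_const
          (C / (1 - lam))
        rwa [zero_mul, zero_add] at this
    refine (ge_of_tendsto' ht hb).trans ?_
    rw [lintegral_const, measure_univ, mul_one]
    exact min_le_left _ _
  have hs : ∀ x, ENNReal.ofReal (W x) = ⨆ N : ℕ, min (ENNReal.ofReal (W x)) N := by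
    intro x
    apply le_antisymm
    · obtain ⟨N, hN⟩ := ENNReal.exists_nat_gt (ENNReal.ofReal_ne_top (r := W x))
      exact le_iSup_of_le N (le_min le_rfl hN.le)
    · exact iSup_le fun N => min_le_left _ _
  rw [lintegral_congr hs]
  rw [lintegral_iSup (fun N => hm.min measurable_const)]
  · exact iSup_le key
  · intro N M hNM x
    exact min_le_min le_rfl (by exact_mod_cast hNM)

set_option linter.unusedSectionVars false

/-- The Hairer-Mattingly seminorm bound. -/
def WLip (W : α → ℝ) (β c : ℝ) (f : α → ℝ) : Prop :=
  ∀ x y, |f x - f y| ≤ c * (2 + β * W x + β * W y)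

/-- A two-point bound becomes a one-point weighted sup bound after subtracting a constant, since
every lower envelope value `f x - c (1 + β W x)` lies below every upper one `f y + c (1 + β W y)`.
-/
theorem WLip.exists_shift [Nonempty α] {W : α → ℝ} {β c : ℝ} {f : α → ℝ} (h : WLip W β c f) :
    ∃ d, ∀ x, |f x - d| ≤ c * (1 + β * W x) := by
  have hb : ∀ y x, f x - c * (1 + β * W x) ≤ f y + c * (1 + β * W y) := fun y x => by
    have := (abs_le.1 (h x y)).2
    linarith
  refine ⟨⨆ x, (f x - c * (1 + β * W x)), fun x => abs_le.2 ⟨?_, ?_⟩⟩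
  · have := ciSup_le (hb x)
    linarith
  · have := le_ciSup (f := fun x => f x - c * (1 + β * W x))
      ⟨f x + c * (1 + β * W x), by rintro _ ⟨z, rfl⟩; exact hb x z⟩ x
    linarith

theorem abs_integral_le_of_abs_le {μ : Measure α} {g h : α → ℝ} (hh : Integrable h μ)
    (hgh : ∀ x, |g x| ≤ h x) : |∫ x, g x ∂μ| ≤ ∫ x, h x ∂μ := by
  rw [← Real.norm_eq_abs]
  exact norm_integral_le_of_norm_le hh (ae_of_all _ hgh)

/-- The Hairer-Mattingly argument. If `W x + W y` is large, the drift alone contracts the weight. If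
it is small, both points lie in the sublevel set, and the common part `η` of the two transition laws
cancels, which gains `2 ε`. The weight `β` is taken so small that the drift constant does not use up
this gain. -/
theorem WLip.contraction [Nonempty α] {P : Kernel α α} [IsMarkovKernel P] {W : α → ℝ}
    {lam C : ℝ} (hd : GeometricDrift P W lam C) (hW : Measurable W) (hW0 : ∀ x, 0 ≤ W x)
    (hl : 0 ≤ lam) (hl1 : lam < 1) (hC : 0 ≤ C)
    (hm : ∀ R, ∃ η : Measure α, η ≠ 0 ∧ ∀ x, W x ≤ R → η ≤ P x) :
    ∃ β q : ℝ, 0 < β ∧ 0 < q ∧ q < 1 ∧ ∀ (c : ℝ) (f : α → ℝ), 0 ≤ c → Measurable f →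
      WLip W β c f → WLip W β (q * c) fun x => ∫ y, f y ∂P x := by
  -- Chosen so that `2 C` is absorbed by half of the drift gap once `W x + W y ≥ R`.
  set R : ℝ := 4 * C / (1 - lam) + 1 with hR
  have h1l : 0 < 1 - lam := by linarith
  have hR0 : 0 < R := by positivity
  have hRC : 2 * C ≤ (1 - lam) / 2 * R := by
    rw [hR]; field_simp; nlinarith
  obtain ⟨η, hη, hη1, hηP⟩ : ∃ η : Measure α, η ≠ 0 ∧ η Set.univ ≤ 1 ∧ ∀ x, W x ≤ R → η ≤ P x := by
    -- An empty sublevel set puts no constraint on `η`, not even finiteness; any transition law then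
    -- serves instead.
    obtain ⟨η, hη, hηP⟩ := hm R
    by_cases hne : ∃ x, W x ≤ R
    · obtain ⟨x, hx⟩ := hne
      exact ⟨η, hη, (hηP x hx Set.univ).trans_eq measure_univ, hηP⟩
    · obtain ⟨x⟩ := ‹Nonempty α›
      exact ⟨P x, IsProbabilityMeasure.ne_zero _, measure_univ.le, fun y hy => (hne ⟨y, hy⟩).elim⟩
  have : IsFiniteMeasure η := ⟨hη1.trans_lt ENNReal.one_lt_top⟩
  set ε := η.real Set.univ with hε
  have hε0 : 0 < ε := by
    rw [hε, measureReal_def, ENNReal.toReal_pos_iff]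
    exact ⟨by simpa [pos_iff_ne_zero] using hη, measure_lt_top _ _⟩
  have hε1 : ε ≤ 1 := by
    rw [hε, measureReal_def]
    exact ENNReal.toReal_mono ENNReal.one_ne_top hη1
  set β := ε / (2 * (C + 1)) with hβ
  have hβ0 : 0 < β := by positivity
  have hβC : 2 * β * C ≤ ε := by
    rw [hβ]; field_simp; nlinarith
  -- The contraction factor of the far case at the worst point `W x + W y = R`.
  set q₁ := (2 + β * ((1 + lam) / 2) * R) / (2 + β * R) with hq₁
  have hq₁0 : 0 < q₁ := by positivity
  have hq₁1 : q₁ < 1 := by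
    rw [hq₁, div_lt_one (by positivity)]
    nlinarith [mul_pos (mul_pos hβ0 hR0) h1l]
  have hq₁R : q₁ * (2 + β * R) = 2 + β * ((1 + lam) / 2) * R := by
    rw [hq₁]; field_simp
  have hq₁l : (1 + lam) / 2 ≤ q₁ := by
    rw [hq₁, le_div_iff₀ (by positivity)]; nlinarith
  refine ⟨β, max q₁ (max (1 - ε / 2) lam), hβ0, lt_max_of_lt_left hq₁0,
    max_lt hq₁1 (max_lt (by linarith) hl1), fun c f hc hf hL => ?_⟩
  set q := max q₁ (max (1 - ε / 2) lam)
  have hqa : q₁ ≤ q := le_max_left _ _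
  have hqb : 1 - ε / 2 ≤ q := (le_max_left _ _).trans (le_max_right _ _)
  have hqc : lam ≤ q := (le_max_right _ _).trans (le_max_right _ _)
  obtain ⟨d, hd'⟩ := hL.exists_shift
  have hWi := hd.integrable hW hW0
  have hWint := hd.integral_le hW hW0 hl hC
  have hbi : ∀ (μ : Measure α) [IsFiniteMeasure μ], Integrable W μ →
      Integrable (fun x => c * (1 + β * W x)) μ := fun μ _ h =>
    ((integrable_const 1).add (h.const_mul β)).const_mul c
  have hgi : ∀ (μ : Measure α) [IsFiniteMeasure μ], Integrable W μ →
      Integrable (fun x => f x - d) μ := fun μ _ h =>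
    (hbi μ h).mono' (hf.sub_const d).aestronglyMeasurable (ae_of_all _ hd')
  have hbound : ∀ (μ : Measure α) [IsFiniteMeasure μ], Integrable W μ →
      |∫ x, (f x - d) ∂μ| ≤ c * (μ.real Set.univ + β * ∫ x, W x ∂μ) := fun μ _ h => by
    refine (abs_integral_le_of_abs_le (hbi μ h) hd').trans_eq ?_
    rw [integral_const_mul, integral_add (integrable_const 1) (h.const_mul β), integral_const_mul]
    simp
  have hshift : ∀ x, ∫ y, f y ∂P x = ∫ y, (f y - d) ∂P x + d := fun x => by
    have := integral_add (hgi (P x) (hWi x)) (integrable_const d)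
    simp only [sub_add_cancel, integral_const, probReal_univ, one_smul] at this
    exact this
  intro x y
  have hx0 := hW0 x
  have hy0 := hW0 y
  simp only
  rw [hshift x, hshift y, add_sub_add_right_eq_sub]
  set w := W x + W y with hw
  rcases le_or_gt R w with hwR | hwR
  · have h1 := hbound (P x) (hWi x)
    have h2 := hbound (P y) (hWi y)
    rw [probReal_univ] at h1 h2
    have h3 : |∫ z, (f z - d) ∂P x - ∫ z, (f z - d) ∂P y| ≤ c * (2 + β * (lam * w + 2 * C)) := by
      refine (abs_sub _ _).trans ((add_le_add h1 h2).trans ?_)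
      rw [← mul_add]
      refine mul_le_mul_of_nonneg_left ?_ hc
      nlinarith [mul_le_mul_of_nonneg_left (hWint x) hβ0.le,
        mul_le_mul_of_nonneg_left (hWint y) hβ0.le]
    refine h3.trans ?_
    have h4 : 2 + β * (lam * w + 2 * C) ≤ q * (2 + β * W x + β * W y) := by
      have e : 2 + β * W x + β * W y = 2 + β * w := by rw [hw]; ring
      rw [e]
      have h5 : q₁ * (2 + β * w) ≤ q * (2 + β * w) :=
        mul_le_mul_of_nonneg_right hqa (by positivity)
      have h6 : 2 * C ≤ (1 - lam) / 2 * w := hRC.trans (by gcongr)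
      have h7 : 0 ≤ β * (q₁ - (1 + lam) / 2) * (w - R) :=
        mul_nonneg (mul_nonneg hβ0.le (by linarith)) (by linarith)
      nlinarith [mul_le_mul_of_nonneg_left h6 hβ0.le]
    exact (mul_le_mul_of_nonneg_left h4 hc).trans_eq (by ring)
  · have hs : ∀ z, W z ≤ R → ∃ ξ : Measure α, IsFiniteMeasure ξ ∧ Integrable W ξ ∧
        ξ.real Set.univ = 1 - ε ∧ ∫ v, W v ∂ξ ≤ lam * W z + C ∧
        ∫ v, (f v - d) ∂P z = ∫ v, (f v - d) ∂ξ + ∫ v, (f v - d) ∂η := by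
      intro z hz
      have hle := hηP z hz
      have hadd := Measure.sub_add_cancel_of_le hle
      have hξ : P z - η ≤ P z := Measure.sub_le
      have hfin : IsFiniteMeasure (P z - η) := isFiniteMeasure_of_le _ hξ
      refine ⟨P z - η, hfin, (hWi z).mono_measure hξ, ?_, ?_, ?_⟩
      · have := congrArg (fun μ : Measure α => μ.real Set.univ) hadd
        rw [measureReal_add_apply, probReal_univ (μ := P z)] at this
        exact eq_sub_of_add_eq this
      · exact (integral_mono_measure hξ (ae_of_all _ hW0) (hWi z)).trans (hWint z)
      · conv_lhs => rw [← hadd]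
        exact integral_add_measure (hgi _ ((hWi z).mono_measure hξ))
          (hgi _ ((hWi z).mono_measure hle))
    obtain ⟨ξ₁, _, i1, m1, w1, e1⟩ := hs x (by linarith)
    obtain ⟨ξ₂, _, i2, m2, w2, e2⟩ := hs y (by linarith)
    rw [e1, e2, add_sub_add_right_eq_sub]
    have h1 := hbound ξ₁ i1
    have h2 := hbound ξ₂ i2
    rw [m1] at h1
    rw [m2] at h2
    have h3 : |∫ z, (f z - d) ∂ξ₁ - ∫ z, (f z - d) ∂ξ₂|
        ≤ c * (2 - 2 * ε + β * (lam * w + 2 * C)) := by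
      refine (abs_sub _ _).trans ((add_le_add h1 h2).trans ?_)
      rw [← mul_add]
      refine mul_le_mul_of_nonneg_left ?_ hc
      nlinarith [mul_le_mul_of_nonneg_left w1 hβ0.le, mul_le_mul_of_nonneg_left w2 hβ0.le]
    refine h3.trans ?_
    have h4 : 2 - 2 * ε + β * (lam * w + 2 * C) ≤ q * (2 + β * W x + β * W y) := by
      have e : 2 + β * W x + β * W y = 2 + β * w := by rw [hw]; ring
      rw [e]
      have hw0 : 0 ≤ β * w := by positivity
      have e2 : β * (lam * w + 2 * C) = lam * (β * w) + 2 * β * C := by ring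
      have e3 : q * (2 + β * w) = 2 * q + q * (β * w) := by ring
      have := mul_le_mul_of_nonneg_right hqc hw0
      linarith
    exact (mul_le_mul_of_nonneg_left h4 hc).trans_eq (by ring)

theorem tvDist_le_of_forall {ν₁ ν₂ : Measure α} {c : ℝ}
    (h : ∀ s, MeasurableSet s → |ν₁.real s - ν₂.real s| ≤ c) : tvDist ν₁ ν₂ ≤ c :=
  haveI : Nonempty {s : Set α // MeasurableSet s} := ⟨⟨∅, MeasurableSet.empty⟩⟩
  ciSup_le fun s => h s.1 s.2

/-- Total variation bound for initial laws with a square integrable density. -/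
theorem abs_integral_le_of_rnDeriv_sq {π ν : Measure α} [IsProbabilityMeasure π]
    [IsProbabilityMeasure ν] (hν : ν ≪ π) {u D : α → ℝ} (hu : Measurable u) {r : ℝ} (hr : 0 < r)
    (hu1 : ∀ x, |u x| ≤ 1) (huD : ∀ x, |u x| ≤ r ^ 2 * D x)
    (hνfin : ∫⁻ x, (ν.rnDeriv π x) ^ 2 ∂π < ∞)
    (hDfin : ∫⁻ x, ENNReal.ofReal (D x) ∂π < ∞) :
    |∫ x, u x ∂ν| ≤ ((∫⁻ x, (ν.rnDeriv π x) ^ 2 ∂π).toReal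
      + (∫⁻ x, ENNReal.ofReal (D x) ∂π).toReal) * r := by
  have h1 : |∫ x, u x ∂ν| ≤ (∫⁻ x, ENNReal.ofReal |u x| ∂ν).toReal := by
    rw [← Real.norm_eq_abs]
    exact norm_integral_le_lintegral_norm u
  refine h1.trans ?_
  -- An AM-GM step: `|u|² ≤ |u| ≤ r² D` gives `g |u| ≤ r (g² + D)`, by comparing `|u|` with `r g`.
  -- Only `∫ g² dπ` and `∫ D dπ` enter, so `W` need not be `ν`-integrable.
  have hpt : ∀ x, ν.rnDeriv π x * ENNReal.ofReal |u x|
      ≤ ENNReal.ofReal r * (ν.rnDeriv π x ^ 2 + ENNReal.ofReal (D x)) := by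
    intro x
    have hD : ENNReal.ofReal |u x| ^ 2 ≤ ENNReal.ofReal r ^ 2 * ENNReal.ofReal (D x) := by
      rw [← ENNReal.ofReal_pow hr.le, ← ENNReal.ofReal_mul (by positivity),
        ← ENNReal.ofReal_pow (abs_nonneg _)]
      refine ENNReal.ofReal_le_ofReal (le_trans ?_ (huD x))
      nlinarith [hu1 x, abs_nonneg (u x)]
    set g := ν.rnDeriv π x
    set v := ENNReal.ofReal |u x|
    have hr0 : ENNReal.ofReal r ≠ 0 := by simpa using hr
    rcases le_total v (ENNReal.ofReal r * g) with h | h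
    · calc g * v ≤ g * (ENNReal.ofReal r * g) := by gcongr
        _ = ENNReal.ofReal r * g ^ 2 := by ring
        _ ≤ _ := by gcongr; exact le_self_add
    · refine (ENNReal.mul_le_mul_iff_right hr0 ENNReal.ofReal_ne_top).1 ?_
      calc ENNReal.ofReal r * (g * v) = (ENNReal.ofReal r * g) * v := by ring
        _ ≤ v * v := by gcongr
        _ = v ^ 2 := by ring
        _ ≤ ENNReal.ofReal r ^ 2 * ENNReal.ofReal (D x) := hD
        _ = ENNReal.ofReal r * (ENNReal.ofReal r * ENNReal.ofReal (D x)) := by ring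
        _ ≤ _ := by gcongr; exact le_add_self
  have h2 : ∫⁻ x, ENNReal.ofReal |u x| ∂ν ≤ ENNReal.ofReal r *
      (∫⁻ x, ν.rnDeriv π x ^ 2 ∂π + ∫⁻ x, ENNReal.ofReal (D x) ∂π) := by
    rw [← lintegral_rnDeriv_mul hν (by fun_prop),
      ← lintegral_add_left ((Measure.measurable_rnDeriv ν π).pow_const 2),
      ← lintegral_const_mul' _ _ ENNReal.ofReal_ne_top]
    exact lintegral_mono hpt
  refine (ENNReal.toReal_mono ?_ h2).trans_eq ?_
  · exact ENNReal.mul_ne_top ENNReal.ofReal_ne_top (ENNReal.add_ne_top.2 ⟨hνfin.ne, hDfin.ne⟩)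
  · rw [ENNReal.toReal_mul, ENNReal.toReal_ofReal hr.le, ENNReal.toReal_add hνfin.ne hDfin.ne]
    ring

theorem measurable_kernel_real {P : Kernel α α} {s : Set α} (hs : MeasurableSet s) :
    Measurable fun x => (P x).real s :=
  (P.measurable_coe hs).ennreal_toReal

theorem integral_kernel_real_eq {P : Kernel α α} [IsMarkovKernel P] {ν : Measure α}
    [IsProbabilityMeasure ν] {s : Set α} (hs : MeasurableSet s) :
    ∫ x, (P x).real s ∂ν = (ν.bind P).real s := by
  rw [measureReal_def, Measure.bind_apply hs (Kernel.aemeasurable _)]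
  exact integral_toReal (P.measurable_coe hs).aemeasurable (ae_of_all _ fun x => measure_lt_top _ _)

/-- **Harris' theorem**, in the form of an `L²`-geometric ergodicity statement. -/
theorem isGeometricallyErgodic_of_drift_of_minorization {P : Kernel α α} [IsMarkovKernel P]
    {π : Measure α} [IsProbabilityMeasure π] (hπ : P.Invariant π) {W : α → ℝ} {lam C : ℝ}
    (hd : GeometricDrift P W lam C) (hW : Measurable W) (hW0 : ∀ x, 0 ≤ W x)
    (hl : 0 ≤ lam) (hl1 : lam < 1) (hC : 0 ≤ C)
    (hm : ∀ R, ∃ η : Measure α, η ≠ 0 ∧ ∀ x, W x ≤ R → η ≤ P x) :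
    IsGeometricallyErgodic P π := by
  have hne : Nonempty α := nonempty_of_isProbabilityMeasure π
  have hMk := isMarkovKernel_pow P
  have hπt : ∀ t : ℕ, (P ^ t).Invariant π := by
    intro t
    induction t with
    | zero => exact Measure.id_comp
    | succ t ih => exact ih.comp hπ
  obtain ⟨β, q, hβ, hq, hq1, hcontr⟩ := WLip.contraction hd hW hW0 hl hl1 hC hm
  have hπW := hd.lintegral_invariant_le hW hW0 hl hl1 hC hπt
  have hWint : Integrable W π := by
    refine ⟨hW.aestronglyMeasurable, ?_⟩
    rw [hasFiniteIntegral_iff_ofReal (Eventually.of_forall hW0)]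
    exact hπW.trans_lt ENNReal.ofReal_lt_top
  have hLip : ∀ s, MeasurableSet s → ∀ t : ℕ, WLip W β (q ^ t) fun x => ((P ^ t) x).real s := by
    intro s hs t
    induction t with
    | zero =>
      intro x y
      have := (hMk 0).isProbabilityMeasure x
      have := (hMk 0).isProbabilityMeasure y
      have h1 := hW0 x
      have h2 := hW0 y
      have : (1 : ℝ) ≤ q ^ 0 * (2 + β * W x + β * W y) := by
        have : 0 ≤ β * W x := by positivity
        have : 0 ≤ β * W y := by positivity
        simp only [pow_zero]
        linarith
      refine le_trans ?_ this
      rw [abs_le]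
      constructor <;> linarith [measureReal_nonneg (μ := (P ^ 0) x) (s := s),
        measureReal_nonneg (μ := (P ^ 0) y) (s := s), measureReal_le_one (μ := (P ^ 0) x) (s := s),
        measureReal_le_one (μ := (P ^ 0) y) (s := s)]
    | succ t ih =>
      have := hcontr (q ^ t) _ (by positivity) (measurable_kernel_real hs) ih
      rw [pow_succ' q]
      convert this using 2 with x
      have := hMk t
      rw [integral_kernel_real_eq hs]
      rfl
  -- The Lipschitz bound on `P ^ t` averaged over the second point with respect to `π`: it bounds
  -- the distance from `P ^ t` at `x` to `π` by `q ^ t * D x`.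
  set D : α → ℝ := fun x => 2 + β * W x + β * ∫ y, W y ∂π with hD
  have hIW : 0 ≤ ∫ y, W y ∂π := integral_nonneg hW0
  -- The pointwise rate is `q`; passing to initial laws with square-integrable density costs a
  -- square root.
  refine ⟨inferInstance, inferInstance, hπ, √q, Real.sqrt_pos.2 hq, ?_, fun ν hνP hν hν2 => ?_⟩
  · rw [Real.sqrt_lt' one_pos]; simpa using hq1
  have hDi : Integrable D π := ((integrable_const _).add (hWint.const_mul _)).add (integrable_const _)
  have hDfin : ∫⁻ x, ENNReal.ofReal (D x) ∂π < ∞ := by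
    have := hDi.2
    rwa [hasFiniteIntegral_iff_ofReal] at this
    exact Eventually.of_forall fun x => by have := hW0 x; simp only [hD]; positivity
  refine ⟨(∫⁻ x, (ν.rnDeriv π x) ^ 2 ∂π).toReal + (∫⁻ x, ENNReal.ofReal (D x) ∂π).toReal + 1,
    by positivity, fun t => tvDist_le_of_forall fun s hs => ?_⟩
  have := hMk t
  set f : α → ℝ := fun x => ((P ^ t) x).real s with hf
  have hfm : Measurable f := measurable_kernel_real hs
  have hfint : ∀ ξ : Measure α, IsProbabilityMeasure ξ → Integrable f ξ := fun ξ _ =>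
    Integrable.of_bound hfm.aestronglyMeasurable 1 (ae_of_all _ fun x => by
      rw [Real.norm_eq_abs, abs_of_nonneg measureReal_nonneg]; exact measureReal_le_one)
  have hπf : ∫ y, f y ∂π = π.real s := by
    rw [hf, integral_kernel_real_eq hs]
    exact congrArg (fun μ : Measure α => μ.real s) (hπt t)
  have hνf : ∫ y, (f y - π.real s) ∂ν = (ν.bind (P ^ t)).real s - π.real s := by
    rw [integral_sub (hfint ν hνP) (integrable_const _), hf, integral_kernel_real_eq hs]
    simp
  rw [← hνf]
  refine (abs_integral_le_of_rnDeriv_sq hν (D := D) (hfm.sub_const _)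
    (pow_pos (Real.sqrt_pos.2 hq) t) (fun x => ?_) (fun x => ?_) hν2 hDfin).trans ?_
  · rw [abs_le]
    constructor <;> linarith [measureReal_nonneg (μ := (P ^ t) x) (s := s),
        measureReal_nonneg (μ := π) (s := s), measureReal_le_one (μ := (P ^ t) x) (s := s),
        measureReal_le_one (μ := π) (s := s)]
  · have e : f x - π.real s = ∫ y, (f x - f y) ∂π := by
      rw [integral_sub (integrable_const _) (hfint π inferInstance), hπf]; simp
    rw [e, ← pow_mul, mul_comm t 2, pow_mul, Real.sq_sqrt hq.le]
    refine (abs_integral_le_of_abs_le ?_ (hLip s hs t x)).trans_eq ?_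
    · exact ((integrable_const _).add (hWint.const_mul _)).const_mul _
    · rw [integral_const_mul, integral_add (integrable_const _) (hWint.const_mul _),
        integral_const_mul]
      simp [hD]
  · exact mul_le_mul_of_nonneg_right (by linarith) (by positivity)

end Harris

/-! ### Finite products of densities -/

section PiDensity

variable {E : Type*} [MeasurableSpace E]

theorem lintegral_fin_prod_eq_prod {n : ℕ} {μ : Fin n → Measure E} [∀ i, SigmaFinite (μ i)]
    {f : Fin n → E → ℝ≥0∞} (hf : ∀ i, Measurable (f i)) :
    ∫⁻ x, ∏ i, f i (x i) ∂(Measure.pi μ) = ∏ i, ∫⁻ x, f i x ∂(μ i) := by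
  induction n with
  | zero => simp
  | succ n ih =>
    have hm : Measurable fun x : Fin n → E => ∏ j, f (Fin.succ j) (x j) :=
      Finset.measurable_prod _ fun i _ => (hf _).comp (measurable_pi_apply i)
    have hm' : Measurable fun x : Fin (n + 1) → E => ∏ j, f j (x j) :=
      Finset.measurable_prod _ fun i _ => (hf _).comp (measurable_pi_apply i)
    rw [← ((measurePreserving_piFinSuccAbove μ 0).symm).lintegral_comp hm', Fin.prod_univ_succ,
      ← ih (μ := fun i => μ i.succ) (fun i => hf i.succ)]
    have := lintegral_prod_mul (μ := μ 0) (ν := Measure.pi fun i => μ (Fin.succ i))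
      (hf 0).aemeasurable hm.aemeasurable
    rw [← this]
    refine lintegral_congr fun x => ?_
    simp_rw [MeasurableEquiv.piFinSuccAbove_symm_apply, Fin.insertNthEquiv, Fin.prod_univ_succ]
    simp

theorem pi_withDensity {n : ℕ} {μ : Fin n → Measure E} [∀ i, SigmaFinite (μ i)]
    {f : Fin n → E → ℝ≥0∞} (hf : ∀ i, Measurable (f i))
    (hs : ∀ i, SigmaFinite ((μ i).withDensity (f i))) :
    Measure.pi (fun i => (μ i).withDensity (f i))
      = (Measure.pi μ).withDensity fun x => ∏ i, f i (x i) := by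
  have := hs
  refine Measure.pi_eq fun s hs => ?_
  rw [withDensity_apply _ (MeasurableSet.univ_pi hs),
    ← lintegral_indicator (MeasurableSet.univ_pi hs)]
  have : ∀ x : Fin n → E, (Set.univ.pi s).indicator (fun x => ∏ i, f i (x i)) x
      = ∏ i, (s i).indicator (f i) (x i) := by
    intro x
    by_cases hx : x ∈ Set.univ.pi s
    · rw [Set.indicator_of_mem hx]
      exact Finset.prod_congr rfl fun i _ => (Set.indicator_of_mem (hx i trivial) _).symm
    · rw [Set.indicator_of_notMem hx]
      simp only [Set.mem_pi, not_forall] at hx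
      obtain ⟨i, -, hi⟩ := hx
      exact (Finset.prod_eq_zero (Finset.mem_univ i) (Set.indicator_of_notMem hi _)).symm
  rw [lintegral_congr this, lintegral_fin_prod_eq_prod fun i => (hf i).indicator (hs i)]
  refine Finset.prod_congr rfl fun i _ => ?_
  rw [withDensity_apply _ (hs i), lintegral_indicator (hs i)]

end PiDensity

/-! ### Gaussian densities -/

section Gaussian

open scoped MatrixOrder

variable {n : ℕ}

theorem gaussianDensity_nonneg (Q : Matrix (Fin n) (Fin n) ℝ) (c x : Fin n → ℝ) :
    0 ≤ gaussianDensity Q c x := by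
  unfold gaussianDensity; positivity

theorem measurable_gaussianDensity_right (Q : Matrix (Fin n) (Fin n) ℝ) (c : Fin n → ℝ) :
    Measurable (gaussianDensity Q c) :=
  measurable_gaussianDensity (Q := fun _ => Q) (c := fun _ => c) (x := id)
    (fun _ _ => measurable_const) (fun _ => measurable_const) fun i => measurable_pi_apply i

theorem lintegral_affine {L : Matrix (Fin n) (Fin n) ℝ} (hL : L.det ≠ 0) (c : Fin n → ℝ)
    {g : (Fin n → ℝ) → ℝ≥0∞} (hg : Measurable g) :
    ∫⁻ x, g x = ENNReal.ofReal |L.det| * ∫⁻ z, g (c + L *ᵥ z) := by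
  have h1 : ∫⁻ x, g x = ∫⁻ x, g (c + x) := (lintegral_add_left_eq_self g c).symm
  have hLm : Measurable fun z : Fin n → ℝ => L *ᵥ z := by
    refine measurable_pi_lambda _ fun i => ?_
    simp only [mulVec, dotProduct]
    fun_prop
  have h2 := Real.map_matrix_volume_pi_eq_smul_volume_pi hL
  have h3 : ∫⁻ x, g (c + x) ∂(Measure.map (toLin' L) volume) = ∫⁻ z, g (c + L *ᵥ z) :=
    lintegral_map (by fun_prop) hLm
  rw [h1, ← h3, h2, lintegral_smul_measure, smul_eq_mul, ← mul_assoc,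
    ← ENNReal.ofReal_mul (abs_nonneg _), ← abs_mul, mul_inv_cancel₀ hL]
  simp

theorem pi_gaussianReal_eq : Measure.pi (fun _ : Fin n => gaussianReal 0 1)
    = volume.withDensity fun z => ∏ i, gaussianPDF 0 1 (z i) := by
  have h : gaussianReal 0 1 = volume.withDensity (gaussianPDF 0 1) :=
    gaussianReal_of_var_ne_zero 0 one_ne_zero
  have hs : ∀ i : Fin n, SigmaFinite ((volume : Measure ℝ).withDensity (gaussianPDF 0 1)) :=
    fun _ => by rw [← h]; infer_instance
  simp_rw [h]
  exact pi_withDensity (μ := fun _ => (volume : Measure ℝ)) (fun _ => measurable_gaussianPDF 0 1) hs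

/-- The substitution whitens the quadratic form, and taking determinants in `Lᵀ Q L = 1` gives `(det
L)² det Q = 1`, which matches the normalising constants. -/
theorem gaussianDensity_affine {Q L : Matrix (Fin n) (Fin n) ℝ} (hLQ : Lᵀ * Q * L = 1)
    (c z : Fin n → ℝ) :
    |L.det| * gaussianDensity Q c (c + L *ᵥ z) = ∏ i, gaussianPDFReal 0 1 (z i) := by
  have hdet : L.det ^ 2 * Q.det = 1 := by
    have := congrArg Matrix.det hLQ
    rw [det_mul, det_mul, det_transpose, det_one] at this
    linarith
  have hq : (L *ᵥ z) ⬝ᵥ (Q *ᵥ (L *ᵥ z)) = z ⬝ᵥ z := by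
    rw [mulVec_mulVec, ← vecMul_transpose, dotProduct_mulVec, vecMul_vecMul,
      ← dotProduct_mulVec, ← mul_assoc, hLQ, one_mulVec]
  unfold gaussianDensity
  rw [add_sub_cancel_left, hq, ← mul_assoc, ← Real.sqrt_sq_eq_abs, ← Real.sqrt_mul (sq_nonneg _),
    ← mul_div_assoc, hdet]
  simp only [gaussianPDFReal, NNReal.coe_one, mul_one, sub_zero, Finset.prod_mul_distrib,
    Finset.prod_const, Finset.card_univ, Fintype.card_fin]
  rw [← Real.exp_sum, one_div, Real.sqrt_inv, inv_pow]
  congr 2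
  · rw [Real.sqrt_eq_rpow, Real.sqrt_eq_rpow, ← Real.rpow_natCast, ← Real.rpow_natCast,
      ← Real.rpow_mul (by positivity), ← Real.rpow_mul (by positivity), mul_comm (n : ℝ)]
  · rw [dotProduct, Finset.mul_sum]
    exact Finset.sum_congr rfl fun i _ => by ring

/-- Whitening with the symmetric square root of `Q⁻¹`. The identification makes coordinate marginals
available: the `i`-th one has variance `Q⁻¹ i i`. -/
theorem withDensity_gaussianDensity_eq {Q : Matrix (Fin n) (Fin n) ℝ} (hQ : Q.PosDef)
    (c : Fin n → ℝ) :
    volume.withDensity (fun x => ENNReal.ofReal (gaussianDensity Q c x))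
      = (multivariateGaussian (WithLp.toLp 2 c) Q⁻¹).map WithLp.ofLp := by
  set L := CFC.sqrt Q⁻¹ with hL
  have hLL : L * L = Q⁻¹ := CFC.sqrt_mul_sqrt_self _ hQ.inv.posSemidef.nonneg
  have hQu : IsUnit Q.det := hQ.det_pos.ne'.isUnit
  have hLT : Lᵀ = L := by
    have := (CFC.sqrt_nonneg Q⁻¹).isSelfAdjoint
    rw [isSelfAdjoint_iff, star_eq_conjTranspose, conjTranspose_eq_transpose_of_trivial] at this
    exact this
  have hLd : L.det ≠ 0 := by
    intro h
    have := congrArg Matrix.det hLL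
    rw [det_mul, h, mul_zero] at this
    exact hQ.inv.det_pos.ne this
  have hLQ : Lᵀ * Q * L = 1 := by
    have hu : IsUnit L.det := hLd.isUnit
    have h1 : L * (L * Q) = 1 := by rw [← mul_assoc, hLL, nonsing_inv_mul _ hQu]
    rw [hLT]
    exact mul_eq_one_comm.1 h1
  have hLm : Measurable fun z : Fin n → ℝ => c + L *ᵥ z := by
    refine measurable_pi_lambda _ fun i => ?_
    simp only [mulVec, dotProduct, Pi.add_apply]
    fun_prop
  have h2 : (multivariateGaussian (WithLp.toLp 2 c) Q⁻¹).map WithLp.ofLp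
      = (Measure.pi fun _ : Fin n => gaussianReal 0 1).map fun z => c + L *ᵥ z := by
    rw [multivariateGaussian, ← map_pi_eq_stdGaussian, Measure.map_map (by fun_prop) (by fun_prop),
      Measure.map_map (by fun_prop) (by fun_prop)]
    rfl
  rw [h2, pi_gaussianReal_eq]
  refine Measure.ext_of_lintegral _ fun g hg => ?_
  have hgd := (measurable_gaussianDensity_right Q c).ennreal_ofReal
  have hpd : Measurable fun z : Fin n → ℝ => ∏ i, gaussianPDF 0 1 (z i) :=
    Finset.measurable_prod _ fun i _ => (measurable_gaussianPDF 0 1).comp (measurable_pi_apply i)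
  rw [lintegral_withDensity_eq_lintegral_mul _ hgd hg, lintegral_map hg hLm,
    lintegral_withDensity_eq_lintegral_mul _ hpd (g := fun z => g (c + L *ᵥ z)) (hg.comp hLm),
    lintegral_affine hLd c (hgd.mul hg), ← lintegral_const_mul' _ _ ENNReal.ofReal_ne_top]
  refine lintegral_congr fun z => ?_
  simp only [Pi.mul_apply, ← mul_assoc]
  rw [← ENNReal.ofReal_mul (abs_nonneg _), gaussianDensity_affine hLQ,
    ENNReal.ofReal_prod_of_nonneg fun i _ => gaussianPDFReal_nonneg _ _ _]
  rfl

theorem lintegral_gaussianDensity_eval {Q : Matrix (Fin n) (Fin n) ℝ} (hQ : Q.PosDef)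
    (c : Fin n → ℝ) (i : Fin n) {g : ℝ → ℝ≥0∞} (hg : Measurable g) :
    ∫⁻ x, g (x i) * ENNReal.ofReal (gaussianDensity Q c x)
      = ∫⁻ y, g y ∂gaussianReal (c i) (Q⁻¹ i i).toNNReal := by
  have h := measurePreserving_eval_multivariateGaussian (μ := WithLp.toLp 2 c)
    hQ.inv.posSemidef (i := i)
  have hgd := (measurable_gaussianDensity_right Q c).ennreal_ofReal
  have hgi : Measurable fun x : Fin n → ℝ => g (x i) := hg.comp (measurable_pi_apply i)
  rw [← h.map_eq, lintegral_map hg h.measurable]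
  have := lintegral_map (μ := multivariateGaussian (WithLp.toLp 2 c) Q⁻¹) hgi
    (WithLp.measurable_ofLp 2 (Fin n → ℝ))
  rw [← this, ← withDensity_gaussianDensity_eq hQ, lintegral_withDensity_eq_lintegral_mul _ hgd hgi]
  exact lintegral_congr fun x => mul_comm _ _

theorem lintegral_gaussianDensity {Q : Matrix (Fin n) (Fin n) ℝ} (hQ : Q.PosDef)
    (c : Fin n → ℝ) : ∫⁻ x, ENNReal.ofReal (gaussianDensity Q c x) = 1 := by
  have h := congrArg (fun μ : Measure (Fin n → ℝ) => μ Set.univ)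
    (withDensity_gaussianDensity_eq hQ c)
  simp only [withDensity_apply _ MeasurableSet.univ, Measure.restrict_univ] at h
  rw [h, Measure.map_apply (WithLp.measurable_ofLp 2 _) MeasurableSet.univ]
  simp

end Gaussian

/-! ### An inequality for the Gamma function -/

/-- Chebyshev's association argument: `(x^s - c^s)(x^t - c^t)` is positive away from `x = c`, since
both factors have the same sign. It is integrated against the Gamma weight `x^(α-1) e^(-x)`, and
`c^s` is taken to be the mean of `x^s` under the normalised weight, so that the terms containing
`c^t` cancel. -/
theorem Gamma_mul_Gamma_lt {α s t : ℝ} (hα : 0 < α) (hs : 0 < s) (ht : 0 < t) :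
    Real.Gamma (α + s) * Real.Gamma (α + t) < Real.Gamma α * Real.Gamma (α + s + t) := by
  have hG : ∀ {r : ℝ}, 0 < r → 0 < Real.Gamma r := Real.Gamma_pos_of_pos
  set c := (Real.Gamma (α + s) / Real.Gamma α) ^ (1 / s) with hc
  have hc0 : 0 < c := by have := hG hα; have := hG (add_pos hα hs); positivity
  have hcs : c ^ s = Real.Gamma (α + s) / Real.Gamma α := by
    have := hG hα
    have := hG (add_pos hα hs)
    rw [hc, ← Real.rpow_mul (by positivity), one_div_mul_cancel hs.ne', Real.rpow_one]
  set F : ℝ → ℝ → ℝ := fun r x => Real.exp (-x) * x ^ (r - 1) with hF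
  have hint : ∀ {r : ℝ}, 0 < r → IntegrableOn (F r) (Set.Ioi 0) := fun h =>
    Real.GammaIntegral_convergent h
  have hval : ∀ {r : ℝ}, 0 < r → ∫ x in Set.Ioi 0, F r x = Real.Gamma r := fun h =>
    (Real.Gamma_eq_integral h).symm
  set g : ℝ → ℝ := fun x => F (α + s + t) x - c ^ t * F (α + s) x - (c ^ s * F (α + t) x
    - c ^ s * c ^ t * F α x) with hg
  have hgi : IntegrableOn g (Set.Ioi 0) := by
    refine Integrable.sub (Integrable.sub (hint (by positivity)) ?_) (Integrable.sub ?_ ?_)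
    exacts [(hint (by positivity)).const_mul _, (hint (by positivity)).const_mul _,
      (hint hα).const_mul _]
  have hgv : ∫ x in Set.Ioi 0, g x = Real.Gamma (α + s + t) - c ^ t * Real.Gamma (α + s)
      - (c ^ s * Real.Gamma (α + t) - c ^ s * c ^ t * Real.Gamma α) := by
    have i1 := hint (show 0 < α + s + t by positivity)
    have i2 := (hint (show 0 < α + s by positivity)).const_mul (c ^ t)
    have i3 := (hint (show 0 < α + t by positivity)).const_mul (c ^ s)
    have i4 := (hint hα).const_mul (c ^ s * c ^ t)
    have e1 := integral_sub (i1.sub i2) (i3.sub i4)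
    have e2 := integral_sub i1 i2
    have e3 := integral_sub i3 i4
    simp only [Pi.sub_apply] at e1
    rw [e1, e2, e3, integral_const_mul, integral_const_mul, integral_const_mul, hval, hval, hval, hval]
    all_goals positivity
  have hgx : ∀ x ∈ Set.Ioi (0 : ℝ), g x = F α x * ((x ^ s - c ^ s) * (x ^ t - c ^ t)) := by
    intro x hx
    have hx : 0 < x := hx
    have e1 : x ^ (α + s + t - 1) = x ^ (α - 1) * x ^ s * x ^ t := by
      rw [← Real.rpow_add hx, ← Real.rpow_add hx]; ring_nf
    have e2 : x ^ (α + s - 1) = x ^ (α - 1) * x ^ s := by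
      rw [← Real.rpow_add hx]; ring_nf
    have e3 : x ^ (α + t - 1) = x ^ (α - 1) * x ^ t := by
      rw [← Real.rpow_add hx]; ring_nf
    simp only [hg, hF, e1, e2, e3]
    ring
  have hpos : ∀ x ∈ Set.Ioi (0 : ℝ), x ≠ c → 0 < g x := by
    intro x hx hxc
    rw [hgx x hx]
    have hx : 0 < x := hx
    refine mul_pos (by simp only [hF]; positivity) ?_
    rcases lt_or_gt_of_ne hxc with h | h
    · exact mul_pos_of_neg_of_neg (sub_neg.2 (Real.rpow_lt_rpow hx.le h hs))
        (sub_neg.2 (Real.rpow_lt_rpow hx.le h ht))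
    · exact mul_pos (sub_pos.2 (Real.rpow_lt_rpow hc0.le h hs))
        (sub_pos.2 (Real.rpow_lt_rpow hc0.le h ht))
  have hnn : ∀ x ∈ Set.Ioi (0 : ℝ), 0 ≤ g x := by
    intro x hx
    by_cases hxc : x = c
    · rw [hgx x hx, hxc]; simp
    · exact (hpos x hx hxc).le
  have hI : 0 < ∫ x in Set.Ioi 0, g x := by
    rw [setIntegral_pos_iff_support_of_nonneg_ae
      ((ae_restrict_iff' measurableSet_Ioi).2 (ae_of_all _ hnn)) hgi]
    refine lt_of_lt_of_le ?_ (measure_mono (show Set.Ioi c ⊆ _ from fun x hx =>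
      ⟨(hpos x (hc0.trans hx) (ne_of_gt hx)).ne', hc0.trans hx⟩))
    simp
  rw [hgv, hcs] at hI
  have hA := hG hα
  have e : Real.Gamma (α + s) / Real.Gamma α * c ^ t * Real.Gamma α
      = c ^ t * Real.Gamma (α + s) := by field_simp
  rw [e] at hI
  have h2 : Real.Gamma (α + s) / Real.Gamma α * Real.Gamma (α + t) < Real.Gamma (α + s + t) := by
    linarith
  calc _ = Real.Gamma α * (Real.Gamma (α + s) / Real.Gamma α * Real.Gamma (α + t)) := by
        field_simp
    _ < _ := by gcongr

/-! ### Absolute moments of one-dimensional Gaussian distributions -/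

/-- The absolute moment `E |Z|^q` of a standard Gaussian variable `Z`. -/
def gaussAbsMoment (q : ℝ) : ℝ := 2 ^ (q / 2) * Real.Gamma ((q + 1) / 2) / √Real.pi

theorem gaussAbsMoment_pos {q : ℝ} (hq : -1 < q) : 0 < gaussAbsMoment q := by
  have : 0 < Real.Gamma ((q + 1) / 2) := Real.Gamma_pos_of_pos (by linarith)
  unfold gaussAbsMoment
  positivity

theorem lintegral_abs_rpow_gaussianReal {q : ℝ} (hq : -1 < q) :
    ∫⁻ y, ENNReal.ofReal |y| ^ q ∂gaussianReal 0 1 = ENNReal.ofReal (gaussAbsMoment q) := by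
  have hm : Measurable fun y : ℝ => ENNReal.ofReal |y| ^ q := by fun_prop
  rw [gaussianReal_of_var_ne_zero 0 one_ne_zero,
    lintegral_withDensity_eq_lintegral_mul _ (measurable_gaussianPDF 0 1) hm]
  set h : ℝ → ℝ≥0∞ := (gaussianPDF 0 1 * fun y : ℝ => ENNReal.ofReal |y| ^ q) with hh
  have heven : ∀ y, h (-y) = h y := by
    intro y
    simp [hh, gaussianPDF, gaussianPDFReal]
  have hsplit : ∫⁻ y, h y = 2 * ∫⁻ y in Set.Ioi 0, h y := by
    rw [← lintegral_add_compl h (measurableSet_Ioi (a := (0 : ℝ))), Set.compl_Ioi,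
      setLIntegral_congr Iio_ae_eq_Iic.symm, two_mul]
    congr 1
    have := (Measure.measurePreserving_neg (volume : Measure ℝ)).setLIntegral_comp_emb
      (MeasurableEquiv.neg ℝ).measurableEmbedding h (Set.Iio 0)
    simp only [heven] at this
    rw [this, Set.image_neg_eq_neg, Set.neg_Iio, neg_zero]
  rw [hsplit]
  have hreal : ∫⁻ y in Set.Ioi 0, h y
      = ENNReal.ofReal (∫ y in Set.Ioi (0 : ℝ), (√(2 * Real.pi))⁻¹ *
          (y ^ q * Real.exp (-(1 / 2) * y ^ (2 : ℝ)))) := by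
    rw [ofReal_integral_eq_lintegral_ofReal]
    · refine setLIntegral_congr_fun measurableSet_Ioi fun y hy => ?_
      have hy : 0 < y := hy
      simp only [hh, Pi.mul_apply, gaussianPDF, gaussianPDFReal, abs_of_pos hy]
      rw [ENNReal.ofReal_rpow_of_pos hy, ← ENNReal.ofReal_mul (by positivity)]
      congr 1
      simp only [NNReal.coe_one, mul_one, sub_zero, Real.rpow_two]
      ring_nf
    · exact (integrableOn_rpow_mul_exp_neg_mul_rpow hq two_pos (by norm_num)).const_mul _
    · refine (ae_restrict_iff' measurableSet_Ioi).2 (ae_of_all _ fun y hy => ?_)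
      have hy : 0 < y := hy
      simp only [Pi.zero_apply]
      positivity
  rw [hreal, integral_const_mul, integral_rpow_mul_exp_neg_mul_rpow two_pos hq (by norm_num),
    ← ENNReal.ofReal_ofNat 2, ← ENNReal.ofReal_mul (by norm_num)]
  congr 1
  unfold gaussAbsMoment
  rw [Real.sqrt_mul (by norm_num), one_div, Real.inv_rpow (by norm_num), ← Real.rpow_neg (by norm_num)]
  have e : (2 : ℝ) ^ (-(-(q + 1) / 2)) = 2 ^ (q / 2) * √2 := by
    rw [Real.sqrt_eq_rpow, ← Real.rpow_add two_pos]; ring_nf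
  rw [e]
  field_simp

/-! ### Rearrangement and moments of non-centred Gaussians. -/

theorem ENNReal.mul_add_mul_le {a b c d : ℝ≥0∞} (hab : a ≤ b) (hcd : c ≤ d) :
    a * d + b * c ≤ b * d + a * c := by
  obtain ⟨e, rfl⟩ := le_iff_exists_add.1 hab
  obtain ⟨f, rfl⟩ := le_iff_exists_add.1 hcd
  calc a * (c + f) + (a + e) * c ≤ a * (c + f) + (a + e) * c + e * f := le_self_add
    _ = _ := by ring

/-- The two-term rearrangement inequality is applied to the pair of points `y`, `y + c`. Both
functions decrease in `|·|`, so the products are larger when sorted alike; after integration,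
translation and reflection identify the terms in pairs and the factor `2` cancels. -/
theorem lintegral_even_antitone_shift_le {F φ : ℝ → ℝ≥0∞} (hF : Measurable F) (hφ : Measurable φ)
    (hFa : ∀ x y, |x| ≤ |y| → F y ≤ F x) (hφa : ∀ x y, |x| ≤ |y| → φ y ≤ φ x) (c : ℝ) :
    ∫⁻ y, F (y + c) * φ y ≤ ∫⁻ y, F y * φ y := by
  have hFn : ∀ x, F (-x) = F x := fun x => le_antisymm (hFa _ _ (by simp)) (hFa _ _ (by simp))
  have hφn : ∀ x, φ (-x) = φ x := fun x => le_antisymm (hφa _ _ (by simp)) (hφa _ _ (by simp))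
  have h1 : ∫⁻ y, F (y + c) * φ (y + c) = ∫⁻ y, F y * φ y :=
    lintegral_add_right_eq_self (fun y => F y * φ y) c
  have h2 : ∫⁻ y, F y * φ (y + c) = ∫⁻ y, F (y + c) * φ y := by
    rw [← lintegral_sub_left_eq_self _ (-c)]
    refine lintegral_congr fun y => ?_
    rw [show -c - y = -(y + c) by ring, hFn, show -(y + c) + c = -y by ring, hφn]
  have hpt : ∀ y, F y * φ (y + c) + F (y + c) * φ y ≤ F y * φ y + F (y + c) * φ (y + c) := by
    intro y
    rcases le_total |y| |y + c| with h | h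
    · rw [add_comm]
      exact ENNReal.mul_add_mul_le (hFa _ _ h) (hφa _ _ h)
    · exact (ENNReal.mul_add_mul_le (hFa _ _ h) (hφa _ _ h)).trans_eq (add_comm _ _)
  have h3 := lintegral_mono (μ := (volume : Measure ℝ)) hpt
  rw [lintegral_add_left (by fun_prop), lintegral_add_left (by fun_prop), h1, h2, ← two_mul,
    ← two_mul] at h3
  exact (ENNReal.mul_le_mul_iff_right two_ne_zero ENNReal.ofNat_ne_top).1 h3

theorem gaussianReal_eq_map_std (m : ℝ) {v : ℝ} (hv : 0 ≤ v) :
    gaussianReal m v.toNNReal = (gaussianReal 0 1).map fun z => m + √v * z := by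
  have h1 := gaussianReal_map_const_mul (μ := 0) (v := 1) √v
  have h2 := gaussianReal_map_const_add (μ := √v * 0) (v := (.mk (√v ^ 2) (sq_nonneg _)) * 1) m
  rw [← h1, Measure.map_map (by fun_prop) (by fun_prop)] at h2
  rw [show (fun z => m + √v * z) = (fun x => m + x) ∘ fun x => √v * x from rfl, h2]
  congr 1
  · simp
  · ext; simp [Real.sq_sqrt hv, Real.coe_toNNReal v hv]

/-- For negative `q` both `|y|^q` and the Gaussian density are even and decrease in `|y|`, so the
centred law has the largest moment. The bound is thus uniform in `m`. -/
theorem lintegral_abs_rpow_gaussianReal_le_of_neg {q : ℝ} (hq : -1 < q) (hq0 : q < 0) (m : ℝ)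
    {v : ℝ} (hv : 0 < v) :
    ∫⁻ y, ENNReal.ofReal |y| ^ q ∂gaussianReal m v.toNNReal
      ≤ ENNReal.ofReal (gaussAbsMoment q * v ^ (q / 2)) := by
  have hsv := Real.sqrt_pos.2 hv
  rw [gaussianReal_eq_map_std m hv.le, lintegral_map (by fun_prop) (by fun_prop)]
  have h1 : ∀ z : ℝ, ENNReal.ofReal |m + √v * z| ^ q
      = ENNReal.ofReal (v ^ (q / 2)) * ENNReal.ofReal |z + m / √v| ^ q := by
    intro z
    have : m + √v * z = √v * (z + m / √v) := by field_simp; ring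
    rw [this, abs_mul, ENNReal.ofReal_mul (abs_nonneg _), abs_of_pos hsv,
      ENNReal.mul_rpow_of_ne_top ENNReal.ofReal_ne_top ENNReal.ofReal_ne_top,
      ENNReal.ofReal_rpow_of_pos hsv, Real.sqrt_eq_rpow, ← Real.rpow_mul hv.le]
    ring_nf
  simp_rw [h1]
  rw [lintegral_const_mul _ (by fun_prop), mul_comm (gaussAbsMoment q),
    ENNReal.ofReal_mul (by positivity), ← lintegral_abs_rpow_gaussianReal hq]
  refine mul_le_mul_right ?_ _
  rw [gaussianReal_of_var_ne_zero 0 one_ne_zero,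
    lintegral_withDensity_eq_lintegral_mul _ (measurable_gaussianPDF 0 1) (by fun_prop),
    lintegral_withDensity_eq_lintegral_mul _ (measurable_gaussianPDF 0 1) (by fun_prop)]
  simp only [Pi.mul_apply, mul_comm (gaussianPDF 0 1 _)]
  refine lintegral_even_antitone_shift_le (F := fun y => ENNReal.ofReal |y| ^ q) (by fun_prop)
    (measurable_gaussianPDF 0 1) (fun x y h => ?_) (fun x y h => ?_) _
  -- The power is taken in `ℝ≥0∞`, where `0 ^ q = ∞`, so monotonicity includes the origin.
  · have hnq : 0 ≤ -q := by linarith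
    rw [← neg_neg q, ENNReal.rpow_neg _ (-q), ENNReal.rpow_neg _ (-q)]
    exact ENNReal.inv_le_inv.2 (ENNReal.rpow_le_rpow (ENNReal.ofReal_le_ofReal h) hnq)
  · simp only [gaussianPDF, gaussianPDFReal]
    refine ENNReal.ofReal_le_ofReal ?_
    have := sq_le_sq' (by linarith [abs_nonneg x, abs_nonneg y]) h
    rw [sq_abs, sq_abs] at this
    simp only [sub_zero]
    gcongr

/-- Subadditivity of `t ↦ t^q` for `q ≤ 1` separates the mean from the fluctuation with constant one
in front of both; a larger constant would spoil the contraction rates. -/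
theorem lintegral_abs_rpow_gaussianReal_le {q : ℝ} (hq0 : 0 < q) (hq : q ≤ 1) (m : ℝ)
    {v : ℝ} (hv : 0 ≤ v) :
    ∫⁻ y, ENNReal.ofReal |y| ^ q ∂gaussianReal m v.toNNReal
      ≤ ENNReal.ofReal (|m| ^ q + gaussAbsMoment q * v ^ (q / 2)) := by
  have hsv := Real.sqrt_nonneg v
  rw [gaussianReal_eq_map_std m hv, lintegral_map (by fun_prop) (by fun_prop)]
  have h1 : ∀ z : ℝ, ENNReal.ofReal |m + √v * z| ^ q
      ≤ ENNReal.ofReal (|m| ^ q) + ENNReal.ofReal (v ^ (q / 2)) * ENNReal.ofReal |z| ^ q := by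
    intro z
    rw [ENNReal.ofReal_rpow_of_nonneg (abs_nonneg _) hq0.le,
      ENNReal.ofReal_rpow_of_nonneg (abs_nonneg _) hq0.le, ← ENNReal.ofReal_mul (by positivity),
      ← ENNReal.ofReal_add (by positivity) (by positivity)]
    refine ENNReal.ofReal_le_ofReal ?_
    have e : v ^ (q / 2) * |z| ^ q = |√v * z| ^ q := by
      rw [abs_mul, abs_of_nonneg hsv, Real.mul_rpow hsv (abs_nonneg _), Real.sqrt_eq_rpow,
        ← Real.rpow_mul hv]
      ring_nf
    rw [e]
    exact (Real.rpow_le_rpow (abs_nonneg _) (abs_add_le _ _) hq0.le).trans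
      (Real.rpow_add_le_add_rpow (abs_nonneg _) (abs_nonneg _) hq0.le hq)
  refine (lintegral_mono h1).trans ?_
  rw [lintegral_add_left measurable_const, lintegral_const_mul _ (by fun_prop),
    lintegral_abs_rpow_gaussianReal (by linarith), lintegral_const, measure_univ, mul_one,
    ← ENNReal.ofReal_mul (by positivity), mul_comm (gaussAbsMoment q), ← ENNReal.ofReal_add]
  · positivity
  · have := gaussAbsMoment_pos (q := q) (by linarith); positivity

theorem lintegral_sq_gaussianReal (m : ℝ) {v : ℝ} (hv : 0 ≤ v) :
    ∫⁻ y, ENNReal.ofReal (y ^ 2) ∂gaussianReal m v.toNNReal = ENNReal.ofReal (m ^ 2 + v) := by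
  have hL := memLp_id_gaussianReal (μ := m) (v := v.toNNReal) 2
  have h1 := variance_eq_sub hL
  rw [variance_id_gaussianReal] at h1
  simp only [id, Pi.pow_apply, integral_id_gaussianReal, Real.coe_toNNReal v hv] at h1
  have h2 := ofReal_integral_eq_lintegral_ofReal hL.integrable_sq
    (ae_of_all _ fun y => sq_nonneg (id y))
  simp only [id] at h2
  rw [← h2]
  congr 1
  linarith

/-! ### Generalised inverse Gaussian distributions -/

section GIG

open Filter Topology

theorem lintegral_lebPos (g : ℝ → ℝ≥0∞) :
    ∫⁻ y, g (y : ℝ) ∂lebPos = ∫⁻ x in Set.Ioi 0, g x :=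
  lintegral_subtype_comap measurableSet_Ioi g

theorem lebPos_ne_zero : lebPos ≠ 0 := by
  intro h
  have := lintegral_lebPos 1
  simp [h] at this

/-- The parameters for which the `GIG` density is integrable. -/
structure GIGProper (p a b : ℝ) : Prop where
  a_nonneg : 0 ≤ a
  b_nonneg : 0 ≤ b
  at_top : 0 < a ∨ p < 0
  at_zero : 0 < b ∨ 0 < p

theorem GIGProper.of_pos (p : ℝ) {a b : ℝ} (ha : 0 < a) (hb : 0 < b) : GIGProper p a b :=
  ⟨ha.le, hb.le, Or.inl ha, Or.inl hb⟩

/-- The unnormalised `GIG` density as a function on `ℝ`. -/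
def gigFun (p a b x : ℝ) : ℝ := x ^ (p - 1) * Real.exp (-(1 / 2) * (a * x + b / x))

theorem gigFun_pos (p a b : ℝ) {x : ℝ} (hx : 0 < x) : 0 < gigFun p a b x := by
  unfold gigFun; positivity

theorem measurable_gigFun (p a b : ℝ) : Measurable (gigFun p a b) := by
  unfold gigFun; fun_prop

theorem rpow_mul_gigFun (p a b s : ℝ) {x : ℝ} (hx : 0 < x) :
    x ^ s * gigFun p a b x = gigFun (p + s) a b x := by
  unfold gigFun
  rw [← mul_assoc, ← Real.rpow_add hx]
  ring_nf

theorem gigFun_anti {p a b a' b' x : ℝ} (hx : 0 < x) (ha : a ≤ a') (hb : b ≤ b') :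
    gigFun p a' b' x ≤ gigFun p a b x := by
  unfold gigFun
  refine mul_le_mul_of_nonneg_left (Real.exp_le_exp.2 ?_) (by positivity)
  have h1 : a * x ≤ a' * x := by gcongr
  have h2 : b / x ≤ b' / x := by gcongr
  linarith

/-- Inversion `x ↦ 1/x`, with Jacobian `x⁻²`, exchanges `a` and `b` and changes the sign of `p`; it
reduces the inverse Gamma case to the Gamma case. -/
theorem gigFun_inv (p a b : ℝ) {x : ℝ} (hx : 0 < x) :
    x ^ (-1 - 1 : ℝ) * gigFun (-p) b a (x ^ (-1 : ℝ)) = gigFun p a b x := by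
  unfold gigFun
  rw [← Real.rpow_mul hx.le, ← mul_assoc, ← Real.rpow_add hx, Real.rpow_neg_one]
  congr 1
  · ring_nf
  · rw [div_inv_eq_mul, ← div_eq_mul_inv]; ring_nf

theorem integrableOn_gigFun_inv_iff (p a b : ℝ) :
    IntegrableOn (gigFun p a b) (Set.Ioi 0) ↔ IntegrableOn (gigFun (-p) b a) (Set.Ioi 0) := by
  rw [← integrableOn_Ioi_comp_rpow_iff (gigFun (-p) b a) (show (-1 : ℝ) ≠ 0 by norm_num)]
  refine integrableOn_congr_fun (fun x hx => ?_) measurableSet_Ioi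
  simp only [abs_neg, abs_one, one_mul, smul_eq_mul]
  exact (gigFun_inv p a b hx).symm

theorem integral_gigFun_inv (p a b : ℝ) :
    ∫ x in Set.Ioi 0, gigFun p a b x = ∫ x in Set.Ioi 0, gigFun (-p) b a x := by
  rw [← integral_comp_rpow_Ioi (gigFun (-p) b a) (show (-1 : ℝ) ≠ 0 by norm_num)]
  refine setIntegral_congr_fun measurableSet_Ioi fun x hx => ?_
  simp only [abs_neg, abs_one, one_mul, smul_eq_mul]
  exact (gigFun_inv p a b hx).symm

theorem integrableOn_gigFun_gamma {p a : ℝ} (hp : 0 < p) (ha : 0 < a) :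
    IntegrableOn (gigFun p a 0) (Set.Ioi 0) := by
  have := integrableOn_rpow_mul_exp_neg_mul_rpow (p := 1) (s := p - 1) (b := a / 2)
    (by linarith) one_pos (by positivity)
  refine this.congr_fun (fun x _ => ?_) measurableSet_Ioi
  simp only [gigFun, Real.rpow_one]
  ring_nf

theorem integral_gigFun_gamma {p a : ℝ} (hp : 0 < p) (ha : 0 < a) :
    ∫ x in Set.Ioi 0, gigFun p a 0 x = (2 / a) ^ p * Real.Gamma p := by
  have := Real.integral_rpow_mul_exp_neg_mul_Ioi hp (half_pos ha)
  rw [one_div_div] at this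
  rw [← this]
  refine setIntegral_congr_fun measurableSet_Ioi fun x _ => ?_
  simp only [gigFun]
  ring_nf

theorem integrableOn_gigFun_of_le {p a b a' b' : ℝ} (ha : a ≤ a') (hb : b ≤ b')
    (h : IntegrableOn (gigFun p a b) (Set.Ioi 0)) :
    IntegrableOn (gigFun p a' b') (Set.Ioi 0) := by
  refine Integrable.mono' h (measurable_gigFun p a' b').aestronglyMeasurable ?_
  refine (ae_restrict_iff' measurableSet_Ioi).2 (ae_of_all _ fun x hx => ?_)
  rw [Real.norm_eq_abs, abs_of_pos (gigFun_pos p a' b' hx)]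
  exact gigFun_anti hx ha hb

theorem GIGProper.integrableOn {p a b : ℝ} (h : GIGProper p a b) :
    IntegrableOn (gigFun p a b) (Set.Ioi 0) := by
  have key1 : ∀ {p}, 0 < p → 0 < a → IntegrableOn (gigFun p a b) (Set.Ioi 0) := fun hp ha =>
    integrableOn_gigFun_of_le le_rfl h.b_nonneg (integrableOn_gigFun_gamma hp ha)
  have key2 : ∀ {p}, p < 0 → 0 < b → IntegrableOn (gigFun p a b) (Set.Ioi 0) := fun hp hb =>
    integrableOn_gigFun_of_le h.a_nonneg le_rfl
      ((integrableOn_gigFun_inv_iff _ _ _).2 (integrableOn_gigFun_gamma (neg_pos.2 hp) hb))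
  rcases lt_trichotomy p 0 with hp | hp | hp
  · exact key2 hp (h.at_zero.resolve_right (by linarith))
  · have ha := h.at_top.resolve_right (by linarith)
    have hb := h.at_zero.resolve_right (by linarith)
    -- At `p = 0` neither the Gamma nor the inverse Gamma majorant is integrable. The inequality `1
    -- ≤ x + x⁻¹` raises or lowers the exponent by one instead.
    subst hp
    refine Integrable.mono' ((key1 (p := 0 + 1) (by norm_num) ha).add
      (key2 (p := 0 + -1) (by norm_num) hb)) (measurable_gigFun _ a b).aestronglyMeasurable ?_
    refine (ae_restrict_iff' measurableSet_Ioi).2 (ae_of_all _ fun x hx => ?_)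
    have hx0 : 0 < x := hx
    rw [Real.norm_eq_abs, abs_of_pos (gigFun_pos _ a b hx), Pi.add_apply,
      ← rpow_mul_gigFun _ _ _ _ hx, ← rpow_mul_gigFun _ _ _ _ hx, ← add_mul, Real.rpow_one,
      Real.rpow_neg_one]
    refine le_mul_of_one_le_left (gigFun_pos _ a b hx).le ?_
    rcases le_total 1 x with h1 | h1
    · have : 0 ≤ x⁻¹ := by positivity
      linarith
    · have := (one_le_inv₀ hx0).2 h1
      linarith
  · exact key1 hp (h.at_top.resolve_right (by linarith))

/-- The normalising integral of the `GIG` density. -/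
def gigNorm (p a b : ℝ) : ℝ≥0∞ := ∫⁻ y, gigKernel p a b y ∂lebPos

/-- The normalising integral of the `GIG` density as a real number. -/
def gigNormReal (p a b : ℝ) : ℝ := ∫ x in Set.Ioi 0, gigFun p a b x

theorem gigNorm_eq_lintegral (p a b : ℝ) :
    gigNorm p a b = ∫⁻ x in Set.Ioi 0, ENNReal.ofReal (gigFun p a b x) :=
  lintegral_lebPos fun x => ENNReal.ofReal (gigFun p a b x)

theorem measurable_gigKernel_right (p a b : ℝ) : Measurable (gigKernel p a b) :=
  (measurable_gigKernel p a).comp (measurable_const (a := b) |>.prodMk measurable_id)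

theorem measurable_gigDensity_right (p a b : ℝ) : Measurable (gigDensity p a b) :=
  (measurable_gigDensity p a).comp (measurable_const (a := b) |>.prodMk measurable_id)

theorem gigKernel_pos (p a b : ℝ) (x : Set.Ioi (0 : ℝ)) : 0 < gigKernel p a b x :=
  ENNReal.ofReal_pos.2 (gigFun_pos p a b x.2)

theorem gigNorm_ne_zero (p a b : ℝ) : gigNorm p a b ≠ 0 := by
  intro h
  rw [gigNorm, lintegral_eq_zero_iff (measurable_gigKernel_right p a b)] at h
  have : ∀ᵐ x ∂lebPos, False := h.mono fun x hx => (gigKernel_pos p a b x).ne' hx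
  rw [eventually_false_iff_eq_bot, ae_eq_bot] at this
  exact lebPos_ne_zero this

theorem gigNorm_anti {p a b a' b' : ℝ} (ha : a ≤ a') (hb : b ≤ b') :
    gigNorm p a' b' ≤ gigNorm p a b :=
  lintegral_mono fun x => ENNReal.ofReal_le_ofReal (gigFun_anti x.2 ha hb)

theorem GIGProper.gigNorm_eq {p a b : ℝ} (h : GIGProper p a b) :
    gigNorm p a b = ENNReal.ofReal (gigNormReal p a b) := by
  rw [gigNorm_eq_lintegral, gigNormReal, ofReal_integral_eq_lintegral_ofReal h.integrableOn]
  exact (ae_restrict_iff' measurableSet_Ioi).2 (ae_of_all _ fun x hx => (gigFun_pos p a b hx).le)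

theorem GIGProper.gigNorm_ne_top {p a b : ℝ} (h : GIGProper p a b) : gigNorm p a b ≠ ∞ := by
  rw [h.gigNorm_eq]; exact ENNReal.ofReal_ne_top

theorem GIGProper.gigNormReal_pos {p a b : ℝ} (h : GIGProper p a b) : 0 < gigNormReal p a b := by
  have := gigNorm_ne_zero p a b
  rw [h.gigNorm_eq] at this
  simpa using this

/-- The `GIG` distribution. -/
def gigLaw (p a b : ℝ) : Measure (Set.Ioi (0 : ℝ)) := lebPos.withDensity (gigDensity p a b)

theorem gigLaw_eq (p a b : ℝ) :
    gigLaw p a b = (gigNorm p a b)⁻¹ • lebPos.withDensity (gigKernel p a b) := by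
  rw [← withDensity_smul _ (measurable_gigKernel_right p a b)]
  unfold gigLaw
  congr 1
  ext x
  rw [Pi.smul_apply, smul_eq_mul, mul_comm, ← div_eq_mul_inv]
  rfl

theorem GIGProper.isProbabilityMeasure {p a b : ℝ} (h : GIGProper p a b) :
    IsProbabilityMeasure (gigLaw p a b) := by
  refine ⟨?_⟩
  rw [gigLaw_eq, Measure.smul_apply, withDensity_apply _ MeasurableSet.univ,
    Measure.restrict_univ, smul_eq_mul]
  exact ENNReal.inv_mul_cancel (gigNorm_ne_zero p a b) h.gigNorm_ne_top

theorem lintegral_rpow_gigLaw (p a b s : ℝ) :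
    ∫⁻ x, ENNReal.ofReal ((x : ℝ) ^ s) ∂gigLaw p a b = gigNorm (p + s) a b / gigNorm p a b := by
  have hm : Measurable fun x : Set.Ioi (0 : ℝ) => ENNReal.ofReal ((x : ℝ) ^ s) := by fun_prop
  rw [gigLaw_eq, lintegral_smul_measure, smul_eq_mul, mul_comm, ← div_eq_mul_inv,
    lintegral_withDensity_eq_lintegral_mul _ (measurable_gigKernel_right p a b) hm]
  congr 1
  refine lintegral_congr fun x => ?_
  have hx : (0 : ℝ) < x := x.2
  rw [Pi.mul_apply, mul_comm]
  change ENNReal.ofReal _ * ENNReal.ofReal (gigFun p a b x) = ENNReal.ofReal (gigFun (p + s) a b x)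
  rw [← ENNReal.ofReal_mul (by positivity), rpow_mul_gigFun _ _ _ _ hx]

theorem lintegral_rpow_gigLaw_of_proper {p a b s : ℝ} (h : GIGProper p a b)
    (hs : GIGProper (p + s) a b) :
    ∫⁻ x, ENNReal.ofReal ((x : ℝ) ^ s) ∂gigLaw p a b
      = ENNReal.ofReal (gigNormReal (p + s) a b / gigNormReal p a b) := by
  rw [lintegral_rpow_gigLaw, h.gigNorm_eq, hs.gigNorm_eq, ENNReal.ofReal_div_of_pos h.gigNormReal_pos]

/-! ### Moment identities -/

theorem tendsto_gigFun_atTop (p : ℝ) {a b : ℝ} (ha : 0 < a) (hb : 0 < b) :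
    Tendsto (gigFun p a b) atTop (𝓝 0) := by
  refine squeeze_zero' (g := fun x => x ^ (p - 1) * Real.exp (-(a / 2) * x)) ?_ ?_
    (tendsto_rpow_mul_exp_neg_mul_atTop_nhds_zero _ _ (half_pos ha))
  · filter_upwards [eventually_gt_atTop 0] with x hx using (gigFun_pos p a b hx).le
  · filter_upwards [eventually_gt_atTop 0] with x hx
    refine (gigFun_anti hx le_rfl hb.le).trans_eq ?_
    simp only [gigFun]
    ring_nf

theorem gigFun_eq_inv (p a b : ℝ) {x : ℝ} (hx : 0 < x) :
    gigFun p a b x = gigFun (2 - p) b a x⁻¹ := by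
  unfold gigFun
  rw [Real.inv_rpow hx.le, ← Real.rpow_neg hx.le, div_inv_eq_mul, ← div_eq_mul_inv]
  ring_nf

theorem tendsto_gigFun_zero (p : ℝ) {a b : ℝ} (ha : 0 < a) (hb : 0 < b) :
    Tendsto (gigFun p a b) (𝓝[>] 0) (𝓝 0) := by
  refine ((tendsto_gigFun_atTop (2 - p) hb ha).comp tendsto_inv_nhdsGT_zero).congr' ?_
  filter_upwards [self_mem_nhdsWithin] with x hx
  exact (gigFun_eq_inv p a b hx).symm

/-- Integration of the derivative of `x^p exp(-(a x + b/x)/2)`, which vanishes at both ends. This is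
the three-term recurrence of the Bessel functions `K_p`. -/
theorem gigNormReal_recurrence (p : ℝ) {a b : ℝ} (ha : 0 < a) (hb : 0 < b) :
    a * gigNormReal (p + 1) a b = b * gigNormReal (p - 1) a b + 2 * p * gigNormReal p a b := by
  have hi := fun p => (GIGProper.of_pos p ha hb).integrableOn
  set F' : ℝ → ℝ := fun x => p * gigFun p a b x - a / 2 * gigFun (p + 1) a b x
    + b / 2 * gigFun (p - 1) a b x with hF'
  have hF'i : IntegrableOn F' (Set.Ioi 0) :=
    (((hi p).const_mul p).sub ((hi (p + 1)).const_mul (a / 2))).add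
      ((hi (p - 1)).const_mul (b / 2))
  have hder : ∀ x ∈ Set.Ioi (0 : ℝ), HasDerivAt (gigFun (p + 1) a b) (F' x) x := by
    intro x hx
    have hx : 0 < x := hx
    have h1 : HasDerivAt (fun x : ℝ => x ^ (p + 1 - 1)) ((p + 1 - 1) * x ^ (p + 1 - 1 - 1)) x :=
      Real.hasDerivAt_rpow_const (Or.inl hx.ne')
    have h2 : HasDerivAt (fun x : ℝ => -(1 / 2) * (a * x + b / x))
        (-(1 / 2) * (a * 1 + b * -(x ^ 2)⁻¹)) x := by
      simp only [div_eq_mul_inv b]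
      exact (((hasDerivAt_id x).const_mul a).add ((hasDerivAt_inv hx.ne').const_mul b)).const_mul _
    have h3 := h1.mul h2.exp
    refine h3.congr_deriv ?_
    have e1 : gigFun p a b x = x ^ (-1 : ℝ) * gigFun (p + 1) a b x := by
      rw [rpow_mul_gigFun _ _ _ _ hx]; ring_nf
    have e2 : gigFun (p - 1) a b x = x ^ (-2 : ℝ) * gigFun (p + 1) a b x := by
      rw [rpow_mul_gigFun _ _ _ _ hx]; ring_nf
    have e3 : x ^ (p + 1 - 1 - 1) = x ^ (-1 : ℝ) * x ^ (p + 1 - 1) := by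
      rw [← Real.rpow_add hx]; ring_nf
    have e4 : (x ^ 2)⁻¹ = x ^ (-2 : ℝ) := by
      rw [Real.rpow_neg hx.le]; norm_num
    simp only [hF', e1, e2]
    simp only [gigFun, e3, e4]
    ring
  have h := integral_Ioi_deriv_mul_eq_sub (u := gigFun (p + 1) a b) (v := fun _ => 1)
    (v' := fun _ => 0) (a' := 0) (b' := 0) hder (fun x _ => hasDerivAt_const x 1)
    (by simpa [Pi.mul_def, Pi.add_def] using hF'i)
    (by simpa [Pi.mul_def] using tendsto_gigFun_zero (p + 1) ha hb)
    (by simpa [Pi.mul_def] using tendsto_gigFun_atTop (p + 1) ha hb)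
  simp only [mul_one, mul_zero, add_zero, sub_self] at h
  have e1 := integral_add (((hi p).const_mul p).sub ((hi (p + 1)).const_mul (a / 2)))
    ((hi (p - 1)).const_mul (b / 2))
  have e2 := integral_sub ((hi p).const_mul p) ((hi (p + 1)).const_mul (a / 2))
  simp only [Pi.sub_apply] at e1
  rw [hF', e1, e2, integral_const_mul, integral_const_mul, integral_const_mul] at h
  unfold gigNormReal
  linarith

/-- Nonnegativity of the variance, `∫ (x - u)² ≥ 0` with `u` the mean. -/
theorem gigNormReal_sq_le (p : ℝ) {a b : ℝ} (ha : 0 < a) (hb : 0 < b) :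
    gigNormReal (p + 1) a b ^ 2 ≤ gigNormReal p a b * gigNormReal (p + 2) a b := by
  have hi := fun p => (GIGProper.of_pos p ha hb).integrableOn
  have hpos := (GIGProper.of_pos p ha hb).gigNormReal_pos
  set u := gigNormReal (p + 1) a b / gigNormReal p a b with hu
  have h : 0 ≤ ∫ x in Set.Ioi 0, (gigFun (p + 2) a b x - 2 * u * gigFun (p + 1) a b x
      + u ^ 2 * gigFun p a b x) := by
    refine setIntegral_nonneg measurableSet_Ioi fun x hx => ?_
    have hx0 : (0 : ℝ) < x := hx
    rw [← rpow_mul_gigFun p a b 2 hx, ← rpow_mul_gigFun p a b 1 hx, Real.rpow_one, Real.rpow_two]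
    have := gigFun_pos p a b hx
    have e : x ^ 2 * gigFun p a b x - 2 * u * (x * gigFun p a b x) + u ^ 2 * gigFun p a b x
        = (x - u) ^ 2 * gigFun p a b x := by ring
    rw [e]
    positivity
  have e1 := integral_add ((hi (p + 2)).sub ((hi (p + 1)).const_mul (2 * u)))
    ((hi p).const_mul (u ^ 2))
  have e2 := integral_sub (hi (p + 2)) ((hi (p + 1)).const_mul (2 * u))
  simp only [Pi.sub_apply] at e1
  rw [e1, e2, integral_const_mul, integral_const_mul] at h
  change 0 ≤ gigNormReal (p + 2) a b - 2 * u * gigNormReal (p + 1) a b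
    + u ^ 2 * gigNormReal p a b at h
  have h2 : gigNormReal (p + 1) a b = u * gigNormReal p a b := by rw [hu]; field_simp
  rw [h2] at h ⊢
  nlinarith [mul_nonneg hpos.le h]

/-- The mean of the `GIG` distribution. -/
def gigMean (p a b : ℝ) : ℝ := gigNormReal (p + 1) a b / gigNormReal p a b

theorem gigMean_pos (p : ℝ) {a b : ℝ} (ha : 0 < a) (hb : 0 < b) : 0 < gigMean p a b :=
  div_pos (GIGProper.of_pos _ ha hb).gigNormReal_pos (GIGProper.of_pos _ ha hb).gigNormReal_pos

theorem gigMean_second_moment (p : ℝ) {a b : ℝ} (ha : 0 < a) (hb : 0 < b) :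
    a * (gigNormReal (p + 2) a b / gigNormReal p a b) = b + 2 * (p + 1) * gigMean p a b := by
  have h := gigNormReal_recurrence (p + 1) ha hb
  have hpos := (GIGProper.of_pos p ha hb).gigNormReal_pos
  rw [show p + 1 + 1 = p + 2 by ring, add_sub_cancel_right] at h
  rw [gigMean, ← mul_div_assoc, h]
  field_simp

/-- The constant in the comparison of the mean of `GIG(p, a, b)` with `√(b / a)`. -/
def gigMeanConst (p a : ℝ) : ℝ := 2 * max (p + 1) 0 / a

theorem gigMeanConst_nonneg (p : ℝ) {a : ℝ} (ha : 0 < a) : 0 ≤ gigMeanConst p a := by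
  have : 0 ≤ max (p + 1) 0 := le_max_right _ _
  unfold gigMeanConst
  positivity

/-- The recurrence expresses the second moment exactly through the mean; replacing `p + 1` by its
positive part gives a nonnegative coefficient for every `p`. -/
theorem gigSecondMoment_le (p : ℝ) {a b : ℝ} (ha : 0 < a) (hb : 0 < b) :
    gigNormReal (p + 2) a b / gigNormReal p a b
      ≤ b / a + gigMeanConst p a * gigMean p a b := by
  have h := gigMean_second_moment p ha hb
  have hm := (gigMean_pos p ha hb).le
  have h1 : (p + 1) * gigMean p a b ≤ max (p + 1) 0 * gigMean p a b :=
    mul_le_mul_of_nonneg_right (le_max_left _ _) hm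
  rw [← mul_le_mul_iff_right₀ ha, h, gigMeanConst]
  have e : a * (b / a + 2 * max (p + 1) 0 / a * gigMean p a b)
      = b + 2 * (max (p + 1) 0 * gigMean p a b) := by field_simp
  rw [e]
  linarith

/-- The mean satisfies `m² ≤ E x² ≤ b/a + κ m`, with `κ` the constant `gigMeanConst p a`, and this
quadratic inequality forces `m ≤ √(b/a) + κ`. The leading term `√(b/a)` has the sharp coefficient
one, on which the drift rate depends. -/
theorem gigMean_le (p : ℝ) {a b : ℝ} (ha : 0 < a) (hb : 0 < b) :
    gigMean p a b ≤ √(b / a) + gigMeanConst p a := by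
  have hpos := (GIGProper.of_pos p ha hb).gigNormReal_pos
  have h1 := gigSecondMoment_le p ha hb
  have h2 : gigMean p a b ^ 2 ≤ gigNormReal (p + 2) a b / gigNormReal p a b := by
    rw [gigMean, div_pow, div_le_div_iff₀ (by positivity) hpos]
    nlinarith [mul_le_mul_of_nonneg_right (gigNormReal_sq_le p ha hb) hpos.le]
  by_contra! h
  have hk := gigMeanConst_nonneg p ha
  have hs := Real.sqrt_nonneg (b / a)
  have hsq : √(b / a) ^ 2 = b / a := Real.sq_sqrt (by positivity)
  nlinarith

theorem gigInvMean_eq (p : ℝ) {a b : ℝ} (ha : 0 < a) (hb : 0 < b) :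
    gigNormReal (p + -1) a b / gigNormReal p a b = (a * gigMean p a b - 2 * p) / b := by
  have h := gigNormReal_recurrence p ha hb
  have hpos := (GIGProper.of_pos p ha hb).gigNormReal_pos
  rw [← sub_eq_add_neg, gigMean]
  field_simp
  linarith

/-! ### Inverse Gamma distributions and comparison -/

theorem gigNormReal_invGamma {p b : ℝ} (hp : p < 0) (hb : 0 < b) :
    gigNormReal p 0 b = (2 / b) ^ (-p) * Real.Gamma (-p) := by
  rw [gigNormReal, integral_gigFun_inv, integral_gigFun_gamma (neg_pos.2 hp) hb]

theorem GIGProper.invGamma {p b : ℝ} (hp : p < 0) (hb : 0 < b) : GIGProper p 0 b :=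
  ⟨le_rfl, hb.le, Or.inr hp, Or.inl hb⟩

/-- The substitution `x ↦ b x`: up to a power of `b`, the integral depends on `a` and `b` only
through `a b`. Small `b` thus corresponds to small `a` at `b = 1`. -/
theorem gigNormReal_scale (p a : ℝ) {b : ℝ} (hb : 0 < b) :
    gigNormReal p a b = b ^ p * gigNormReal p (a * b) 1 := by
  have h := integral_comp_mul_left_Ioi (gigFun p a b) 0 hb
  rw [mul_zero, smul_eq_mul] at h
  have h2 : ∫ x in Set.Ioi 0, gigFun p a b (b * x)
      = b ^ (p - 1) * ∫ x in Set.Ioi 0, gigFun p (a * b) 1 x := by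
    rw [← integral_const_mul]
    refine setIntegral_congr_fun measurableSet_Ioi fun x hx => ?_
    have hx : 0 < x := hx
    simp only [gigFun]
    rw [Real.mul_rpow hb.le hx.le, div_mul_cancel_left₀ hb.ne', one_div]
    ring_nf
  rw [h2] at h
  unfold gigNormReal
  rw [Real.rpow_sub_one hb.ne'] at h
  field_simp at h
  rw [← h, mul_comm b a]

/-- Lower semicontinuity of the normalising integral as `a → 0`. -/
theorem exists_le_gigNormReal {p : ℝ} (hp : p ≤ 0) {L : ℝ}
    (hL : p < 0 → L < gigNormReal p 0 1) :
    ∃ δ > 0, ∀ c, 0 < c → c ≤ δ → L ≤ gigNormReal p c 1 := by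
  -- Monotone convergence along `c = 1/(k+1)`; monotonicity in `c` then covers all smaller `c`.
  have hlim : Tendsto (fun k : ℕ => gigNorm p (1 / (k + 1)) 1) atTop (𝓝 (gigNorm p 0 1)) := by
    refine lintegral_tendsto_of_tendsto_of_monotone
      (fun k => (measurable_gigKernel_right p _ 1).aemeasurable) (ae_of_all _ fun x => ?_)
      (ae_of_all _ fun x => ?_)
    · intro k l hkl
      exact ENNReal.ofReal_le_ofReal (gigFun_anti x.2 (Nat.one_div_le_one_div hkl) le_rfl)
    · refine ENNReal.tendsto_ofReal ?_
      have hc : Continuous fun c : ℝ => gigFun p c 1 x := by unfold gigFun; fun_prop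
      exact (hc.tendsto 0).comp tendsto_one_div_add_atTop_nhds_zero_nat
  have hlt : ENNReal.ofReal L < gigNorm p 0 1 := by
    rcases hp.lt_or_eq with hp | hp
    · have hpr := GIGProper.invGamma hp one_pos
      rw [hpr.gigNorm_eq]
      exact (ENNReal.ofReal_lt_ofReal_iff hpr.gigNormReal_pos).2 (hL hp)
    -- At `p = 0` the limit integral diverges, since the integrand is at least `e^(-1/2)/x` on `x >
    -- 1`. Hence no condition on `L` is needed there.
    · subst hp
      suffices gigNorm 0 0 1 = ∞ by rw [this]; exact ENNReal.ofReal_lt_top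
      by_contra hfin
      have hI : IntegrableOn (gigFun 0 0 1) (Set.Ioi 0) := by
        refine ⟨(measurable_gigFun _ _ _).aestronglyMeasurable, ?_⟩
        rw [hasFiniteIntegral_iff_ofReal ((ae_restrict_iff' measurableSet_Ioi).2
          (ae_of_all _ fun x hx => (gigFun_pos 0 0 1 hx).le)), ← gigNorm_eq_lintegral]
        exact lt_top_iff_ne_top.2 hfin
      refine not_integrableOn_Ioi_inv (a := 1) (Integrable.mono'
        ((hI.mono_set (Set.Ioi_subset_Ioi zero_le_one)).const_mul (Real.exp (1 / 2)))
        measurable_inv.aestronglyMeasurable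
        ((ae_restrict_iff' measurableSet_Ioi).2 (ae_of_all _ fun x hx => ?_)))
      have hx1 : (1 : ℝ) < x := hx
      have hx0 : 0 < x := by linarith
      rw [Real.norm_eq_abs, abs_of_pos (by positivity), gigFun, mul_left_comm, ← Real.exp_add,
        zero_sub, Real.rpow_neg_one]
      refine le_mul_of_one_le_right (by positivity) (Real.one_le_exp ?_)
      have : 1 / x ≤ 1 := by rw [div_le_one hx0]; exact hx1.le
      linarith
  obtain ⟨k, hk⟩ := (hlim.eventually (lt_mem_nhds hlt)).exists
  refine ⟨1 / (k + 1), by positivity, fun c hc hck => ?_⟩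
  have h1 := hk.le.trans (gigNorm_anti (p := p) hck (le_refl (1 : ℝ)))
  have hpr := GIGProper.of_pos p hc one_pos
  rw [hpr.gigNorm_eq] at h1
  exact (ENNReal.ofReal_le_ofReal_iff hpr.gigNormReal_pos.le).1 h1

/-- A bound on the negative moments of `GIG(p, a, b)`, `p ≤ 0`, that is sharp as `b → 0`. -/
theorem exists_gig_neg_moment_le {p a s L : ℝ} (hp : p ≤ 0) (ha : 0 < a) (hs : 0 < s) (hs1 : s ≤ 1)
    (hL0 : 0 < L) (hL : p < 0 → L < gigNormReal p 0 1) :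
    ∃ C, 0 ≤ C ∧ ∀ b, 0 < b → gigNormReal (p + -s) a b / gigNormReal p a b
      ≤ gigNormReal (p + -s) 0 1 / L * b ^ (-s) + C := by
  obtain ⟨δ, hδ, hδL⟩ := exists_le_gigNormReal hp hL
  have hps : p + -s < 0 := by linarith
  have hpr0 := GIGProper.invGamma hps one_pos
  -- The threshold `a b ≤ δ`. Below it, scaling to `b = 1` and the lower bound `L` for the
  -- normaliser give the sharp term. Above it, `x^(-s) ≤ 1 + x⁻¹` and the formula for the inverse
  -- mean give a constant.
  set b₀ := δ / a with hb₀
  have hb₀0 : 0 < b₀ := by positivity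
  set C := 1 + (√a / √b₀ + a * gigMeanConst p a / b₀ + -2 * p / b₀) with hC
  have hC0 : 0 ≤ C := by
    have := gigMeanConst_nonneg p ha
    have : 0 ≤ -2 * p := by linarith
    positivity
  refine ⟨C, hC0, fun b hb => ?_⟩
  have hpos := (GIGProper.of_pos p ha hb).gigNormReal_pos
  have hN0 := hpr0.gigNormReal_pos
  have hfirst : 0 ≤ gigNormReal (p + -s) 0 1 / L * b ^ (-s) := by positivity
  rcases le_total b b₀ with h | h
  · have hLb : L ≤ gigNormReal p (a * b) 1 := by
      refine hδL _ (by positivity) ?_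
      rw [hb₀, le_div_iff₀ ha] at h
      linarith
    have hNle : gigNormReal (p + -s) (a * b) 1 ≤ gigNormReal (p + -s) 0 1 :=
      setIntegral_mono_on (GIGProper.of_pos _ (mul_pos ha hb) one_pos).integrableOn
        hpr0.integrableOn measurableSet_Ioi fun x hx => gigFun_anti hx (by positivity) le_rfl
    rw [gigNormReal_scale p a hb, gigNormReal_scale (p + -s) a hb, Real.rpow_add hb]
    have hbp : 0 < b ^ p := by positivity
    have e : b ^ p * b ^ (-s) * gigNormReal (p + -s) (a * b) 1 / (b ^ p * gigNormReal p (a * b) 1)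
        = gigNormReal (p + -s) (a * b) 1 / gigNormReal p (a * b) 1 * b ^ (-s) := by
      field_simp
    rw [e]
    refine le_add_of_le_of_nonneg ?_ hC0
    gcongr
  · refine le_add_of_nonneg_of_le hfirst ?_
    have hpt : gigNormReal (p + -s) a b ≤ gigNormReal p a b + gigNormReal (p + -1) a b := by
      have hi := fun p => (GIGProper.of_pos p ha hb).integrableOn
      unfold gigNormReal
      rw [← integral_add (hi _) (hi _)]
      refine setIntegral_mono_on (hi _) ((hi _).add (hi _)) measurableSet_Ioi fun x hx => ?_
      have hx0 : (0 : ℝ) < x := hx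
      rw [← rpow_mul_gigFun p a b (-s) hx, ← rpow_mul_gigFun p a b (-1) hx]
      have hg := gigFun_pos p a b hx
      have : x ^ (-s) ≤ 1 + x ^ (-1 : ℝ) := by
        rcases le_total 1 x with h1 | h1
        · exact le_add_of_le_of_nonneg (Real.rpow_le_one_of_one_le_of_nonpos h1 (by linarith))
            (by positivity)
        · exact le_add_of_nonneg_of_le zero_le_one
            (Real.rpow_le_rpow_of_exponent_ge hx0 h1 (by linarith))
      nlinarith
    calc gigNormReal (p + -s) a b / gigNormReal p a b
        ≤ (gigNormReal p a b + gigNormReal (p + -1) a b) / gigNormReal p a b := by gcongr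
      _ = 1 + (a * gigMean p a b - 2 * p) / b := by
          rw [add_div, div_self hpos.ne', gigInvMean_eq p ha hb]
      _ ≤ 1 + (a * (√(b / a) + gigMeanConst p a) - 2 * p) / b := by
          gcongr; exact gigMean_le p ha hb
      _ = 1 + (√a / √b + a * gigMeanConst p a / b + -2 * p / b) := by
          rw [Real.sqrt_div hb.le]
          have h1 : √a ^ 2 = a := Real.sq_sqrt ha.le
          have h2 : √b ^ 2 = b := Real.sq_sqrt hb.le
          have h3 := Real.sqrt_pos.2 ha
          have h4 := Real.sqrt_pos.2 hb
          have h5 : a * (√b / √a) / b = √a / √b := by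
            nth_rewrite 1 [← h1]
            nth_rewrite 2 [← h2]
            field_simp
          rw [← h5]
          ring
      _ ≤ C := by
          have := gigMeanConst_nonneg p ha
          have : 0 ≤ -2 * p := by linarith
          rw [hC]
          gcongr

end GIG

/-! ### Ridge-type precision matrices -/

section Ridge

variable {n m : ℕ} {r : ℝ} {B : Matrix (Fin m) (Fin n) ℝ} {v : Fin n → ℝ}

/-- The matrix `r Bᵀ B + diag(v)⁻¹`. -/
def ridge (r : ℝ) (B : Matrix (Fin m) (Fin n) ℝ) (v : Fin n → ℝ) : Matrix (Fin n) (Fin n) ℝ :=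
  r • (Bᵀ * B) + Matrix.diagonal fun i => (v i)⁻¹

theorem ridge_mulVec (x : Fin n → ℝ) (i : Fin n) :
    (ridge r B v *ᵥ x) i = r * (Bᵀ *ᵥ (B *ᵥ x)) i + x i / v i := by
  rw [ridge, add_mulVec, smul_mulVec, ← mulVec_mulVec, Pi.add_apply, Pi.smul_apply, smul_eq_mul,
    mulVec_diagonal, inv_mul_eq_div]

theorem dotProduct_ridge_mulVec (w x : Fin n → ℝ) :
    w ⬝ᵥ (ridge r B v *ᵥ x) = r * ((B *ᵥ w) ⬝ᵥ (B *ᵥ x)) + ∑ i, w i * x i / v i := by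
  have : (B *ᵥ w) ⬝ᵥ (B *ᵥ x) = w ⬝ᵥ (Bᵀ *ᵥ (B *ᵥ x)) := by
    rw [dotProduct_mulVec, dotProduct_mulVec, vecMul_transpose, dotProduct_mulVec]
  rw [this]
  simp only [dotProduct, ridge_mulVec, mul_add, Finset.sum_add_distrib, Finset.mul_sum]
  congr 1
  · exact Finset.sum_congr rfl fun i _ => by ring
  · exact Finset.sum_congr rfl fun i _ => by ring

theorem ridge_posDef (hr : 0 ≤ r) (hv : ∀ i, 0 < v i) : (ridge r B v).PosDef := by
  refine Matrix.PosDef.posSemidef_add ?_ (posDef_diagonal_iff.2 fun i => inv_pos.2 (hv i))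
  exact (posSemidef_conjTranspose_mul_self B).smul hr

theorem ridge_mulVec_inv (hr : 0 ≤ r) (hv : ∀ i, 0 < v i) (u : Fin n → ℝ) :
    ridge r B v *ᵥ ((ridge r B v)⁻¹ *ᵥ u) = u := by
  rw [mulVec_mulVec, mul_nonsing_inv _ (ridge_posDef hr hv).det_pos.ne'.isUnit, one_mulVec]

/-- The equation `Q x = u` tested against `x`. Dropping one of the two nonnegative terms on the left
gives most of the estimates below. -/
theorem ridge_inv_energy (hr : 0 ≤ r) (hv : ∀ i, 0 < v i) (u : Fin n → ℝ) :
    r * ((B *ᵥ ((ridge r B v)⁻¹ *ᵥ u)) ⬝ᵥ (B *ᵥ ((ridge r B v)⁻¹ *ᵥ u)))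
      + ∑ i, ((ridge r B v)⁻¹ *ᵥ u) i ^ 2 / v i = ((ridge r B v)⁻¹ *ᵥ u) ⬝ᵥ u := by
  have h := dotProduct_ridge_mulVec (r := r) (B := B) (v := v) ((ridge r B v)⁻¹ *ᵥ u)
    ((ridge r B v)⁻¹ *ᵥ u)
  rw [ridge_mulVec_inv hr hv] at h
  rw [h]
  simp only [sq]

theorem dotProduct_self_nonneg' {k : ℕ} (x : Fin k → ℝ) : 0 ≤ x ⬝ᵥ x :=
  Finset.sum_nonneg fun i _ => mul_self_nonneg (x i)

theorem ridge_inv_sum_sq_div_le (hr : 0 ≤ r) (hv : ∀ i, 0 < v i) (u : Fin n → ℝ) :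
    ∑ i, ((ridge r B v)⁻¹ *ᵥ u) i ^ 2 / v i ≤ ((ridge r B v)⁻¹ *ᵥ u) ⬝ᵥ u := by
  rw [← ridge_inv_energy hr hv u]
  exact le_add_of_nonneg_left (mul_nonneg hr (dotProduct_self_nonneg' _))

theorem ridge_inv_diag_pos (hr : 0 ≤ r) (hv : ∀ i, 0 < v i) (i : Fin n) :
    0 < (ridge r B v)⁻¹ i i := (ridge_posDef hr hv).inv.diag_pos

/-- The energy bound at `u = e_i`, of whose sum only the `i`-th term is kept, reads `t² / v i ≤ t`
with `t` the diagonal entry. -/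
theorem ridge_inv_diag_le (hr : 0 ≤ r) (hv : ∀ i, 0 < v i) (i : Fin n) :
    (ridge r B v)⁻¹ i i ≤ v i := by
  have h := ridge_inv_sum_sq_div_le (B := B) hr hv (Pi.single i 1)
  have hpos := ridge_inv_diag_pos (B := B) hr hv i
  have e : ∀ j, ((ridge r B v)⁻¹ *ᵥ Pi.single i 1) j = (ridge r B v)⁻¹ j i := fun j => by simp
  rw [dotProduct_single_one, e, Finset.sum_congr rfl fun j _ => by rw [e j]] at h
  have h2 : (ridge r B v)⁻¹ i i ^ 2 / v i ≤ (ridge r B v)⁻¹ i i :=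
    (Finset.single_le_sum (f := fun j => (ridge r B v)⁻¹ j i ^ 2 / v j)
    (fun j _ => div_nonneg (sq_nonneg _) (hv j).le) (Finset.mem_univ i)).trans h
  rw [div_le_iff₀ (hv i), sq] at h2
  exact le_of_mul_le_mul_left h2 hpos

/-- The general inequality `1 / Q_ii ≤ (Q⁻¹)_ii`, from nonnegativity of the form `Q` at `Q⁻¹ e_i -
e_i / Q_ii`. -/
theorem le_ridge_inv_diag (hr : 0 ≤ r) (hv : ∀ i, 0 < v i) (i : Fin n) :
    (r * (Bᵀ * B) i i + (v i)⁻¹)⁻¹ ≤ (ridge r B v)⁻¹ i i := by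
  have hQ := ridge_posDef (B := B) hr hv
  set Q := ridge r B v with hQd
  have hQii : Q i i = r * (Bᵀ * B) i i + (v i)⁻¹ := by
    rw [hQd, ridge, Matrix.add_apply, Matrix.smul_apply, diagonal_apply_eq, smul_eq_mul]
  have hQpos : 0 < Q i i := hQ.diag_pos
  rw [← hQii]
  set e : Fin n → ℝ := Pi.single i 1
  set x := Q⁻¹ *ᵥ e with hx
  have hQx : Q *ᵥ x = e := ridge_mulVec_inv hr hv e
  have hxi : x i = Q⁻¹ i i := by simp [hx, e]
  have h := hQ.posSemidef.dotProduct_mulVec_nonneg (x - (Q i i)⁻¹ • e)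
  have hQT : Qᵀ = Q := by
    have := hQ.isHermitian
    rwa [IsHermitian, conjTranspose_eq_transpose_of_trivial] at this
  have hsym : x ⬝ᵥ (Q *ᵥ e) = 1 := by
    rw [dotProduct_mulVec, ← mulVec_transpose, hQT, hQx]
    simp [e]
  have hee : e ⬝ᵥ (Q *ᵥ e) = Q i i := by simp [e]
  have hxe : x ⬝ᵥ e = x i := by simp [e]
  have hee2 : e ⬝ᵥ e = 1 := by simp [e]
  rw [star_trivial, mulVec_sub, mulVec_smul, hQx, sub_dotProduct, dotProduct_sub, dotProduct_sub,
    dotProduct_smul, smul_dotProduct, smul_dotProduct, dotProduct_smul, hsym, hee, hxe, hee2] at h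
  simp only [smul_eq_mul] at h
  rw [inv_mul_cancel₀ hQpos.ne', hxi] at h
  linarith

/-- With `x = Q⁻¹ 1`, the sum of `2 |x i| ≤ x i² / v i + v i` and the energy bound `∑ x i² / v i ≤ ∑
x i` give the estimate with constant exactly one. -/
theorem sum_abs_ridge_inv_one_le (hr : 0 ≤ r) (hv : ∀ i, 0 < v i) :
    ∑ i, |((ridge r B v)⁻¹ *ᵥ 1) i| ≤ ∑ i, v i := by
  have h := ridge_inv_sum_sq_div_le (B := B) hr hv 1
  set x := (ridge r B v)⁻¹ *ᵥ 1
  have hx : x ⬝ᵥ 1 ≤ ∑ i, |x i| := by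
    rw [dotProduct_one]; exact Finset.sum_le_sum fun i _ => le_abs_self _
  have hcs : ∀ i, 2 * |x i| ≤ x i ^ 2 / v i + v i := by
    intro i
    have := hv i
    rw [div_add' _ _ _ this.ne', le_div_iff₀ this, ← sq_abs (x i)]
    nlinarith [sq_nonneg (|x i| - v i)]
  have := Finset.sum_le_sum fun i (_ : i ∈ Finset.univ) => hcs i
  rw [← Finset.mul_sum, Finset.sum_add_distrib] at this
  linarith

/-- Each `v i` is at most `T = √(∑ v i²)`, so the energy bound gives `|x|² ≤ T (x ⬝ u)`;
Cauchy-Schwarz finishes. -/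
theorem sum_sq_ridge_inv_le (hr : 0 ≤ r) (hv : ∀ i, 0 < v i) (u : Fin n → ℝ) :
    ∑ i, ((ridge r B v)⁻¹ *ᵥ u) i ^ 2 ≤ (∑ i, u i ^ 2) * ∑ i, v i ^ 2 := by
  have h := ridge_inv_sum_sq_div_le (B := B) hr hv u
  set x := (ridge r B v)⁻¹ *ᵥ u
  set N := ∑ i, x i ^ 2 with hN
  set T := √(∑ i, v i ^ 2) with hT
  have hvT : ∀ i, v i ≤ T := fun i => Real.le_sqrt_of_sq_le
    (Finset.single_le_sum (f := fun i => v i ^ 2) (fun j _ => sq_nonneg _) (Finset.mem_univ i))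
  have hT2 : T ^ 2 = ∑ i, v i ^ 2 := Real.sq_sqrt (Finset.sum_nonneg fun i _ => sq_nonneg _)
  have hN0 : 0 ≤ N := Finset.sum_nonneg fun i _ => sq_nonneg _
  have h1 : N ≤ T * (x ⬝ᵥ u) := by
    refine le_trans ?_ (mul_le_mul_of_nonneg_left h (Real.sqrt_nonneg _))
    rw [hN, Finset.mul_sum]
    refine Finset.sum_le_sum fun i _ => ?_
    rw [← mul_div_assoc, le_div_iff₀ (hv i), mul_comm]
    exact mul_le_mul_of_nonneg_right (hvT i) (sq_nonneg _)
  have hcs : (x ⬝ᵥ u) ^ 2 ≤ N * ∑ i, u i ^ 2 := Finset.sum_mul_sq_le_sq_mul_sq _ _ _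
  have hU0 : 0 ≤ ∑ i, u i ^ 2 := Finset.sum_nonneg fun i _ => sq_nonneg _
  rw [← hT2]
  rcases hN0.eq_or_lt with h0 | h0
  · rw [← h0]; positivity
  have h2 : N ^ 2 ≤ T ^ 2 * (N * ∑ i, u i ^ 2) := by
    calc N ^ 2 ≤ (T * (x ⬝ᵥ u)) ^ 2 := by gcongr
      _ = T ^ 2 * (x ⬝ᵥ u) ^ 2 := by ring
      _ ≤ _ := by gcongr
  have h3 : N * N ≤ N * ((∑ i, u i ^ 2) * T ^ 2) := by linarith
  exact le_of_mul_le_mul_left h3 h0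

/-- The closed cone of vectors with sign pattern `s`. -/
def signCone (s : Fin n → SignType) : Set (Fin n → ℝ) :=
  {x | ∀ i, 0 ≤ (s i : ℝ) * x i ∧ (s i = 0 → x i = 0)}

theorem isClosed_signCone (s : Fin n → SignType) : IsClosed (signCone s) := by
  simp only [signCone, Set.ofPred_forall]
  refine isClosed_iInter fun i => ?_
  refine IsClosed.and (isClosed_le continuous_const (by fun_prop)) ?_
  by_cases h : s i = 0
  · simp only [h, true_implies]
    exact isClosed_eq (continuous_apply i) continuous_const
  · simp [h]

/-- Compactness: `‖B x‖` has a positive minimum on the unit vectors of a closed cone that meets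
`Null(B)` only at zero. -/
theorem exists_norm_le_of_signCone (B : Matrix (Fin m) (Fin n) ℝ) (s : Fin n → SignType)
    (hs : ∀ x ∈ signCone s, B *ᵥ x = 0 → x = 0) :
    ∃ c : ℝ, 0 ≤ c ∧ ∀ x ∈ signCone s, ‖x‖ ≤ c * ‖B *ᵥ x‖ := by
  have hcont : Continuous fun x : Fin n → ℝ => ‖B *ᵥ x‖ := by fun_prop
  have hK : IsCompact (signCone s ∩ Metric.sphere 0 1) :=
    (isCompact_sphere _ _).inter_left (isClosed_signCone s)
  have hscale : ∀ x ∈ signCone s, x ≠ 0 → ‖x‖⁻¹ • x ∈ signCone s ∩ Metric.sphere 0 1 := by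
    intro x hx hx0
    have hn : 0 < ‖x‖ := norm_pos_iff.2 hx0
    refine ⟨fun i => ⟨?_, fun h => ?_⟩, ?_⟩
    · rw [Pi.smul_apply, smul_eq_mul, mul_left_comm]
      exact mul_nonneg (inv_pos.2 hn).le (hx i).1
    · rw [Pi.smul_apply, (hx i).2 h, smul_zero]
    · simp [norm_smul, hn.ne']
  by_cases hne : (signCone s ∩ Metric.sphere 0 1).Nonempty
  · obtain ⟨y, hy, hmin⟩ := hK.exists_isMinOn hne hcont.continuousOn
    have hBy : 0 < ‖B *ᵥ y‖ := by
      refine norm_pos_iff.2 fun h => ?_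
      have := hs y hy.1 h
      have h1 := hy.2
      simp [this] at h1
    refine ⟨‖B *ᵥ y‖⁻¹, by positivity, fun x hx => ?_⟩
    by_cases hx0 : x = 0
    · simp [hx0]
    have hn : 0 < ‖x‖ := norm_pos_iff.2 hx0
    have h1 : ‖B *ᵥ y‖ ≤ ‖B *ᵥ (‖x‖⁻¹ • x)‖ := hmin (hscale x hx hx0)
    rw [mulVec_smul, norm_smul, norm_inv, norm_norm, inv_mul_eq_div, le_div_iff₀ hn] at h1
    rw [inv_mul_eq_div, le_div_iff₀ hBy, mul_comm]
    exact h1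
  · refine ⟨0, le_rfl, fun x hx => ?_⟩
    by_cases hx0 : x = 0
    · simp [hx0]
    · exact (hne ⟨_, hscale x hx hx0⟩).elim

/-- Uniform boundedness of ridge solutions in the directions orthogonal to the null space. -/
theorem exists_ridge_inv_bound (hr : 0 < r) (B : Matrix (Fin m) (Fin n) ℝ) (u : Fin n → ℝ)
    (hu : ∀ w, B *ᵥ w = 0 → w ⬝ᵥ u = 0) :
    ∃ C : ℝ, 0 ≤ C ∧ ∀ v : Fin n → ℝ, (∀ i, 0 < v i) →
      ∀ i, |((ridge r B v)⁻¹ *ᵥ u) i| ≤ C := by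
  -- There are finitely many sign patterns, so one constant serves all cones that meet `Null(B)`
  -- trivially.
  have hex : ∀ s : Fin n → SignType, ∃ c : ℝ, 0 ≤ c ∧
      ((∀ x ∈ signCone s, B *ᵥ x = 0 → x = 0) → ∀ x ∈ signCone s, ‖x‖ ≤ c * ‖B *ᵥ x‖) := by
    intro s
    by_cases hs : ∀ x ∈ signCone s, B *ᵥ x = 0 → x = 0
    · obtain ⟨c, hc, h⟩ := exists_norm_le_of_signCone B s hs
      exact ⟨c, hc, fun _ => h⟩
    · exact ⟨0, le_rfl, fun h => (hs h).elim⟩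
  choose c hc0 hc using hex
  set D := ∑ s, c s with hD
  have hD0 : 0 ≤ D := Finset.sum_nonneg fun s _ => hc0 s
  refine ⟨D * (D * (n * ‖u‖) / r), by positivity, fun v hv i => ?_⟩
  set x := (ridge r B v)⁻¹ *ᵥ u with hx
  have hQx : ridge r B v *ᵥ x = u := ridge_mulVec_inv hr.le hv u
  set s : Fin n → SignType := fun i => SignType.sign (x i) with hs
  have hmem : x ∈ signCone s := fun i =>
    ⟨by rw [hs, sign_mul_self]; exact abs_nonneg _, fun h => sign_eq_zero_iff.1 h⟩
  -- The key point: the sign cone of the solution `x` itself meets `Null(B)` trivially. For `y` in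
  -- both, `0 = y ⬝ u = y ⬝ Q x = ∑ y i x i / v i`, a sum of nonnegative terms, so `y` vanishes
  -- wherever `x` does not, and elsewhere by the definition of the cone. This holds for every `v`,
  -- whence the uniformity.
  have hcone : ∀ y ∈ signCone s, B *ᵥ y = 0 → y = 0 := by
    intro y hy hBy
    have h1 : ∑ i, y i * x i / v i = 0 := by
      have := dotProduct_ridge_mulVec (r := r) (B := B) (v := v) y x
      rw [hQx, hu y hBy, hBy, zero_dotProduct, mul_zero, zero_add] at this
      exact this.symm
    have h2 : ∀ i, 0 ≤ y i * x i := by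
      intro i
      have h := (hy i).1
      have h3 : y i * x i = (s i : ℝ) * y i * |x i| := by
        rw [← sign_mul_abs (x i)]
        simp only [hs, abs_mul]
        rcases lt_trichotomy (x i) 0 with h | h | h <;> simp [h, sign_neg, sign_pos]
      rw [h3]
      exact mul_nonneg h (abs_nonneg _)
    rw [Finset.sum_eq_zero_iff_of_nonneg fun i _ => div_nonneg (h2 i) (hv i).le] at h1
    ext i
    have h4 := h1 i (Finset.mem_univ i)
    rw [div_eq_zero_iff, or_iff_left (hv i).ne', mul_eq_zero] at h4
    rcases h4 with h4 | h4
    · exact h4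
    · exact (hy i).2 (by simp [hs, h4])
  have hxB : ‖x‖ ≤ D * ‖B *ᵥ x‖ := (hc s hcone x hmem).trans
    (mul_le_mul_of_nonneg_right (Finset.single_le_sum (fun s _ => hc0 s) (Finset.mem_univ s))
      (norm_nonneg _))
  have hxu : x ⬝ᵥ u ≤ n * ‖u‖ * ‖x‖ := by
    calc x ⬝ᵥ u ≤ ∑ _i : Fin n, ‖u‖ * ‖x‖ := by
          refine Finset.sum_le_sum fun i _ => ?_
          refine (le_abs_self _).trans ?_
          rw [abs_mul, mul_comm]
          exact mul_le_mul (norm_le_pi_norm u i) (norm_le_pi_norm x i) (abs_nonneg _) (norm_nonneg _)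
      _ = _ := by simp; ring
  have hBx : ‖B *ᵥ x‖ ^ 2 ≤ (B *ᵥ x) ⬝ᵥ (B *ᵥ x) := by
    have h0 := dotProduct_self_nonneg' (B *ᵥ x)
    refine (Real.le_sqrt (norm_nonneg _) h0).1 ?_
    rw [pi_norm_le_iff_of_nonneg (Real.sqrt_nonneg _)]
    intro j
    refine Real.le_sqrt_of_sq_le ?_
    rw [Real.norm_eq_abs, sq_abs, sq]
    exact Finset.single_le_sum (f := fun j => (B *ᵥ x) j * (B *ᵥ x) j)
      (fun j _ => mul_self_nonneg _) (Finset.mem_univ j)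
  -- Since `‖x‖` is bounded by a multiple of `‖B x‖`, the right side is linear in `‖B x‖` and the
  -- left side quadratic.
  have hen : r * ((B *ᵥ x) ⬝ᵥ (B *ᵥ x)) ≤ x ⬝ᵥ u := by
    rw [← ridge_inv_energy hr.le hv u]
    exact le_add_of_nonneg_right (Finset.sum_nonneg fun i _ => div_nonneg (sq_nonneg _) (hv i).le)
  have hfin : ‖B *ᵥ x‖ ≤ D * (n * ‖u‖) / r := by
    rw [le_div_iff₀ hr]
    rcases (norm_nonneg (B *ᵥ x)).eq_or_lt with h0 | h0
    · rw [← h0, zero_mul]; positivity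
    · refine le_of_mul_le_mul_left ?_ h0
      calc ‖B *ᵥ x‖ * (‖B *ᵥ x‖ * r) = r * ‖B *ᵥ x‖ ^ 2 := by ring
        _ ≤ r * ((B *ᵥ x) ⬝ᵥ (B *ᵥ x)) := by gcongr
        _ ≤ n * ‖u‖ * ‖x‖ := hen.trans hxu
        _ ≤ n * ‖u‖ * (D * ‖B *ᵥ x‖) := by gcongr
        _ = _ := by ring
  calc |x i| ≤ ‖x‖ := norm_le_pi_norm x i
    _ ≤ D * ‖B *ᵥ x‖ := hxB
    _ ≤ _ := by gcongr

end Ridge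

/-! ### Null-smallness as a bound on a projection. -/

namespace LLnGM

variable {n m q : ℕ} (S : LLnGM n m q)

/-- The columns of `N = K U` form a basis of `K Null(A) = Null(B)`, and `v = N G⁻¹ z` is the
orthogonal projection of the vector `1` onto this space, with `|v|² = zᵀ G⁻¹ z`. For `a = 0`, `μ ≠
0` the prefactor in null-smallness is one, so the condition reads `|v| < 1`. -/
theorem NullSmallness.exists_decomposition {S : LLnGM n m q} (h : S.NullSmallness)
    (hK : IsUnit S.K.det) (ha : S.a = 0) (hμ : S.μ ≠ 0) :
    ∃ v u : Fin n → ℝ, v + u = 1 ∧ ∑ i, v i ^ 2 < 1 ∧ ∀ w, S.B *ᵥ w = 0 → w ⬝ᵥ u = 0 := by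
  obtain ⟨r, U, hU, hrange, hsmall⟩ := h
  set N := S.K * U with hN
  set G := Uᵀ * S.Kᵀ * S.K * U with hG
  set z : Fin r → ℝ := (Uᵀ * S.Kᵀ) *ᵥ (1 : Fin n → ℝ) with hz
  have hGN : Nᵀ * N = G := by rw [hN, hG, transpose_mul]; simp only [Matrix.mul_assoc]
  have hzN : Nᵀ *ᵥ 1 = z := by rw [hz, hN, transpose_mul]
  have hGdet : IsUnit G.det := by
    rw [isUnit_iff_ne_zero]
    intro h0
    obtain ⟨c, hc, hGc⟩ := exists_mulVec_eq_zero_iff.2 h0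
    have hNc : N *ᵥ c = 0 := by
      rw [← hGN, ← mulVec_mulVec] at hGc
      have h1 : (N *ᵥ c) ⬝ᵥ (N *ᵥ c) = 0 := by
        rw [dotProduct_mulVec, ← mulVec_transpose, hGc, zero_dotProduct]
      exact dotProduct_self_eq_zero.1 h1
    apply hc
    have h2 : S.K⁻¹ *ᵥ (N *ᵥ c) = U *ᵥ c := by
      rw [hN, mulVec_mulVec, ← Matrix.mul_assoc, nonsing_inv_mul _ hK, Matrix.one_mul]
    have h3 : Uᵀ *ᵥ (U *ᵥ c) = c := by rw [mulVec_mulVec, hU, one_mulVec]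
    rw [← h3, ← h2, hNc]
    simp
  have hvz : Nᵀ *ᵥ (N *ᵥ (G⁻¹ *ᵥ z)) = z := by
    rw [mulVec_mulVec, hGN, mulVec_mulVec, mul_nonsing_inv _ hGdet, one_mulVec]
  refine ⟨N *ᵥ (G⁻¹ *ᵥ z), 1 - N *ᵥ (G⁻¹ *ᵥ z), add_sub_cancel _ _, ?_, fun w hw => ?_⟩
  · have e : ∑ i, (N *ᵥ (G⁻¹ *ᵥ z)) i ^ 2 = z ⬝ᵥ (G⁻¹ *ᵥ z) := by
      calc ∑ i, (N *ᵥ (G⁻¹ *ᵥ z)) i ^ 2 = (N *ᵥ (G⁻¹ *ᵥ z)) ⬝ᵥ (N *ᵥ (G⁻¹ *ᵥ z)) := by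
            simp only [dotProduct, sq]
        _ = (Nᵀ *ᵥ (N *ᵥ (G⁻¹ *ᵥ z))) ⬝ᵥ (G⁻¹ *ᵥ z) := by
            rw [dotProduct_mulVec, ← mulVec_transpose]
        _ = _ := by rw [hvz]
    rw [e]
    rcases hsmall with hr0 | hlt
    · subst hr0; simp [dotProduct]
    · simp only at hlt
      rw [ha, mul_zero, zero_add, Real.sqrt_sq_eq_abs, div_self (abs_ne_zero.2 hμ), one_mul] at hlt
      rw [Real.sqrt_lt' one_pos, one_pow] at hlt
      exact hlt
  · have hker : S.K⁻¹ *ᵥ w ∈ LinearMap.ker S.A.mulVecLin := by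
      rw [LinearMap.mem_ker, mulVecLin_apply, mulVec_mulVec]; exact hw
    rw [← hrange] at hker
    obtain ⟨c, hc⟩ := hker
    rw [mulVecLin_apply] at hc
    have hwN : w = N *ᵥ c := by
      rw [hN, ← mulVec_mulVec, hc, mulVec_mulVec, mul_nonsing_inv _ hK, one_mulVec]
    rw [hwN, dotProduct_comm, dotProduct_mulVec, ← mulVec_transpose, mulVec_sub, hzN, hvz, sub_self,
      zero_dotProduct]

end LLnGM

/-! ### Identities for the joint density -/

namespace LLnGM

open Filter

variable {n m q : ℕ} (S : LLnGM n m q)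

theorem Qbar_eq_ridge (V : MixSpace n) : S.Qbar V = ridge S.ρ S.B V.toVec := rfl

theorem toVec_pos (V : MixSpace n) (i : Fin n) : 0 < V.toVec i := (V i).2

variable {S}

theorem ρ_pos (hσ : 0 < S.σ) (hσε : 0 < S.σε) : 0 < S.ρ := by unfold ρ; positivity

theorem Qbar_posDef (hσ : 0 < S.σ) (hσε : 0 < S.σε) (V : MixSpace n) : (S.Qbar V).PosDef :=
  ridge_posDef (ρ_pos hσ hσε).le (toVec_pos V)

theorem condPrecision_posDef (hσ : 0 < S.σ) (hσε : 0 < S.σε) (V : MixSpace n) :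
    ((S.σ ^ 2)⁻¹ • S.Qbar V).PosDef :=
  (Qbar_posDef hσ hσε V).smul (by positivity)

theorem condPrecision_inv (hσ : 0 < S.σ) (hσε : 0 < S.σε) (V : MixSpace n) (i : Fin n) :
    ((S.σ ^ 2)⁻¹ • S.Qbar V)⁻¹ i i = S.σ ^ 2 * (S.Qbar V)⁻¹ i i := by
  have hu : IsUnit (S.Qbar V).det := (Qbar_posDef hσ hσε V).det_pos.ne'.isUnit
  have h := Matrix.inv_smul' (A := S.Qbar V) (Units.mk0 ((S.σ ^ 2)⁻¹) (by positivity)) hu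
  rw [Units.smul_mk0] at h
  rw [h]
  simp [Units.smul_def]

theorem latentPrecision_posDef (hσ : 0 < S.σ) (V : MixSpace n) :
    (Matrix.diagonal fun i => (S.σ ^ 2 * V.toVec i)⁻¹).PosDef :=
  posDef_diagonal_iff.2 fun i => by have := toVec_pos V i; positivity

/-- The normalising constant of a Gaussian density. -/
theorem gaussianDensity_const_pos {k : ℕ} {Q : Matrix (Fin k) (Fin k) ℝ} (hQ : Q.PosDef) :
    0 < √(Q.det / (2 * Real.pi) ^ Fintype.card (Fin k)) := by
  have := hQ.det_pos
  positivity

theorem gaussianDensity_quadratic {Q : Matrix (Fin n) (Fin n) ℝ} (hQ : Q.PosDef)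
    (u x : Fin n → ℝ) :
    (x - Q⁻¹ *ᵥ u) ⬝ᵥ (Q *ᵥ (x - Q⁻¹ *ᵥ u))
      = x ⬝ᵥ (Q *ᵥ x) - 2 * (x ⬝ᵥ u) + (Q⁻¹ *ᵥ u) ⬝ᵥ u := by
  have hu : Q *ᵥ (Q⁻¹ *ᵥ u) = u := by
    rw [mulVec_mulVec, mul_nonsing_inv _ hQ.det_pos.ne'.isUnit, one_mulVec]
  have hQT : Qᵀ = Q := by
    have := hQ.isHermitian
    rwa [IsHermitian, conjTranspose_eq_transpose_of_trivial] at this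
  have h1 : (Q⁻¹ *ᵥ u) ⬝ᵥ (Q *ᵥ x) = x ⬝ᵥ u := by
    rw [dotProduct_mulVec, ← mulVec_transpose, hQT, hu, dotProduct_comm]
  rw [mulVec_sub, hu, sub_dotProduct, dotProduct_sub, dotProduct_sub, h1]
  ring

/-- Completing the square in `M`. -/
theorem exists_latent_mul_likelihood (hσ : 0 < S.σ) (hσε : 0 < S.σε) (V : MixSpace n) :
    ∃ c : ℝ, 0 < c ∧ ∀ M, S.latentDensity V M * S.likelihood M = c * S.condM V M := by
  have hV := toVec_pos V
  set y := S.Y - S.X *ᵥ S.β + S.μ • (S.B *ᵥ S.h) with hy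
  -- The part of the exponent, in units of `-1/(2σ²)`, that does not depend on `M` after completing
  -- the square.
  set k := S.μ ^ 2 * ∑ i, V.toVec i + S.ρ * (y ⬝ᵥ y)
    - ((S.Qbar V)⁻¹ *ᵥ S.mbar) ⬝ᵥ S.mbar with hk
  have hε : ((S.σε ^ 2)⁻¹ • (1 : Matrix (Fin m) (Fin m) ℝ)).PosDef :=
    PosDef.one.smul (by positivity)
  have h1 := gaussianDensity_const_pos (latentPrecision_posDef hσ V)
  have h2 := gaussianDensity_const_pos hε
  have h3 := gaussianDensity_const_pos (condPrecision_posDef hσ hσε V)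
  set c₁ := √((Matrix.diagonal fun i => (S.σ ^ 2 * V.toVec i)⁻¹).det /
    (2 * Real.pi) ^ Fintype.card (Fin n)) with hc₁
  set c₂ := √(((S.σε ^ 2)⁻¹ • (1 : Matrix (Fin m) (Fin m) ℝ)).det /
    (2 * Real.pi) ^ Fintype.card (Fin m)) with hc₂
  set c₃ := √(((S.σ ^ 2)⁻¹ • S.Qbar V).det / (2 * Real.pi) ^ Fintype.card (Fin n)) with hc₃
  refine ⟨c₁ * c₂ / c₃ * Real.exp (-(1 / 2) * ((S.σ ^ 2)⁻¹ * k)), by positivity, fun M => ?_⟩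
  have e1 : (M - S.μ • V.toVec) ⬝ᵥ
      ((Matrix.diagonal fun i => (S.σ ^ 2 * V.toVec i)⁻¹) *ᵥ (M - S.μ • V.toVec))
      = (S.σ ^ 2)⁻¹ * (∑ i, M i * M i / V.toVec i - 2 * S.μ * (M ⬝ᵥ 1)
        + S.μ ^ 2 * ∑ i, V.toVec i) := by
    simp only [dotProduct, mulVec_diagonal, Pi.sub_apply, Pi.smul_apply, smul_eq_mul, Finset.mul_sum,
      ← Finset.sum_sub_distrib, ← Finset.sum_add_distrib, Pi.one_apply]
    refine Finset.sum_congr rfl fun i _ => ?_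
    have := hV i
    field_simp
    ring
  have e2 : (S.Y - (S.X *ᵥ S.β + S.B *ᵥ (M - S.μ • S.h))) ⬝ᵥ
      (((S.σε ^ 2)⁻¹ • (1 : Matrix (Fin m) (Fin m) ℝ)) *ᵥ
        (S.Y - (S.X *ᵥ S.β + S.B *ᵥ (M - S.μ • S.h))))
      = (S.σ ^ 2)⁻¹ * (S.ρ * ((S.B *ᵥ M) ⬝ᵥ (S.B *ᵥ M) - 2 * (M ⬝ᵥ (S.Bᵀ *ᵥ y)) + y ⬝ᵥ y)) := by
    have : S.Y - (S.X *ᵥ S.β + S.B *ᵥ (M - S.μ • S.h)) = y - S.B *ᵥ M := by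
      rw [hy, mulVec_sub, mulVec_smul]; abel
    rw [this, smul_mulVec, one_mulVec, dotProduct_smul, sub_dotProduct, dotProduct_sub,
      dotProduct_sub, dotProduct_mulVec M, vecMul_transpose, dotProduct_comm y (S.B *ᵥ M), smul_eq_mul,
      ρ]
    field_simp
    ring
  have e3 : (M - (S.Qbar V)⁻¹ *ᵥ S.mbar) ⬝ᵥ
      (((S.σ ^ 2)⁻¹ • S.Qbar V) *ᵥ (M - (S.Qbar V)⁻¹ *ᵥ S.mbar))
      = (S.σ ^ 2)⁻¹ * (S.ρ * ((S.B *ᵥ M) ⬝ᵥ (S.B *ᵥ M)) + ∑ i, M i * M i / V.toVec i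
        - 2 * (S.ρ * (M ⬝ᵥ (S.Bᵀ *ᵥ y)) + S.μ * (M ⬝ᵥ 1))
        + ((S.Qbar V)⁻¹ *ᵥ S.mbar) ⬝ᵥ S.mbar) := by
    rw [smul_mulVec, dotProduct_smul, gaussianDensity_quadratic (Qbar_posDef hσ hσε V),
      Qbar_eq_ridge, dotProduct_ridge_mulVec, smul_eq_mul]
    congr 4
    rw [mbar, dotProduct_add, dotProduct_smul, dotProduct_smul, smul_eq_mul, smul_eq_mul]
  rw [latentDensity, likelihood, condM, gaussianDensity, gaussianDensity, gaussianDensity, e1, e2, e3]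
  rw [← hc₁, ← hc₂, ← hc₃]
  have : Real.exp (-(1 / 2) * ((S.σ ^ 2)⁻¹ * k)) * Real.exp (-(1 / 2) * ((S.σ ^ 2)⁻¹ *
      (S.ρ * ((S.B *ᵥ M) ⬝ᵥ (S.B *ᵥ M)) + ∑ i, M i * M i / V.toVec i
        - 2 * (S.ρ * (M ⬝ᵥ (S.Bᵀ *ᵥ y)) + S.μ * (M ⬝ᵥ 1))
        + ((S.Qbar V)⁻¹ *ᵥ S.mbar) ⬝ᵥ S.mbar)))
      = Real.exp (-(1 / 2) * ((S.σ ^ 2)⁻¹ * (∑ i, M i * M i / V.toVec i - 2 * S.μ * (M ⬝ᵥ 1)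
        + S.μ ^ 2 * ∑ i, V.toVec i))) * Real.exp (-(1 / 2) * ((S.σ ^ 2)⁻¹ * (S.ρ *
        ((S.B *ᵥ M) ⬝ᵥ (S.B *ᵥ M) - 2 * (M ⬝ᵥ (S.Bᵀ *ᵥ y)) + y ⬝ᵥ y)))) := by
    rw [← Real.exp_add, ← Real.exp_add, hk]
    congr 1
    ring
  calc _ = c₁ * c₂ * (Real.exp (-(1 / 2) * ((S.σ ^ 2)⁻¹ * (∑ i, M i * M i / V.toVec i
        - 2 * S.μ * (M ⬝ᵥ 1) + S.μ ^ 2 * ∑ i, V.toVec i))) * Real.exp (-(1 / 2) * ((S.σ ^ 2)⁻¹ *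
        (S.ρ * ((S.B *ᵥ M) ⬝ᵥ (S.B *ᵥ M) - 2 * (M ⬝ᵥ (S.Bᵀ *ᵥ y)) + y ⬝ᵥ y))))) := by ring
    _ = _ := by
        rw [← this]
        field_simp

theorem measurable_condM_right (V : MixSpace n) : Measurable (S.condM V) :=
  measurable_gaussianDensity_right _ _

theorem lintegral_condM (hσ : 0 < S.σ) (hσε : 0 < S.σε) (V : MixSpace n) :
    ∫⁻ M, ENNReal.ofReal (S.condM V M) = 1 :=
  lintegral_gaussianDensity (condPrecision_posDef hσ hσε V) _

theorem priorDensity_ne_zero (hp : GIGProper S.p S.a S.b) (V : MixSpace n) :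
    S.priorDensity V ≠ 0 :=
  Finset.prod_ne_zero_iff.2 fun _ _ =>
    (ENNReal.div_pos (gigKernel_pos _ _ _ _).ne' hp.gigNorm_ne_top).ne'

theorem exists_jointDensity_eq (hσ : 0 < S.σ) (hσε : 0 < S.σε) (V : MixSpace n) :
    ∃ c : ℝ, 0 < c ∧ ∀ M, S.jointDensity V M
      = S.priorDensity V * ENNReal.ofReal c * ENNReal.ofReal (S.condM V M) := by
  obtain ⟨c, hc, h⟩ := exists_latent_mul_likelihood hσ hσε V
  refine ⟨c, hc, fun M => ?_⟩
  rw [jointDensity, mul_assoc, mul_assoc, ← ENNReal.ofReal_mul hc.le, ← h,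
    ENNReal.ofReal_mul (show 0 ≤ S.latentDensity V M from gaussianDensity_nonneg _ _ _)]

theorem jointDensity_eq_marginal_mul (hσ : 0 < S.σ) (hσε : 0 < S.σε) (V : MixSpace n)
    (M : Fin n → ℝ) :
    S.jointDensity V M = S.marginalDensity V * ENNReal.ofReal (S.condM V M) := by
  obtain ⟨c, hc, h⟩ := exists_jointDensity_eq hσ hσε V
  have : S.marginalDensity V = S.priorDensity V * ENNReal.ofReal c := by
    rw [marginalDensity, lintegral_congr h,
      lintegral_const_mul _ (measurable_condM_right V).ennreal_ofReal, lintegral_condM hσ hσε, mul_one]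
  rw [h, this]

theorem marginalDensity_ne_zero (hσ : 0 < S.σ) (hσε : 0 < S.σε) (hp : GIGProper S.p S.a S.b)
    (V : MixSpace n) : S.marginalDensity V ≠ 0 := by
  obtain ⟨c, hc, h⟩ := exists_jointDensity_eq hσ hσε V
  rw [marginalDensity, lintegral_congr h,
    lintegral_const_mul _ (measurable_condM_right V).ennreal_ofReal, lintegral_condM hσ hσε, mul_one]
  exact mul_ne_zero (priorDensity_ne_zero hp V) (by simpa using hc)

theorem measurable_latentDensity :
    Measurable fun t : MixSpace n × (Fin n → ℝ) => S.latentDensity t.1 t.2 := by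
  refine measurable_gaussianDensity (fun i j => ?_) (fun i => ?_) (fun _ => by fun_prop)
  · simp only [Matrix.diagonal_apply, MixSpace.toVec]
    by_cases hij : i = j
    · simp only [hij, if_true]; fun_prop
    · simp only [hij, if_false]; exact measurable_const
  · simp only [Pi.smul_apply, MixSpace.toVec, smul_eq_mul]; fun_prop

theorem measurable_likelihood : Measurable S.likelihood := by
  refine measurable_gaussianDensity (fun _ _ => measurable_const) (fun i => ?_)
    (fun _ => measurable_const)
  simp only [Pi.add_apply, Matrix.mulVec, dotProduct, Pi.sub_apply]
  fun_prop

theorem measurable_priorDensity : Measurable S.priorDensity :=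
  Finset.measurable_prod _ fun i _ =>
    (measurable_gigDensity_right _ _ _).comp (measurable_pi_apply i)

theorem measurable_jointDensity :
    Measurable fun t : MixSpace n × (Fin n → ℝ) => S.jointDensity t.1 t.2 :=
  ((measurable_priorDensity.comp measurable_fst).mul measurable_latentDensity.ennreal_ofReal).mul
    (measurable_likelihood.comp measurable_snd).ennreal_ofReal

theorem measurable_marginalDensity : Measurable S.marginalDensity :=
  measurable_jointDensity.lintegral_prod_right'

theorem likelihood_le (M : Fin n → ℝ) :
    S.likelihood M ≤ √(((S.σε ^ 2)⁻¹ • (1 : Matrix (Fin m) (Fin m) ℝ)).det /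
      (2 * Real.pi) ^ Fintype.card (Fin m)) := by
  unfold likelihood gaussianDensity
  refine mul_le_of_le_one_right (Real.sqrt_nonneg _) (Real.exp_le_one_iff.2 ?_)
  rw [smul_mulVec, one_mulVec, dotProduct_smul, smul_eq_mul]
  have h1 := dotProduct_self_nonneg' (S.Y - (S.X *ᵥ S.β + S.B *ᵥ (M - S.μ • S.h)))
  have h2 : 0 ≤ (S.σε ^ 2)⁻¹ := by positivity
  have := mul_nonneg h2 h1
  linarith

/-- The law with density `Π gigDensity` is a product of `GIG` laws. -/
theorem pi_gigLaw {p a : ℝ} {b : Fin n → ℝ} (h : ∀ i, GIGProper p a (b i)) :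
    Measure.pi (fun i => gigLaw p a (b i))
      = (lebMix n).withDensity fun V => ∏ i, gigDensity p a (b i) (V i) :=
  pi_withDensity (μ := fun _ => lebPos) (f := fun i => gigDensity p a (b i))
    (fun i => measurable_gigDensity_right _ _ _)
    fun i => by have := (h i).isProbabilityMeasure; exact inferInstanceAs (SigmaFinite (gigLaw p a (b i)))

theorem lintegral_priorDensity (hp : GIGProper S.p S.a S.b) :
    ∫⁻ V, S.priorDensity V ∂lebMix n = 1 := by
  have h := congrArg (fun μ : Measure (MixSpace n) => μ Set.univ)
    (pi_gigLaw (n := n) (b := fun _ => S.b) fun _ => hp)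
  have := hp.isProbabilityMeasure
  simp only [withDensity_apply _ MeasurableSet.univ, Measure.restrict_univ, measure_univ] at h
  exact h.symm

theorem lintegral_marginalDensity_ne_top (hσ : 0 < S.σ) (hp : GIGProper S.p S.a S.b) :
    ∫⁻ V, S.marginalDensity V ∂lebMix n ≠ ∞ := by
  set c := √(((S.σε ^ 2)⁻¹ • (1 : Matrix (Fin m) (Fin m) ℝ)).det /
      (2 * Real.pi) ^ Fintype.card (Fin m))
  have h : ∀ V, S.marginalDensity V ≤ S.priorDensity V * ENNReal.ofReal c := by
    intro V
    calc S.marginalDensity V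
        ≤ ∫⁻ M, S.priorDensity V * ENNReal.ofReal (S.latentDensity V M) * ENNReal.ofReal c :=
          lintegral_mono fun M => mul_le_mul_right (ENNReal.ofReal_le_ofReal (likelihood_le M)) _
      _ = S.priorDensity V * ENNReal.ofReal c := by
          have hm : Measurable fun M => ENNReal.ofReal (S.latentDensity V M) :=
            (measurable_gaussianDensity_right _ _).ennreal_ofReal
          rw [lintegral_mul_const _ (hm.const_mul _), lintegral_const_mul _ hm]
          have := lintegral_gaussianDensity (latentPrecision_posDef hσ V) (S.μ • V.toVec)
          change ∫⁻ M, ENNReal.ofReal (S.latentDensity V M) = 1 at this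
          rw [this, mul_one]
  refine ne_top_of_le_ne_top ?_ (lintegral_mono h)
  rw [lintegral_mul_const _ measurable_priorDensity, lintegral_priorDensity hp, one_mul]
  exact ENNReal.ofReal_ne_top

theorem lebMix_ne_zero : lebMix n ≠ 0 := by
  intro h
  have := congrArg (fun μ : Measure (MixSpace n) => μ Set.univ) h
  simp only [lebMix, Measure.pi_univ, Measure.coe_zero, Pi.zero_apply, Finset.prod_eq_zero_iff,
    Measure.measure_univ_eq_zero] at this
  obtain ⟨i, -, hi⟩ := this
  exact lebPos_ne_zero hi

theorem withDensity_lebMix_ne_zero {g : MixSpace n → ℝ≥0∞} (hg : Measurable g)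
    (h : ∀ V, g V ≠ 0) : (lebMix n).withDensity g ≠ 0 := by
  intro h0
  rw [withDensity_eq_zero_iff hg.aemeasurable] at h0
  have : ∀ᵐ x ∂lebMix n, False := h0.mono fun x hx => h x hx
  rw [eventually_false_iff_eq_bot, ae_eq_bot] at this
  exact lebMix_ne_zero this

theorem lintegral_marginalDensity_ne_zero (hσ : 0 < S.σ) (hσε : 0 < S.σε)
    (hp : GIGProper S.p S.a S.b) : ∫⁻ V, S.marginalDensity V ∂lebMix n ≠ 0 := by
  intro h
  refine withDensity_lebMix_ne_zero measurable_marginalDensity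
    (marginalDensity_ne_zero hσ hσε hp) ?_
  rw [withDensity_eq_zero_iff measurable_marginalDensity.aemeasurable]
  rwa [lintegral_eq_zero_iff measurable_marginalDensity] at h

theorem posterior_eq : S.posterior
    = (∫⁻ V, S.marginalDensity V ∂lebMix n)⁻¹ • (lebMix n).withDensity S.marginalDensity := by
  rw [← withDensity_smul _ measurable_marginalDensity, posterior]
  congr 1
  ext V
  rw [Pi.smul_apply, smul_eq_mul, mul_comm, ← div_eq_mul_inv]

theorem isProbabilityMeasure_posterior (hσ : 0 < S.σ) (hσε : 0 < S.σε)
    (hp : GIGProper S.p S.a S.b) : IsProbabilityMeasure S.posterior := by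
  refine ⟨?_⟩
  rw [posterior_eq, Measure.smul_apply, withDensity_apply _ MeasurableSet.univ,
    Measure.restrict_univ, smul_eq_mul]
  exact ENNReal.inv_mul_cancel (lintegral_marginalDensity_ne_zero hσ hσε hp)
    (lintegral_marginalDensity_ne_top hσ hp)

end LLnGM

/-! ### Conjugacy, invariance and a one-dimensional criterion for ergodicity -/

namespace LLnGM

open Filter

variable {n m q : ℕ} {S : LLnGM n m q}

/-- The parameter `p` of the second Gibbs update. -/
def postP (S : LLnGM n m q) : ℝ := S.p - 1 / 2

/-- The parameter `a` of the second Gibbs update. -/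
def postA (S : LLnGM n m q) : ℝ := S.a + (S.μ / S.σ) ^ 2

/-- The parameter `b` of the second Gibbs update. -/
def postB (S : LLnGM n m q) (y : ℝ) : ℝ := S.b + (y / S.σ) ^ 2

theorem postB_pos (hσ : 0 < S.σ) (hp : GIGProper S.p S.a S.b) {y : ℝ} (hy : y ≠ 0) :
    0 < S.postB y := by
  have := hp.b_nonneg
  unfold postB
  positivity

/-- When `b = 0` the update may fail to be a probability law at `y = 0`; this affects only a
Lebesgue null set of `M`. -/
theorem postProper (hσ : 0 < S.σ) (hp : GIGProper S.p S.a S.b) {y : ℝ} (hy : y ≠ 0) :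
    GIGProper S.postP S.postA (S.postB y) := by
  have ha := hp.a_nonneg
  refine ⟨by unfold postA; positivity, (postB_pos hσ hp hy).le, ?_, Or.inl (postB_pos hσ hp hy)⟩
  rcases hp.at_top with h | h
  · left; unfold postA; positivity
  · right; unfold postP; linarith

/-- One-dimensional conjugacy. Expanding the square, `y²/(σ² v)` joins `b/v`, `μ² v/σ²` joins `a v`,
the cross term is free of `v`, and the Gaussian normaliser `v^(-1/2)` lowers `p` by one half. -/
theorem gigFun_mul_gaussian (hσ : 0 < S.σ) (y : ℝ) {v : ℝ} (hv : 0 < v) :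
    gigFun S.p S.a S.b v * (√((S.σ ^ 2 * v)⁻¹ / (2 * Real.pi))
      * Real.exp (-(1 / 2) * ((S.σ ^ 2 * v)⁻¹ * (y - S.μ * v) ^ 2)))
      = √((S.σ ^ 2)⁻¹ / (2 * Real.pi)) * Real.exp (S.μ * y / S.σ ^ 2)
        * gigFun S.postP S.postA (S.postB y) v := by
  have e1 : √((S.σ ^ 2 * v)⁻¹ / (2 * Real.pi))
      = √((S.σ ^ 2)⁻¹ / (2 * Real.pi)) * v ^ (-(1 / 2) : ℝ) := by
    rw [mul_inv, mul_div_right_comm, Real.sqrt_mul (by positivity), Real.sqrt_eq_rpow v⁻¹,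
      Real.inv_rpow hv.le, ← Real.rpow_neg hv.le]
  have e2 : v ^ (S.postP - 1) = v ^ (S.p - 1) * v ^ (-(1 / 2) : ℝ) := by
    rw [← Real.rpow_add hv, postP]; ring_nf
  have e3 : Real.exp (S.μ * y / S.σ ^ 2) * Real.exp (-(1 / 2) * (S.postA * v + S.postB y / v))
      = Real.exp (-(1 / 2) * (S.a * v + S.b / v))
        * Real.exp (-(1 / 2) * ((S.σ ^ 2 * v)⁻¹ * (y - S.μ * v) ^ 2)) := by
    rw [← Real.exp_add, ← Real.exp_add, postA, postB]
    congr 1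
    field_simp
    ring
  unfold gigFun
  rw [e1, e2]
  calc _ = √((S.σ ^ 2)⁻¹ / (2 * Real.pi)) * (v ^ (S.p - 1) * v ^ (-(1 / 2) : ℝ)) *
        (Real.exp (-(1 / 2) * (S.a * v + S.b / v))
        * Real.exp (-(1 / 2) * ((S.σ ^ 2 * v)⁻¹ * (y - S.μ * v) ^ 2))) := by ring
    _ = _ := by rw [← e3]; ring

theorem latentDensity_eq_prod (V : MixSpace n) (M : Fin n → ℝ) :
    S.latentDensity V M = ∏ i, (√((S.σ ^ 2 * V.toVec i)⁻¹ / (2 * Real.pi))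
      * Real.exp (-(1 / 2) * ((S.σ ^ 2 * V.toVec i)⁻¹ * (M i - S.μ * V.toVec i) ^ 2))) := by
  rw [Finset.prod_mul_distrib, ← Real.sqrt_prod _ fun i _ => ?_, ← Real.exp_sum,
    Finset.prod_div_distrib, Finset.prod_const, latentDensity, gaussianDensity, det_diagonal]
  · congr 2
    rw [← Finset.mul_sum]
    congr 1
    simp only [dotProduct, mulVec_diagonal, Pi.sub_apply, Pi.smul_apply, smul_eq_mul]
    exact Finset.sum_congr rfl fun i _ => by ring
  · have := toVec_pos V i
    positivity

theorem exists_jointDensity_eq_condV (hσ : 0 < S.σ) (hp : GIGProper S.p S.a S.b) {M : Fin n → ℝ}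
    (hM : ∀ i, M i ≠ 0) : ∃ d : ℝ≥0∞, ∀ V, S.jointDensity V M = d * S.condV M V := by
  set e : Fin n → ℝ := fun i =>
    √((S.σ ^ 2)⁻¹ / (2 * Real.pi)) * Real.exp (S.μ * M i / S.σ ^ 2) with he
  refine ⟨(∏ i, (ENNReal.ofReal (e i) * gigNorm S.postP S.postA (S.postB (M i))
    / gigNorm S.p S.a S.b)) * ENNReal.ofReal (S.likelihood M), fun V => ?_⟩
  rw [jointDensity, mul_right_comm _ _ (S.condV M V)]
  congr 1
  have hV := toVec_pos V
  rw [priorDensity, latentDensity_eq_prod, ENNReal.ofReal_prod_of_nonneg fun i _ => by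
    have := hV i; positivity]
  rw [← Finset.prod_mul_distrib, condV, ← Finset.prod_mul_distrib]
  refine Finset.prod_congr rfl fun i _ => ?_
  have h := gigFun_mul_gaussian (S := S) hσ (M i) (hV i)
  have hN := (postProper hσ hp (hM i)).gigNorm_ne_top
  have hN0 := gigNorm_ne_zero S.postP S.postA (S.postB (M i))
  have h2 : ENNReal.ofReal (gigFun S.p S.a S.b (V.toVec i))
      * ENNReal.ofReal (√((S.σ ^ 2 * V.toVec i)⁻¹ / (2 * Real.pi))
      * Real.exp (-(1 / 2) * ((S.σ ^ 2 * V.toVec i)⁻¹ * (M i - S.μ * V.toVec i) ^ 2)))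
      = ENNReal.ofReal (e i)
        * ENNReal.ofReal (gigFun S.postP S.postA (S.postB (M i)) (V.toVec i)) := by
    rw [← ENNReal.ofReal_mul (gigFun_pos _ _ _ (hV i)).le, h, ← ENNReal.ofReal_mul (by positivity)]
  change ENNReal.ofReal (gigFun S.p S.a S.b (V.toVec i)) / gigNorm S.p S.a S.b * _ = _ *
    (ENNReal.ofReal (gigFun S.postP S.postA (S.postB (M i)) (V.toVec i))
        / gigNorm S.postP S.postA (S.postB (M i)))
  generalize gigNorm S.postP S.postA (S.postB (M i)) = N' at hN hN0 ⊢
  rw [← ENNReal.mul_div_right_comm, h2]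
  simp only [div_eq_mul_inv]
  generalize ENNReal.ofReal (e i) = x
  generalize ENNReal.ofReal (gigFun S.postP _ _ _) = y
  calc x * y * (gigNorm S.p S.a S.b)⁻¹ = x * y * (gigNorm S.p S.a S.b)⁻¹ * (N' * N'⁻¹) := by
        rw [ENNReal.mul_inv_cancel hN0 hN, mul_one]
    _ = _ := by ring

/-- The law of the second Gibbs update. -/
def updateLaw (S : LLnGM n m q) (M : Fin n → ℝ) : Measure (MixSpace n) :=
  (lebMix n).withDensity (S.condV M)

theorem measurable_condV_right (M : Fin n → ℝ) : Measurable (S.condV M) :=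
  Finset.measurable_prod _ fun i _ =>
    (measurable_gigDensity_right _ _ _).comp (measurable_pi_apply i)

theorem updateLaw_eq_pi (hσ : 0 < S.σ) (hp : GIGProper S.p S.a S.b) {M : Fin n → ℝ}
    (hM : ∀ i, M i ≠ 0) :
    S.updateLaw M = Measure.pi fun i => gigLaw S.postP S.postA (S.postB (M i)) :=
  (pi_gigLaw fun i => postProper hσ hp (hM i)).symm

theorem updateLaw_univ (hσ : 0 < S.σ) (hp : GIGProper S.p S.a S.b) {M : Fin n → ℝ}
    (hM : ∀ i, M i ≠ 0) : S.updateLaw M Set.univ = 1 := by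
  have := fun i => (postProper hσ hp (hM i)).isProbabilityMeasure
  rw [updateLaw_eq_pi hσ hp hM, measure_univ]

theorem lintegral_updateLaw_eval (hσ : 0 < S.σ) (hp : GIGProper S.p S.a S.b) {M : Fin n → ℝ}
    (hM : ∀ i, M i ≠ 0) (i : Fin n) {g : Set.Ioi (0 : ℝ) → ℝ≥0∞} (hg : Measurable g) :
    ∫⁻ V, g (V i) ∂S.updateLaw M = ∫⁻ x, g x ∂gigLaw S.postP S.postA (S.postB (M i)) := by
  have := fun i => (postProper hσ hp (hM i)).isProbabilityMeasure
  rw [updateLaw_eq_pi hσ hp hM]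
  exact (measurePreserving_eval (fun i => gigLaw S.postP S.postA (S.postB (M i))) i).lintegral_comp hg

theorem ae_ne_zero : ∀ᵐ M : Fin n → ℝ, ∀ i, M i ≠ 0 :=
  ae_all_iff.2 fun i => Measure.ae_eval_ne (fun _ : Fin n => (volume : Measure ℝ)) i 0

theorem measurable_lintegral_updateLaw {g : MixSpace n → ℝ≥0∞} (hg : Measurable g) :
    Measurable fun M => ∫⁻ V, g V ∂S.updateLaw M := by
  have h : Measurable fun t : (Fin n → ℝ) × MixSpace n => S.condV t.1 t.2 * g t.2 :=
    S.measurable_condV.mul (hg.comp measurable_snd)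
  have e : ∀ M, ∫⁻ V, g V ∂S.updateLaw M = ∫⁻ V, S.condV M V * g V ∂lebMix n := fun M =>
    lintegral_withDensity_eq_lintegral_mul _ (measurable_condV_right M) hg
  simp_rw [e]
  exact h.lintegral_prod_right'

/-- The Gibbs kernel as the composition of its two updates. -/
theorem lintegral_gibbsKernel {g : MixSpace n → ℝ≥0∞} (hg : Measurable g) (V : MixSpace n) :
    ∫⁻ V', g V' ∂S.gibbsKernel V
      = ∫⁻ M, (∫⁻ V', g V' ∂S.updateLaw M) * ENNReal.ofReal (S.condM V M) := by
  have hk : Measurable (S.transitionDensity V) :=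
    S.measurable_transitionDensity.comp (f := fun V' => (V, V')) measurable_prodMk_left
  have hM := (measurable_condM_right (S := S) V).ennreal_ofReal
  have hF : Measurable fun t : MixSpace n × (Fin n → ℝ) =>
      S.condV t.2 t.1 * ENNReal.ofReal (S.condM V t.2) * g t.1 :=
    ((S.measurable_condV.comp (f := fun t : MixSpace n × (Fin n → ℝ) => (t.2, t.1))
      measurable_swap).mul (hM.comp measurable_snd)).mul (hg.comp measurable_fst)
  change ∫⁻ V', g V' ∂(lebMix n).withDensity (S.transitionDensity V) = _
  rw [lintegral_withDensity_eq_lintegral_mul _ hk hg]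
  calc ∫⁻ V', (S.transitionDensity V * g) V' ∂lebMix n
      = ∫⁻ V', (∫⁻ M, S.condV M V' * ENNReal.ofReal (S.condM V M) * g V') ∂lebMix n := by
        refine lintegral_congr fun V' => ?_
        rw [Pi.mul_apply, transitionDensity, lintegral_mul_const]
        exact (S.measurable_condV.comp (f := fun M : Fin n → ℝ => (M, V'))
          measurable_prodMk_right).mul hM
    _ = ∫⁻ M, ∫⁻ V', S.condV M V' * ENNReal.ofReal (S.condM V M) * g V' ∂lebMix n :=
        lintegral_lintegral_swap hF.aemeasurable
    _ = _ := by
        refine lintegral_congr fun M => ?_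
        rw [updateLaw, lintegral_withDensity_eq_lintegral_mul _ (measurable_condV_right M) hg,
          ← lintegral_mul_const _ ((measurable_condV_right M).mul hg)]
        refine lintegral_congr fun V' => ?_
        rw [Pi.mul_apply]
        ring

theorem isMarkovKernel_gibbsKernel (hσ : 0 < S.σ) (hσε : 0 < S.σε) (hp : GIGProper S.p S.a S.b) :
    IsMarkovKernel S.gibbsKernel := by
  refine ⟨fun V => ⟨?_⟩⟩
  have h := lintegral_gibbsKernel (S := S) (measurable_const (a := (1 : ℝ≥0∞))) V
  simp only [lintegral_const, one_mul] at h
  rw [h, ← lintegral_condM hσ hσε V]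
  refine lintegral_congr_ae (ae_ne_zero.mono fun M hM => ?_)
  simp only
  rw [updateLaw_univ hσ hp hM, one_mul]

/-- The joint density equals `marginalDensity V` times `condM` and, for almost every `M`, a function
of `M` times `condV`. Two applications of Tonelli's theorem exchange the two factorisations. -/
theorem invariant_posterior (hσ : 0 < S.σ) (hσε : 0 < S.σε) (hp : GIGProper S.p S.a S.b) :
    S.gibbsKernel.Invariant S.posterior := by
  rw [Kernel.Invariant]
  refine Measure.ext_of_lintegral _ fun g hg => ?_
  rw [Measure.lintegral_bind (Kernel.aemeasurable _) hg.aemeasurable, posterior_eq,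
    lintegral_smul_measure, lintegral_smul_measure]
  congr 1
  have hH := measurable_lintegral_updateLaw (S := S) hg
  have hJ := measurable_jointDensity (S := S)
  rw [lintegral_withDensity_eq_lintegral_mul _ measurable_marginalDensity hg.lintegral_kernel,
    lintegral_withDensity_eq_lintegral_mul _ measurable_marginalDensity hg]
  calc ∫⁻ V, (S.marginalDensity * fun V => ∫⁻ V', g V' ∂S.gibbsKernel V) V ∂lebMix n
      = ∫⁻ V, (∫⁻ M : Fin n → ℝ, (∫⁻ V', g V' ∂S.updateLaw M) * S.jointDensity V M) ∂lebMix n := by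
        refine lintegral_congr fun V => ?_
        rw [Pi.mul_apply, lintegral_gibbsKernel hg, ← lintegral_const_mul]
        · refine lintegral_congr fun M => ?_
          rw [jointDensity_eq_marginal_mul hσ hσε]
          ring
        · exact hH.mul (measurable_condM_right V).ennreal_ofReal
    _ = ∫⁻ M : Fin n → ℝ, ∫⁻ V, (∫⁻ V', g V' ∂S.updateLaw M) * S.jointDensity V M ∂lebMix n :=
        lintegral_lintegral_swap ((hH.comp measurable_snd).mul hJ).aemeasurable
    _ = ∫⁻ M : Fin n → ℝ, ∫⁻ V, S.jointDensity V M * g V ∂lebMix n := by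
        refine lintegral_congr_ae (ae_ne_zero.mono fun M hM => ?_)
        obtain ⟨d, hd⟩ := exists_jointDensity_eq_condV hσ hp hM
        have h1 := updateLaw_univ hσ hp hM
        rw [updateLaw, withDensity_apply _ MeasurableSet.univ, Measure.restrict_univ] at h1
        have hc := measurable_condV_right (S := S) M
        simp only [hd, mul_assoc]
        have e := lintegral_withDensity_eq_lintegral_mul (lebMix n) hc hg
        rw [lintegral_const_mul _ (hc.const_mul d), lintegral_const_mul _ hc, h1, updateLaw, e,
          lintegral_const_mul _ (f := fun V => S.condV M V * g V) (hc.mul hg), mul_one, mul_comm]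
        rfl
    _ = ∫⁻ V, (∫⁻ M : Fin n → ℝ, S.jointDensity V M * g V) ∂lebMix n :=
        (lintegral_lintegral_swap (hJ.mul (hg.comp measurable_fst)).aemeasurable).symm
    _ = _ := by
        refine lintegral_congr fun V => ?_
        rw [Pi.mul_apply, marginalDensity, lintegral_mul_const]
        exact hJ.comp (f := fun M : Fin n → ℝ => (V, M)) measurable_prodMk_left

/-- The mean of the first Gibbs update. -/
def condMean (S : LLnGM n m q) (V : MixSpace n) : Fin n → ℝ := (S.Qbar V)⁻¹ *ᵥ S.mbar

/-- The coordinate variances of the first Gibbs update. -/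
def condVar (S : LLnGM n m q) (V : MixSpace n) (i : Fin n) : ℝ := S.σ ^ 2 * (S.Qbar V)⁻¹ i i

theorem lintegral_condM_eval (hσ : 0 < S.σ) (hσε : 0 < S.σε) (V : MixSpace n) (i : Fin n)
    {f : ℝ → ℝ≥0∞} (hf : Measurable f) :
    ∫⁻ M, f (M i) * ENNReal.ofReal (S.condM V M)
      = ∫⁻ y, f y ∂gaussianReal (S.condMean V i) (S.condVar V i).toNNReal := by
  rw [condVar, ← condPrecision_inv hσ hσε]
  exact lintegral_gaussianDensity_eval (condPrecision_posDef hσ hσε V) _ i hf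

/-- Kernel and normaliser both decrease in `b`; taking the numerator at `bmax` and the denominator
at `bmin` gives a minorant uniform over the interval. -/
theorem gigDensity_ge {p a b bmin bmax : ℝ} (h1 : bmin ≤ b) (h2 : b ≤ bmax)
    (x : Set.Ioi (0 : ℝ)) : gigKernel p a bmax x / gigNorm p a bmin ≤ gigDensity p a b x :=
  ENNReal.div_le_div (ENNReal.ofReal_le_ofReal (gigFun_anti x.2 le_rfl h2)) (gigNorm_anti le_rfl h1)

/-- Geometric ergodicity from coordinatewise bounds on the two Gibbs updates. -/
theorem isGeometricallyErgodic_of_bounds (hσ : 0 < S.σ) (hσε : 0 < S.σε)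
    (hp : GIGProper S.p S.a S.b) {w : ℝ → ℝ} {f : ℝ → ℝ≥0∞} {lam C : ℝ} (hw : Measurable w)
    (hw0 : ∀ x, 0 < x → 0 ≤ w x) (hf : Measurable f) (hl : 0 ≤ lam) (hl1 : lam < 1) (hC : 0 ≤ C)
    (hup : ∀ y, y ≠ 0 → ∫⁻ x, ENNReal.ofReal (w x) ∂gigLaw S.postP S.postA (S.postB y) ≤ f y)
    (hdrift : ∀ V : MixSpace n,
      ∑ i, ∫⁻ y, f y ∂gaussianReal (S.condMean V i) (S.condVar V i).toNNReal
        ≤ ENNReal.ofReal (lam * ∑ i, w (V i) + C))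
    (hlevel : ∀ L : ℝ, ∃ bmin bmax, GIGProper S.postP S.postA bmin ∧
      ∀ y, y ≠ 0 → f y ≤ ENNReal.ofReal L → bmin ≤ S.postB y ∧ S.postB y ≤ bmax) :
    IsGeometricallyErgodic S.gibbsKernel S.posterior := by
  have := isMarkovKernel_gibbsKernel hσ hσε hp
  have := isProbabilityMeasure_posterior hσ hσε hp
  set W : MixSpace n → ℝ := fun V => ∑ i, w (V i) with hW
  have hWm : Measurable W := by
    refine Finset.measurable_sum _ fun i _ => hw.comp ?_
    exact measurable_subtype_coe.comp (measurable_pi_apply i)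
  have hW0 : ∀ V, 0 ≤ W V := fun V => Finset.sum_nonneg fun i _ => hw0 _ (V i).2
  set F : (Fin n → ℝ) → ℝ≥0∞ := fun M => ∑ i, f (M i) with hF
  have hFm : Measurable F :=
    Finset.measurable_sum _ fun i _ => hf.comp (measurable_pi_apply i)
  have hFV : ∀ V, ∫⁻ M, F M * ENNReal.ofReal (S.condM V M) ≤ ENNReal.ofReal (lam * W V + C) := by
    intro V
    refine le_trans (le_of_eq ?_) (hdrift V)
    simp only [hF, Finset.sum_mul]
    rw [lintegral_finsetSum]
    · exact Finset.sum_congr rfl fun i _ => lintegral_condM_eval hσ hσε V i hf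
    · exact fun i _ => (hf.comp (measurable_pi_apply i)).mul (measurable_condM_right V).ennreal_ofReal
  have hWF : ∀ M : Fin n → ℝ, (∀ i, M i ≠ 0) →
      ∫⁻ V, ENNReal.ofReal (W V) ∂S.updateLaw M ≤ F M := by
    intro M hM
    have hwi : Measurable fun x : Set.Ioi (0 : ℝ) => ENNReal.ofReal (w x) :=
      (hw.comp measurable_subtype_coe).ennreal_ofReal
    change ∫⁻ V : MixSpace n, ENNReal.ofReal (∑ i, w (V i)) ∂S.updateLaw M ≤ _
    have e : ∀ V : MixSpace n, ENNReal.ofReal (∑ i, w (V i)) = ∑ i, ENNReal.ofReal (w (V i)) :=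
      fun V => ENNReal.ofReal_sum_of_nonneg fun i _ => hw0 _ (V i).2
    rw [lintegral_congr e, lintegral_finsetSum _ fun i _ =>
      show Measurable fun V : MixSpace n => ENNReal.ofReal (w (V i)) from
        hwi.comp (measurable_pi_apply i)]
    refine Finset.sum_le_sum fun i _ => ?_
    rw [lintegral_updateLaw_eval hσ hp hM i hwi]
    exact hup _ (hM i)
  refine isGeometricallyErgodic_of_drift_of_minorization (invariant_posterior hσ hσε hp)
    (W := W) (lam := lam) (C := C) (fun V => ?_) hWm hW0 hl hl1 hC fun R => ?_
  · rw [lintegral_gibbsKernel hWm.ennreal_ofReal]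
    refine (lintegral_mono_ae (ae_ne_zero.mono fun M hM => ?_)).trans (hFV V)
    exact mul_le_mul_left (hWF M hM) _
  -- On `W ≤ R` the conditional mean of `F(M)` is at most `T`, so by Markov's inequality `F(M) < 2
  -- T` with probability at least one half. This is the origin of the factor `2⁻¹` in `η`; the
  -- summand `1` makes `T` positive.
  · set T := lam * max R 0 + C + 1 with hT
    have hT0 : 0 < T := by have := le_max_right R 0; positivity
    obtain ⟨bmin, bmax, hpr, hb⟩ := hlevel (2 * T)
    set η : MixSpace n → ℝ≥0∞ := fun V => 2⁻¹ *
      ∏ i, (gigKernel S.postP S.postA bmax (V i) / gigNorm S.postP S.postA bmin) with hη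
    have hηm : Measurable η := by
      refine measurable_const.mul (Finset.measurable_prod _ fun i _ => ?_)
      exact ((measurable_gigKernel_right _ _ _).comp (measurable_pi_apply i)).div_const _
    refine ⟨(lebMix n).withDensity η, withDensity_lebMix_ne_zero hηm fun V => ?_, fun V hV => ?_⟩
    · refine mul_ne_zero (by simp) (Finset.prod_ne_zero_iff.2 fun i _ => ?_)
      exact (ENNReal.div_pos (gigKernel_pos _ _ _ _).ne' hpr.gigNorm_ne_top).ne'
    · refine Measure.le_iff.2 fun s hs => ?_
      set E : Set (Fin n → ℝ) := {M | F M < ENNReal.ofReal (2 * T)} with hE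
      have hEm : MeasurableSet E := measurableSet_lt hFm measurable_const
      have hcm := (measurable_condM_right (S := S) V).ennreal_ofReal
      have hhalf : 2⁻¹ ≤ ∫⁻ M in E, ENNReal.ofReal (S.condM V M) := by
        set γ := (volume : Measure (Fin n → ℝ)).withDensity fun M => ENNReal.ofReal (S.condM V M)
        have hγ1 : γ Set.univ = 1 := by
          rw [withDensity_apply _ MeasurableSet.univ, Measure.restrict_univ, lintegral_condM hσ hσε]
        have hγ : IsProbabilityMeasure γ := ⟨hγ1⟩
        have hmk : ENNReal.ofReal (2 * T) * γ Eᶜ ≤ ENNReal.ofReal T := by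
          have h1 := mul_meas_ge_le_lintegral (μ := γ) hFm (ENNReal.ofReal (2 * T))
          have h2 : Eᶜ = {M | ENNReal.ofReal (2 * T) ≤ F M} := by ext; simp [hE]
          rw [h2]
          refine h1.trans ?_
          rw [lintegral_withDensity_eq_lintegral_mul _ hcm hFm]
          simp only [Pi.mul_apply, mul_comm (ENNReal.ofReal (S.condM V _))]
          refine (hFV V).trans (ENNReal.ofReal_le_ofReal ?_)
          have : lam * W V ≤ lam * max R 0 :=
            mul_le_mul_of_nonneg_left (hV.trans (le_max_left _ _)) hl
          rw [hT]; linarith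
        have hEc : γ Eᶜ ≤ 2⁻¹ := by
          have h2T : ENNReal.ofReal (2 * T) ≠ 0 := by simpa using hT0
          refine (ENNReal.mul_le_mul_iff_right h2T ENNReal.ofReal_ne_top).1 (hmk.trans_eq ?_)
          rw [ENNReal.ofReal_mul (by norm_num), mul_right_comm, ENNReal.ofReal_ofNat,
            ENNReal.mul_inv_cancel (by norm_num) (by norm_num), one_mul]
        have hadd := measure_add_measure_compl (μ := γ) hEm
        rw [hγ1] at hadd
        rw [← withDensity_apply _ hEm]
        change 2⁻¹ ≤ γ E
        by_contra! hlt
        have : γ E + γ Eᶜ < 2⁻¹ + 2⁻¹ := ENNReal.add_lt_add_of_lt_of_le (measure_ne_top _ _) hlt hEc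
        rw [hadd, ENNReal.inv_two_add_inv_two] at this
        exact this.false
      -- On this event every `f (M i)` is below `2 T`, so each coordinate density of the second
      -- update has the uniform minorant.
      have hlow : ∀ M ∈ E, (∀ i, M i ≠ 0) → 2 * (lebMix n).withDensity η s ≤ S.updateLaw M s := by
        intro M hME hM
        rw [updateLaw, withDensity_apply _ hs, withDensity_apply _ hs,
          ← lintegral_const_mul _ hηm]
        refine lintegral_mono fun V' => ?_
        simp only [hη]
        rw [← mul_assoc, ENNReal.mul_inv_cancel (by norm_num) (by norm_num), one_mul]
        refine Finset.prod_le_prod' fun i _ => ?_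
        have hfi : f (M i) ≤ ENNReal.ofReal (2 * T) :=
          (Finset.single_le_sum (f := fun i => f (M i)) (fun _ _ => zero_le) (Finset.mem_univ i)).trans
            (le_of_lt hME)
        obtain ⟨h1, h2⟩ := hb _ (hM i) hfi
        exact gigDensity_ge h1 h2 _
      have hind := lintegral_gibbsKernel (S := S) (measurable_const.indicator hs (f := fun _ => (1 : ℝ≥0∞))) V
      simp only [lintegral_indicator hs, setLIntegral_one] at hind
      rw [hind]
      calc (lebMix n).withDensity η s
          = (2 * (lebMix n).withDensity η s) * 2⁻¹ := by
            rw [mul_right_comm, ENNReal.mul_inv_cancel (by norm_num) (by norm_num), one_mul]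
        _ ≤ (2 * (lebMix n).withDensity η s) * ∫⁻ M in E, ENNReal.ofReal (S.condM V M) := by gcongr
        _ = ∫⁻ M in E, (2 * (lebMix n).withDensity η s) * ENNReal.ofReal (S.condM V M) := by
            rw [lintegral_const_mul _ hcm]
        _ ≤ ∫⁻ M in E, S.updateLaw M s * ENNReal.ofReal (S.condM V M) := by
            refine lintegral_mono_ae ?_
            filter_upwards [ae_restrict_mem hEm, ae_restrict_of_ae ae_ne_zero] with M h1 h2
            exact mul_le_mul_left (hlow M h1 h2) _
        _ ≤ _ := setLIntegral_le_lintegral _ _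

end LLnGM

/-! ### Drift in the parameter regimes -/

theorem sum_le_ofReal_of_forall_le {ι : Type*} [Fintype ι] {F : ι → ℝ≥0∞} {g : ι → ℝ} {R : ℝ}
    (h : ∀ i, F i ≤ ENNReal.ofReal (g i)) (hg : ∀ i, 0 ≤ g i) (hR : ∑ i, g i ≤ R) :
    ∑ i, F i ≤ ENNReal.ofReal R := by
  refine (Finset.sum_le_sum fun i _ => h i).trans ?_
  rw [← ENNReal.ofReal_sum_of_nonneg fun i _ => hg i]
  exact ENNReal.ofReal_le_ofReal hR

theorem lintegral_const_add_abs_rpow_gaussianReal_le {q c₀ c₁ : ℝ} (hq0 : 0 < q) (hq : q ≤ 1)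
    (hc₀ : 0 ≤ c₀) (hc₁ : 0 ≤ c₁) (m : ℝ) {v : ℝ} (hv : 0 ≤ v) :
    ∫⁻ y, (ENNReal.ofReal c₀ + ENNReal.ofReal c₁ * ENNReal.ofReal |y| ^ q)
        ∂gaussianReal m v.toNNReal
      ≤ ENNReal.ofReal (c₀ + c₁ * (|m| ^ q + gaussAbsMoment q * v ^ (q / 2))) := by
  have hg := (gaussAbsMoment_pos (q := q) (by linarith)).le
  rw [lintegral_add_left measurable_const, lintegral_const, measure_univ, mul_one,
    lintegral_const_mul _ (by fun_prop), ENNReal.ofReal_add hc₀ (by positivity),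
    ENNReal.ofReal_mul hc₁]
  gcongr
  exact lintegral_abs_rpow_gaussianReal_le hq0 hq m hv

theorem ofReal_mul_abs_rpow {c q y : ℝ} (hc : 0 ≤ c) (hy : y ≠ 0) :
    ENNReal.ofReal c * ENNReal.ofReal |y| ^ q = ENNReal.ofReal (c * |y| ^ q) := by
  rw [ENNReal.ofReal_rpow_of_pos (abs_pos.2 hy), ENNReal.ofReal_mul hc]

theorem mul_abs_rpow_le_of_le {c q y L : ℝ} {T : ℝ≥0∞} (hc : 0 ≤ c) (hy : y ≠ 0)
    (h : ENNReal.ofReal c * ENNReal.ofReal |y| ^ q ≤ T) (hT : T ≤ ENNReal.ofReal L) :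
    c * |y| ^ q ≤ |L| := by
  rw [ofReal_mul_abs_rpow hc hy] at h
  have := (h.trans hT).trans (ENNReal.ofReal_le_ofReal (le_abs_self L))
  rwa [ENNReal.ofReal_le_ofReal_iff (abs_nonneg L)] at this

theorem abs_le_of_mul_rpow_le {c q y L : ℝ} (hc : 0 < c) (hq : 0 < q) (h : c * |y| ^ q ≤ L) :
    |y| ≤ (L / c) ^ q⁻¹ := by
  have h0 : |y| ^ q ≤ L / c := by rw [le_div_iff₀ hc]; linarith
  have h1 : 0 ≤ |y| ^ q := by positivity
  exact (Real.le_rpow_inv_iff_of_pos (abs_nonneg y) (h1.trans h0) hq).2 h0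

theorem exists_pos_le_abs_of_mul_rpow_neg_le {c q L : ℝ} (hc : 0 < c) (hq : q < 0) (hL : 0 ≤ L) :
    ∃ δ, 0 < δ ∧ ∀ y, y ≠ 0 → c * |y| ^ q ≤ L → δ ≤ |y| := by
  refine ⟨((L + 1) / c) ^ q⁻¹, by positivity, fun y hy h => ?_⟩
  have hy' := abs_pos.2 hy
  have h0 : |y| ^ q ≤ (L + 1) / c := by rw [le_div_iff₀ hc]; linarith
  exact (Real.rpow_inv_le_iff_of_neg (by positivity) hy' hq).2 h0

theorem sqrt_le_mul_add {ε x : ℝ} (hε : 0 < ε) (hx : 0 ≤ x) : √x ≤ ε * x + (4 * ε)⁻¹ := by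
  have h := Real.sq_sqrt hx
  have h2 : ε * √x ^ 2 + (4 * ε)⁻¹ - √x = (2 * ε * √x - 1) ^ 2 / (4 * ε) := by
    field_simp
    ring
  have h3 : 0 ≤ (2 * ε * √x - 1) ^ 2 / (4 * ε) := by positivity
  rw [h] at h2
  linarith

theorem le_mul_sq_add {ε : ℝ} (hε : 0 < ε) (x : ℝ) : x ≤ ε * x ^ 2 + (4 * ε)⁻¹ := by
  have h2 : ε * x ^ 2 + (4 * ε)⁻¹ - x = (2 * ε * x - 1) ^ 2 / (4 * ε) := by
    field_simp
    ring
  have h3 : 0 ≤ (2 * ε * x - 1) ^ 2 / (4 * ε) := by positivity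
  linarith

/-! ### Conditional mean and variance bounds, and the choice of drift function. -/

namespace LLnGM

variable {n m q : ℕ} {S : LLnGM n m q}

/-- Up to the term `μ v`, the vector `mbar` is `ρ Bᵀ y + μ u`, which is orthogonal to `Null(B)`;
`exists_ridge_inv_bound` applies to it. Only the `v` component can make the conditional mean grow
with `V`. -/
theorem exists_condMean_sub_bound (hσ : 0 < S.σ) (hσε : 0 < S.σε) {v u : Fin n → ℝ}
    (hvu : v + u = 1) (hu : ∀ w, S.B *ᵥ w = 0 → w ⬝ᵥ u = 0) :
    ∃ C, 0 ≤ C ∧ ∀ V i, |S.condMean V i - S.μ * ((ridge S.ρ S.B V.toVec)⁻¹ *ᵥ v) i| ≤ C := by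
  set y := S.Y - S.X *ᵥ S.β + S.μ • (S.B *ᵥ S.h) with hy
  obtain ⟨C, hC, h⟩ := exists_ridge_inv_bound (ρ_pos hσ hσε) S.B
    (S.ρ • (S.Bᵀ *ᵥ y) + S.μ • u) fun w hw => by
      rw [dotProduct_add, dotProduct_smul, dotProduct_smul, hu w hw, dotProduct_mulVec,
        vecMul_transpose, hw, zero_dotProduct, smul_zero, smul_zero, add_zero]
  refine ⟨C, hC, fun V i => ?_⟩
  have e : S.mbar = (S.ρ • (S.Bᵀ *ᵥ y) + S.μ • u) + S.μ • v := by
    rw [mbar, ← hy, ← hvu, smul_add]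
    abel
  have := h V.toVec (toVec_pos V) i
  rwa [condMean, Qbar_eq_ridge, e, mulVec_add, mulVec_smul _ S.μ, Pi.add_apply, Pi.smul_apply,
    smul_eq_mul, add_sub_cancel_right]

theorem exists_abs_condMean_le (hσ : 0 < S.σ) (hσε : 0 < S.σε) :
    ∃ C, 0 ≤ C ∧ ∀ V i, |S.condMean V i|
      ≤ C + |S.μ| * |((ridge S.ρ S.B V.toVec)⁻¹ *ᵥ (1 : Fin n → ℝ)) i| := by
  obtain ⟨C, hC, h⟩ := exists_condMean_sub_bound hσ hσε (v := 1) (u := 0) (add_zero _)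
    fun w _ => dotProduct_zero w
  refine ⟨C, hC, fun V i => ?_⟩
  have := abs_sub_abs_le_abs_sub (S.condMean V i)
    (S.μ * ((ridge S.ρ S.B V.toVec)⁻¹ *ᵥ (1 : Fin n → ℝ)) i)
  rw [abs_mul] at this
  linarith [h V i]

theorem condVar_pos (hσ : 0 < S.σ) (hσε : 0 < S.σε) (V : MixSpace n) (i : Fin n) :
    0 < S.condVar V i :=
  mul_pos (by positivity) (ridge_inv_diag_pos (ρ_pos hσ hσε).le (toVec_pos V) i)

theorem condVar_le (hσ : 0 < S.σ) (hσε : 0 < S.σε) (V : MixSpace n) (i : Fin n) :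
    S.condVar V i ≤ S.σ ^ 2 * V i :=
  mul_le_mul_of_nonneg_left (ridge_inv_diag_le (ρ_pos hσ hσε).le (toVec_pos V) i) (by positivity)

theorem postB_le_of_abs_le (hσ : 0 < S.σ) {y R : ℝ} (h : |y| ≤ R) :
    S.postB y ≤ S.b + (R / S.σ) ^ 2 := by
  have h1 : y ^ 2 ≤ R ^ 2 := sq_le_sq' (by linarith [neg_abs_le y]) ((le_abs_self y).trans h)
  rw [postB, div_pow, div_pow]
  gcongr

theorem le_postB (y : ℝ) : S.b ≤ S.postB y := le_add_of_nonneg_right (sq_nonneg _)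

theorem postA_pos_of_pos (ha : 0 < S.a) : 0 < S.postA := by unfold postA; positivity

/-- Linear growth of the mean of the second Gibbs update. -/
theorem gigMean_post_le (hσ : 0 < S.σ) (hb : 0 ≤ S.b) (ha : 0 < S.postA) {y : ℝ}
    (hy : 0 < S.postB y) :
    gigMean S.postP S.postA (S.postB y)
      ≤ (√(S.b / S.postA) + gigMeanConst S.postP S.postA) + (S.σ * √S.postA)⁻¹ * |y| := by
  have h := gigMean_le S.postP ha hy
  have h1 : √(S.postB y / S.postA) ≤ √(S.b / S.postA) + (S.σ * √S.postA)⁻¹ * |y| := by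
    have e : S.postB y / S.postA = S.b / S.postA + ((S.σ * √S.postA)⁻¹ * |y|) ^ 2 := by
      rw [postB, add_div, mul_pow, inv_pow, mul_pow, Real.sq_sqrt ha.le, sq_abs]
      congr 1
      field_simp
    have h0 : 0 ≤ (S.σ * √S.postA)⁻¹ * |y| := by positivity
    rw [e]
    refine Real.sqrt_le_iff.2 ⟨by positivity, ?_⟩
    have := Real.sq_sqrt (show 0 ≤ S.b / S.postA by positivity)
    nlinarith [mul_nonneg (Real.sqrt_nonneg (S.b / S.postA)) h0]
  linarith

theorem lintegral_gigLaw_id (p : ℝ) {a b : ℝ} (ha : 0 < a) (hb : 0 < b) :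
    ∫⁻ x, ENNReal.ofReal (x : ℝ) ∂gigLaw p a b = ENNReal.ofReal (gigMean p a b) := by
  rw [gigMean, ← lintegral_rpow_gigLaw_of_proper (GIGProper.of_pos p ha hb)
    (GIGProper.of_pos (p + 1) ha hb)]
  simp only [Real.rpow_one]

/-- Contraction of the first absolute moments along the first Gibbs update when `a > 0`. -/
theorem exists_sum_abs_moment_le (hσ : 0 < S.σ) (hσε : 0 < S.σε) (ha : 0 < S.a) {c₀ : ℝ} :
    ∃ lam C : ℝ, 0 ≤ lam ∧ lam < 1 ∧ 0 ≤ C ∧ ∀ V : MixSpace n,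
      ∑ i, (c₀ + (S.σ * √S.postA)⁻¹ * (|S.condMean V i| ^ (1 : ℝ)
        + gaussAbsMoment 1 * S.condVar V i ^ ((1 : ℝ) / 2))) ≤ lam * ∑ i, (V i : ℝ) + C := by
  obtain ⟨D, hD, hm⟩ := exists_abs_condMean_le (S := S) hσ hσε
  have hA := postA_pos_of_pos ha
  have hg := gaussAbsMoment_pos (q := 1) (by norm_num)
  set g := gaussAbsMoment 1
  set c₁ := (S.σ * √S.postA)⁻¹ with hc₁
  have hc₁0 : 0 < c₁ := by positivity
  -- The product is `|μ| / √(σ² a + μ²)`, strictly below one because `a > 0`.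
  have hκ : c₁ * |S.μ| < 1 := by
    rw [hc₁, inv_mul_lt_one₀ (by positivity)]
    refine abs_lt_of_sq_lt_sq ?_ (by positivity)
    rw [mul_pow, Real.sq_sqrt hA.le, postA, mul_add, div_pow, mul_div_cancel₀ _ (by positivity)]
    have : 0 < S.σ ^ 2 * S.a := by positivity
    linarith
  set κ := c₁ * |S.μ| with hκd
  have hκ0 : 0 ≤ κ := by positivity
  -- The standard deviation grows only like `√(V i)`; this `ε` makes its linear majorant use half of
  -- the gap `1 - κ`.
  set ε := (1 - κ) / (2 * (c₁ * g * S.σ)) with hε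
  have hε0 : 0 < ε := div_pos (by linarith) (by positivity)
  have hεe : c₁ * g * S.σ * ε = (1 - κ) / 2 := by rw [hε]; field_simp
  set E := |c₀| + c₁ * D + c₁ * g * S.σ * (4 * ε)⁻¹ with hE
  refine ⟨κ + (1 - κ) / 2, n * E, by linarith, by linarith, by positivity, fun V => ?_⟩
  have hV := toVec_pos V
  have hone := sum_abs_ridge_inv_one_le (B := S.B) (ρ_pos hσ hσε).le hV
  set x := (ridge S.ρ S.B V.toVec)⁻¹ *ᵥ (1 : Fin n → ℝ)
  have hi : ∀ i, c₀ + c₁ * (|S.condMean V i| ^ (1 : ℝ) + g * S.condVar V i ^ ((1 : ℝ) / 2))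
      ≤ κ * |x i| + (1 - κ) / 2 * V i + E := by
    intro i
    have hVi : (0 : ℝ) < V i := (V i).2
    have h1 : S.condVar V i ^ ((1 : ℝ) / 2) ≤ S.σ * (ε * V i + (4 * ε)⁻¹) := by
      rw [← Real.sqrt_eq_rpow]
      calc √(S.condVar V i) ≤ √(S.σ ^ 2 * V i) := Real.sqrt_le_sqrt (condVar_le hσ hσε V i)
        _ = S.σ * √(V i) := by rw [Real.sqrt_mul (by positivity), Real.sqrt_sq hσ.le]
        _ ≤ _ := by gcongr; exact sqrt_le_mul_add hε0 hVi.le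
    have h2 := hm V i
    rw [Real.rpow_one]
    calc _ ≤ |c₀| + c₁ * ((D + |S.μ| * |x i|) + g * (S.σ * (ε * V i + (4 * ε)⁻¹))) := by
          gcongr; exact le_abs_self _
      _ = _ := by rw [← hεe, hE, hκd]; ring
  refine (Finset.sum_le_sum fun i _ => hi i).trans ?_
  rw [Finset.sum_add_distrib, Finset.sum_add_distrib, ← Finset.mul_sum, ← Finset.mul_sum,
    Finset.sum_const, Finset.card_univ, Fintype.card_fin, nsmul_eq_mul]
  have : κ * ∑ i, |x i| ≤ κ * ∑ i, (V i : ℝ) := mul_le_mul_of_nonneg_left hone hκ0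
  linarith

/-- Drift function `∑ V i`. The condition `hpost` makes `GIG(p - 1/2, ·, b)` proper, so `bmin = b`
is admissible and small values of `|M i|` need no separate control. -/
theorem isGeometricallyErgodic_of_a_pos (hσ : 0 < S.σ) (hσε : 0 < S.σε) (ha : 0 < S.a)
    (hp : GIGProper S.p S.a S.b) (hpost : 0 < S.b ∨ 1 / 2 < S.p) :
    IsGeometricallyErgodic S.gibbsKernel S.posterior := by
  have hA := postA_pos_of_pos ha
  have hb := hp.b_nonneg
  have hG := gigMeanConst_nonneg S.postP hA
  set c₀ := √(S.b / S.postA) + gigMeanConst S.postP S.postA with hc₀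
  set c₁ := (S.σ * √S.postA)⁻¹ with hc₁
  have hc₀0 : 0 ≤ c₀ := by positivity
  have hc₁0 : 0 < c₁ := by positivity
  obtain ⟨lam, C, hl, hl1, hC, hdr⟩ := exists_sum_abs_moment_le (c₀ := c₀) hσ hσε ha
  refine isGeometricallyErgodic_of_bounds hσ hσε hp (w := fun x => x)
    (f := fun y => ENNReal.ofReal c₀ + ENNReal.ofReal c₁ * ENNReal.ofReal |y| ^ (1 : ℝ))
    measurable_id (fun x hx => hx.le) (by fun_prop) hl hl1 hC (fun y hy => ?_) (fun V => ?_)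
    fun L => ?_
  · have hB := postB_pos hσ hp hy
    rw [lintegral_gigLaw_id _ hA hB, ofReal_mul_abs_rpow hc₁0.le hy,
      ← ENNReal.ofReal_add hc₀0 (by positivity), Real.rpow_one]
    exact ENNReal.ofReal_le_ofReal (gigMean_post_le hσ hb hA hB)
  · refine sum_le_ofReal_of_forall_le (fun i => lintegral_const_add_abs_rpow_gaussianReal_le
      one_pos le_rfl hc₀0 hc₁0.le _ (condVar_pos hσ hσε V i).le) (fun i => ?_) (hdr V)
    have := (gaussAbsMoment_pos (q := 1) (by norm_num)).le
    have := (condVar_pos hσ hσε V i).le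
    positivity
  · refine ⟨S.b, _, ⟨hA.le, hb, Or.inl hA, ?_⟩, fun y hy h => ⟨le_postB y,
      postB_le_of_abs_le hσ (abs_le_of_mul_rpow_le hc₁0 one_pos
        (mul_abs_rpow_le_of_le hc₁0.le hy le_add_self h))⟩⟩
    exact hpost.imp_right fun h => by unfold postP; linarith

/-- The constant in the negative moment bound beats the Gaussian negative moment. -/
theorem exists_between_neg_moments {p : ℝ} (hp : 0 < p) (hp2 : p ≤ 1 / 2) :
    ∃ L : ℝ, 0 < L ∧ (p - 1 / 2 < 0 → L < gigNormReal (p - 1 / 2) 0 1) ∧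
      gigNormReal (p - 1 / 2 + -(p / 2)) 0 1 * gaussAbsMoment (-p) < L := by
  have hN : 0 < gigNormReal (p - 1 / 2 + -(p / 2)) 0 1 :=
    (GIGProper.invGamma (by linarith) one_pos).gigNormReal_pos
  have hg := gaussAbsMoment_pos (q := -p) (by linarith)
  have hpos := mul_pos hN hg
  rcases hp2.lt_or_eq with h | h
  · have key : gigNormReal (p - 1 / 2 + -(p / 2)) 0 1 * gaussAbsMoment (-p)
        < gigNormReal (p - 1 / 2) 0 1 := by
      -- After the powers of `2` cancel, the claim is `Γ(1/2 - p/2)² < Γ(1/2 - p) Γ(1/2)`.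
      have hΓ := Gamma_mul_Gamma_lt (α := 1 / 2 - p) (s := p / 2) (t := p / 2)
        (by linarith) (by linarith) (by linarith)
      rw [show 1 / 2 - p + p / 2 + p / 2 = 1 / 2 by ring, Real.Gamma_one_half_eq] at hΓ
      rw [gigNormReal_invGamma (by linarith) one_pos, gigNormReal_invGamma (by linarith) one_pos,
        gaussAbsMoment, div_one, show -(p - 1 / 2 + -(p / 2)) = (1 / 2 - p) + p / 2 by ring,
        show -(p - 1 / 2) = 1 / 2 - p by ring, show (-p + 1) / 2 = 1 / 2 - p + p / 2 by ring,
        Real.rpow_add two_pos, show -p / 2 = -(p / 2) by ring, Real.rpow_neg two_pos.le]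
      have hπ : 0 < √Real.pi := Real.sqrt_pos.2 Real.pi_pos
      have h2 : (0 : ℝ) < 2 ^ (p / 2) := by positivity
      have h3 : (0 : ℝ) < 2 ^ (1 / 2 - p) := by positivity
      calc _ = 2 ^ (1 / 2 - p) * (Real.Gamma (1 / 2 - p + p / 2)
            * Real.Gamma (1 / 2 - p + p / 2)) / √Real.pi := by field_simp
        _ < 2 ^ (1 / 2 - p) * (Real.Gamma (1 / 2 - p) * √Real.pi) / √Real.pi := by gcongr
        _ = _ := by field_simp
    obtain ⟨L, h1, h2⟩ := exists_between key
    exact ⟨L, hpos.trans h1, fun _ => h2, h1⟩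
  -- At `p = 1/2` the upper constraint on `L` is void, so any larger number works.
  · exact ⟨_, by positivity, fun h' => absurd h' (by rw [h]; norm_num), lt_add_one _⟩

/-- The variance is at least `σ² / (ρ (BᵀB)_ii + 1/V i)`, and `t ↦ t^s` is subadditive for `s ≤ 1`.
The coefficient of `(V i)^(-s)` is therefore sharp. -/
theorem exists_condVar_rpow_neg_le (hσ : 0 < S.σ) (hσε : 0 < S.σε) {s : ℝ} (hs : 0 < s)
    (hs1 : s ≤ 1) : ∃ C, 0 ≤ C ∧ ∀ V i,
      S.condVar V i ^ (-s) ≤ (S.σ ^ 2) ^ (-s) * ((V i : ℝ) ^ (-s) + C) := by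
  have hd : ∀ i, 0 ≤ S.ρ * (S.Bᵀ * S.B) i i := fun i =>
    mul_nonneg (ρ_pos hσ hσε).le ((posSemidef_conjTranspose_mul_self S.B).diag_nonneg (i := i))
  refine ⟨∑ i, (S.ρ * (S.Bᵀ * S.B) i i) ^ s,
    Finset.sum_nonneg fun i _ => Real.rpow_nonneg (hd i) s, fun V i => ?_⟩
  have hV := toVec_pos V
  have hVi : (0 : ℝ) < V i := (V i).2
  have hpos := ridge_inv_diag_pos (B := S.B) (ρ_pos hσ hσε).le hV i
  have h := le_ridge_inv_diag (B := S.B) (ρ_pos hσ hσε).le hV i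
  have hsum : 0 < S.ρ * (S.Bᵀ * S.B) i i + (V.toVec i)⁻¹ :=
    add_pos_of_nonneg_of_pos (hd i) (inv_pos.2 (hV i))
  rw [condVar, Qbar_eq_ridge, Real.mul_rpow (by positivity) hpos.le]
  gcongr
  calc _ ≤ ((S.ρ * (S.Bᵀ * S.B) i i + (V.toVec i)⁻¹)⁻¹) ^ (-s) :=
        Real.rpow_le_rpow_of_nonpos (inv_pos.2 hsum) h (by linarith)
    _ = (S.ρ * (S.Bᵀ * S.B) i i + (V.toVec i)⁻¹) ^ s := by
        rw [Real.inv_rpow hsum.le, Real.rpow_neg hsum.le, inv_inv]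
    _ ≤ (S.ρ * (S.Bᵀ * S.B) i i) ^ s + (V.toVec i)⁻¹ ^ s :=
        Real.rpow_add_le_add_rpow (hd i) (inv_pos.2 (hV i)).le hs.le hs1
    _ = (V i : ℝ) ^ (-s) + (S.ρ * (S.Bᵀ * S.B) i i) ^ s := by
        rw [Real.inv_rpow (hV i).le, ← Real.rpow_neg (hV i).le, add_comm]; rfl
    _ ≤ _ := by
        gcongr
        exact Finset.single_le_sum (f := fun i => (S.ρ * (S.Bᵀ * S.B) i i) ^ s)
          (fun j _ => Real.rpow_nonneg (hd j) s) (Finset.mem_univ i)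

/-- Drift function `∑ (V i + (V i)^(-s))` with `s = p/2`. The linear part contracts as for other `a
> 0`; the singular part contracts with factor `θ`, the product of the `GIG` and Gaussian
negative-moment constants. -/
theorem isGeometricallyErgodic_of_b_eq_zero (hσ : 0 < S.σ) (hσε : 0 < S.σε) (ha : 0 < S.a)
    (hb : S.b = 0) (hp : 0 < S.p) (hp2 : S.p ≤ 1 / 2) :
    IsGeometricallyErgodic S.gibbsKernel S.posterior := by
  have hA := postA_pos_of_pos ha
  have hpr : GIGProper S.p S.a S.b := ⟨ha.le, hb.ge, Or.inl ha, Or.inr hp⟩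
  have hG := gigMeanConst_nonneg S.postP hA
  obtain ⟨L, hL0, hL, hLN⟩ := exists_between_neg_moments hp hp2
  change _ → _ < gigNormReal S.postP 0 1 at hL
  change gigNormReal (S.postP + _) 0 1 * _ < L at hLN
  set s := S.p / 2 with hs
  have hs0 : 0 < s := by positivity
  have hs1 : s ≤ 1 := by linarith
  have hp' : S.postP ≤ 0 := by unfold postP; linarith
  obtain ⟨D, hD, hneg⟩ := exists_gig_neg_moment_le hp' hA hs0 hs1 hL0 hL
  have hN : 0 < gigNormReal (S.postP + -s) 0 1 :=
    (GIGProper.invGamma (by linarith) one_pos).gigNormReal_pos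
  set N := gigNormReal (S.postP + -s) 0 1
  have hg := gaussAbsMoment_pos (q := -S.p) (by linarith)
  set g := gaussAbsMoment (-S.p)
  set c₀ := (√(S.b / S.postA) + gigMeanConst S.postP S.postA) + D with hc₀
  set c₁ := (S.σ * √S.postA)⁻¹ with hc₁
  -- Since `b = 0`, the updated parameter is `(y/σ)²`, and its power `-s` equals `(σ²)^s |y|^(-p)`.
  set c₂ := N / L * (S.σ ^ 2) ^ s with hc₂
  have hc₀0 : 0 ≤ c₀ := by positivity
  have hc₁0 : 0 < c₁ := by positivity
  have hc₂0 : 0 < c₂ := by positivity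
  obtain ⟨lam, C, hl, hl1, hC, hdr⟩ := exists_sum_abs_moment_le (c₀ := c₀) hσ hσε ha
  obtain ⟨F, hF, hvar⟩ := exists_condVar_rpow_neg_le (S := S) hσ hσε hs0 hs1
  set θ := N * g / L with hθ
  have hθ0 : 0 ≤ θ := by positivity
  have hθ1 : θ < 1 := by rw [hθ, div_lt_one hL0]; exact hLN
  refine isGeometricallyErgodic_of_bounds hσ hσε hpr (w := fun x => x + x ^ (-s))
    (f := fun y => (ENNReal.ofReal c₀ + ENNReal.ofReal c₁ * ENNReal.ofReal |y| ^ (1 : ℝ))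
      + ENNReal.ofReal c₂ * ENNReal.ofReal |y| ^ (-S.p)) (lam := max lam θ) (C := C + n * (θ * F))
    (by fun_prop) (fun x hx => by positivity) (by fun_prop) (le_max_of_le_left hl)
    (max_lt hl1 hθ1) (by positivity) (fun y hy => ?_) (fun V => ?_) fun T => ?_
  · have hB := postB_pos hσ hpr hy
    have hy' := abs_pos.2 hy
    have e : ∀ x : Set.Ioi (0 : ℝ), ENNReal.ofReal ((x : ℝ) + (x : ℝ) ^ (-s))
        = ENNReal.ofReal (x : ℝ) + ENNReal.ofReal ((x : ℝ) ^ (-s)) := fun x =>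
      ENNReal.ofReal_add x.2.le (Real.rpow_nonneg x.2.le _)
    rw [lintegral_congr e, lintegral_add_left (by fun_prop), lintegral_gigLaw_id _ hA hB,
      lintegral_rpow_gigLaw_of_proper (GIGProper.of_pos _ hA hB) (GIGProper.of_pos _ hA hB),
      ofReal_mul_abs_rpow hc₁0.le hy, ofReal_mul_abs_rpow hc₂0.le hy,
      ← ENNReal.ofReal_add hc₀0 (by positivity), ← ENNReal.ofReal_add
      (p := c₀ + c₁ * |y| ^ (1 : ℝ)) (q := c₂ * |y| ^ (-S.p)) (by positivity)
      (by positivity), ← ENNReal.ofReal_add (gigMean_pos _ hA hB).le (div_pos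
      (GIGProper.of_pos _ hA hB).gigNormReal_pos (GIGProper.of_pos _ hA hB).gigNormReal_pos).le]
    refine ENNReal.ofReal_le_ofReal ?_
    have h1 := gigMean_post_le hσ hb.ge hA hB
    have h2 := hneg _ hB
    have e2 : S.postB y ^ (-s) = (S.σ ^ 2) ^ s * |y| ^ (-S.p) := by
      rw [postB, hb, zero_add, div_pow, Real.div_rpow (by positivity) (by positivity),
        Real.rpow_neg (by positivity) (x := S.σ ^ 2), div_inv_eq_mul, mul_comm, ← sq_abs y,
        ← Real.rpow_natCast |y|, ← Real.rpow_mul hy'.le]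
      congr 2
      rw [hs]; push_cast; ring
    rw [e2, ← mul_assoc, ← hc₂] at h2
    rw [Real.rpow_one]
    linarith
  · have hm : Measurable fun y : ℝ =>
        ENNReal.ofReal c₀ + ENNReal.ofReal c₁ * ENNReal.ofReal |y| ^ (1 : ℝ) := by fun_prop
    refine sum_le_ofReal_of_forall_le (g := fun i => (c₀ + c₁ * (|S.condMean V i| ^ (1 : ℝ)
      + gaussAbsMoment 1 * S.condVar V i ^ ((1 : ℝ) / 2))) + θ * ((V i : ℝ) ^ (-s) + F))
      (fun i => ?_) (fun i => ?_) ?_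
    · have hv := condVar_pos hσ hσε V i
      have hVi : (0 : ℝ) < V i := (V i).2
      have := (gaussAbsMoment_pos (q := 1) (by norm_num)).le
      rw [lintegral_add_left hm]
      refine le_trans ?_ (ENNReal.ofReal_add (by positivity) (by positivity)).ge
      refine add_le_add (lintegral_const_add_abs_rpow_gaussianReal_le
        one_pos le_rfl hc₀0 hc₁0.le _ hv.le) ?_
      rw [lintegral_const_mul _ (by fun_prop)]
      calc _ ≤ ENNReal.ofReal c₂ * ENNReal.ofReal (g * S.condVar V i ^ (-S.p / 2)) := by
            gcongr
            exact lintegral_abs_rpow_gaussianReal_le_of_neg (by linarith) (by linarith) _ hv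
        _ = ENNReal.ofReal (c₂ * (g * S.condVar V i ^ (-s))) := by
            rw [ENNReal.ofReal_mul hc₂0.le, hs, neg_div]
        _ ≤ _ := by
            refine ENNReal.ofReal_le_ofReal ?_
            calc _ ≤ c₂ * (g * ((S.σ ^ 2) ^ (-s) * ((V i : ℝ) ^ (-s) + F))) := by
                  gcongr; exact hvar V i
              _ = _ := by
                  rw [hc₂, hθ, Real.rpow_neg (by positivity) (x := S.σ ^ 2)]
                  field_simp
    · have := (gaussAbsMoment_pos (q := 1) (by norm_num)).le
      have := (condVar_pos hσ hσε V i).le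
      have hVi : (0 : ℝ) < V i := (V i).2
      positivity
    · have h1 : lam * ∑ i, (V i : ℝ) ≤ max lam θ * ∑ i, (V i : ℝ) :=
        mul_le_mul_of_nonneg_right (le_max_left _ _) (Finset.sum_nonneg fun i _ => (V i).2.le)
      have h2 : θ * ∑ i, (V i : ℝ) ^ (-s) ≤ max lam θ * ∑ i, (V i : ℝ) ^ (-s) :=
        mul_le_mul_of_nonneg_right (le_max_right _ _)
          (Finset.sum_nonneg fun i _ => Real.rpow_nonneg (V i).2.le _)
      have h3 := hdr V
      simp only [Finset.sum_add_distrib, ← Finset.mul_sum, Finset.sum_const, Finset.card_univ,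
        Fintype.card_fin, nsmul_eq_mul] at h3 ⊢
      linarith
  -- The negative power in `f` keeps `|M i|` away from zero, which supplies a positive `bmin`; at `b
  -- = 0` the law `GIG(p - 1/2, ·, 0)` is not proper.
  · obtain ⟨δ, hδ, hlow⟩ := exists_pos_le_abs_of_mul_rpow_neg_le (L := |T|) hc₂0
      (neg_neg_of_pos hp) (abs_nonneg T)
    refine ⟨(δ / S.σ) ^ 2, _, GIGProper.of_pos _ hA (by positivity), fun y hy h => ⟨?_,
      postB_le_of_abs_le hσ (abs_le_of_mul_rpow_le hc₁0 one_pos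
        (mul_abs_rpow_le_of_le hc₁0.le hy (le_add_self.trans le_self_add) h))⟩⟩
    have h1 := hlow y hy (mul_abs_rpow_le_of_le hc₂0.le hy le_add_self h)
    rw [postB, hb, zero_add, ← sq_abs (y / S.σ), abs_div, abs_of_pos hσ]
    gcongr

/-- The second update is inverse Gamma with explicit moments, and `μ = 0` leaves only bounded
conditional means. For `w = x^s` the rate is the exact ratio `Γ(1/2 + s) Γ(1/2 - p - s) / (Γ(1/2)
Γ(1/2 - p))`. -/
theorem isGeometricallyErgodic_of_a_eq_zero_of_μ_eq_zero (hσ : 0 < S.σ) (hσε : 0 < S.σε)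
    (ha : S.a = 0) (hb : 0 < S.b) (hp : S.p < 0) (hμ : S.μ = 0) :
    IsGeometricallyErgodic S.gibbsKernel S.posterior := by
  have hpr : GIGProper S.p S.a S.b := by rw [ha]; exact GIGProper.invGamma hp hb
  have hA : S.postA = 0 := by rw [postA, ha, hμ]; simp
  -- The bound `1/2` gives `2 s ≤ 1`, needed for subadditivity of `|y|^(2s)`; the bound `-p/2` keeps
  -- `-p - s` positive, as the Gamma inequality requires.
  set s := min (1 / 2) (-S.p / 2) with hs
  have hs0 : 0 < s := lt_min (by norm_num) (by linarith)
  have hs1 : s ≤ 1 / 2 := min_le_left _ _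
  have hsp : s ≤ -S.p / 2 := min_le_right _ _
  have hp' : S.postP < 0 := by unfold postP; linarith
  have hp's : S.postP + s < 0 := by unfold postP; linarith
  have hΓ1 : 0 < Real.Gamma (-S.postP) := Real.Gamma_pos_of_pos (by linarith)
  have hΓ2 : 0 < Real.Gamma (-(S.postP + s)) := Real.Gamma_pos_of_pos (by linarith)
  set Γr := Real.Gamma (-(S.postP + s)) / Real.Gamma (-S.postP) with hΓr
  have hΓr0 : 0 < Γr := by positivity
  have hratio : ∀ b, 0 < b → gigNormReal (S.postP + s) 0 b / gigNormReal S.postP 0 b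
      = 2 ^ (-s) * Γr * b ^ s := by
    intro b hb
    rw [gigNormReal_invGamma hp' hb, gigNormReal_invGamma hp's hb, hΓr, neg_add,
      Real.rpow_add (by positivity), Real.div_rpow two_pos.le hb.le (z := -s),
      Real.rpow_neg hb.le]
    have : (0 : ℝ) < (2 / b) ^ (-S.postP) := by positivity
    rw [neg_add] at hΓ2
    field_simp
  set c₀ := 2 ^ (-s) * Γr * S.b ^ s with hc₀
  set c₁ := 2 ^ (-s) * Γr * (S.σ ^ 2) ^ (-s) with hc₁
  have hc₀0 : 0 < c₀ := by positivity
  have hc₁0 : 0 < c₁ := by positivity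
  have hg := gaussAbsMoment_pos (q := 2 * s) (by linarith)
  obtain ⟨D, hD, hm⟩ := exists_abs_condMean_le (S := S) hσ hσε
  have hm : ∀ V i, |S.condMean V i| ≤ D := fun V i => by
    have := hm V i
    rwa [hμ, abs_zero, zero_mul, add_zero] at this
  set lam := 2 ^ (-s) * Γr * gaussAbsMoment (2 * s) with hlam
  have hl1 : lam < 1 := by
    have hΓ := Gamma_mul_Gamma_lt (α := 1 / 2) (s := s) (t := -S.p - s) (by norm_num) hs0
      (by linarith)
    have hπ : 0 < √Real.pi := Real.sqrt_pos.2 Real.pi_pos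
    rw [Real.Gamma_one_half_eq, show 1 / 2 + (-S.p - s) = -(S.postP + s) by unfold postP; ring,
      show 1 / 2 + s + (-S.p - s) = -S.postP by unfold postP; ring] at hΓ
    rw [hlam, hΓr, gaussAbsMoment, mul_div_cancel_left₀ _ two_ne_zero,
      show (2 * s + 1) / 2 = 1 / 2 + s by ring, Real.rpow_neg two_pos.le]
    have h2 : (0 : ℝ) < 2 ^ s := by positivity
    calc _ = Real.Gamma (1 / 2 + s) * Real.Gamma (-(S.postP + s))
          / (√Real.pi * Real.Gamma (-S.postP)) := by field_simp
      _ < 1 := (div_lt_one (by positivity)).2 hΓ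
  refine isGeometricallyErgodic_of_bounds hσ hσε hpr (w := fun x => x ^ s)
    (f := fun y => ENNReal.ofReal c₀ + ENNReal.ofReal c₁ * ENNReal.ofReal |y| ^ (2 * s))
    (lam := lam) (C := n * (c₀ + c₁ * D ^ (2 * s)))
    (by fun_prop) (fun x hx => by positivity) (by fun_prop) (by positivity) hl1 (by positivity)
    (fun y hy => ?_) (fun V => ?_) fun T => ?_
  · have hB := postB_pos hσ hpr hy
    have hy' := abs_pos.2 hy
    rw [hA, lintegral_rpow_gigLaw_of_proper (GIGProper.invGamma hp' hB)
      (GIGProper.invGamma hp's hB), hratio _ hB, ofReal_mul_abs_rpow hc₁0.le hy,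
      ← ENNReal.ofReal_add hc₀0.le (by positivity)]
    refine ENNReal.ofReal_le_ofReal ?_
    have e2 : ((y / S.σ) ^ 2) ^ s = (S.σ ^ 2) ^ (-s) * |y| ^ (2 * s) := by
      rw [div_pow, Real.div_rpow (by positivity) (by positivity),
        Real.rpow_neg (by positivity) (x := S.σ ^ 2), mul_comm, ← div_eq_mul_inv, ← sq_abs y,
        ← Real.rpow_natCast |y|, ← Real.rpow_mul hy'.le]
      norm_num
    calc _ ≤ 2 ^ (-s) * Γr * (S.b ^ s + ((y / S.σ) ^ 2) ^ s) := by
          gcongr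
          exact Real.rpow_add_le_add_rpow hb.le (sq_nonneg _) hs0.le (by linarith)
      _ = _ := by rw [e2, hc₀, hc₁]; ring
  · refine sum_le_ofReal_of_forall_le (g := fun i => lam * (V i : ℝ) ^ s
      + (c₀ + c₁ * D ^ (2 * s))) (fun i => ?_) (fun i => ?_) ?_
    · have hv := condVar_pos hσ hσε V i
      have hVi : (0 : ℝ) < V i := (V i).2
      refine (lintegral_const_add_abs_rpow_gaussianReal_le (by linarith) (by linarith) hc₀0.le
        hc₁0.le _ hv.le).trans (ENNReal.ofReal_le_ofReal ?_)
      rw [mul_div_cancel_left₀ _ two_ne_zero]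
      calc _ ≤ c₀ + c₁ * (D ^ (2 * s) + gaussAbsMoment (2 * s) * (S.σ ^ 2 * V i) ^ s) := by
            gcongr
            · exact hm V i
            · exact condVar_le hσ hσε V i
        _ = _ := by
            rw [Real.mul_rpow (by positivity) hVi.le, hlam, hc₁,
              Real.rpow_neg (by positivity) (x := S.σ ^ 2)]
            field_simp
            ring
    · have hVi : (0 : ℝ) < V i := (V i).2
      positivity
    · rw [Finset.sum_add_distrib, ← Finset.mul_sum, Finset.sum_const,
        Finset.card_univ, Fintype.card_fin, nsmul_eq_mul]
  · refine ⟨S.b, _, by rw [hA]; exact GIGProper.invGamma hp' hb, fun y hy h => ⟨le_postB y,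
      postB_le_of_abs_le hσ (abs_le_of_mul_rpow_le hc₁0 (by positivity)
        (mul_abs_rpow_le_of_le hc₁0.le hy le_add_self h))⟩⟩

/-- With `a = 0` the second moment of the update is `M i² / μ²` to leading order, and `M i` has mean
`μ (Q̄⁻¹ v) i` up to a bounded error. Summing squares, the limiting rate is `|v|² < 1`; the
remaining terms are of lower order and are absorbed by `ε`. -/
theorem isGeometricallyErgodic_of_a_eq_zero_of_nullSmallness (hσ : 0 < S.σ) (hσε : 0 < S.σε)
    (hK : IsUnit S.K.det) (ha : S.a = 0) (hb : 0 < S.b) (hp : S.p < 0) (hμ : S.μ ≠ 0)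
    (hnull : S.NullSmallness) : IsGeometricallyErgodic S.gibbsKernel S.posterior := by
  have hpr : GIGProper S.p S.a S.b := by rw [ha]; exact GIGProper.invGamma hp hb
  have hA : 0 < S.postA := by rw [postA, ha]; positivity
  have hAe : S.postA = S.μ ^ 2 / S.σ ^ 2 := by rw [postA, ha, zero_add, div_pow]
  have hμ2 : 0 < S.μ ^ 2 := by positivity
  have hG := gigMeanConst_nonneg S.postP hA
  set G := gigMeanConst S.postP S.postA
  obtain ⟨v, u, hvu, hd1, hu⟩ := hnull.exists_decomposition hK ha hμ
  obtain ⟨D, hD, hm⟩ := exists_condMean_sub_bound hσ hσε hvu hu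
  have hd0 : 0 ≤ ∑ i, v i ^ 2 := Finset.sum_nonneg fun i _ => sq_nonneg _
  set d := ∑ i, v i ^ 2 with hd
  -- Then `(1 + ε)² d + ε ≤ (1 + 3 ε) d + ε`, which is below `d + 4 ε < 1`.
  set ε := (1 - d) / 8 with hε
  have hε0 : 0 < ε := by linarith
  have hε1 : ε ≤ 1 := by linarith
  set c₁ := (1 + ε) / S.μ ^ 2 with hc₁
  have hc₁0 : 0 < c₁ := by positivity
  set c₀ := (1 + ε) * (S.b * S.σ ^ 2 / S.μ ^ 2) + G ^ 2 / (4 * ε) + G ^ 2 with hc₀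
  have hc₀0 : 0 ≤ c₀ := by positivity
  set η := ε / (c₁ * S.σ ^ 2) with hη
  have hη0 : 0 < η := by positivity
  have hηe : c₁ * S.σ ^ 2 * η = ε := by rw [hη]; field_simp
  set lam := (1 + ε) ^ 2 * d + ε with hlam
  have hl1 : lam < 1 := by
    have : (1 + ε) ^ 2 ≤ 1 + 3 * ε := by nlinarith
    have h2 : (1 + ε) ^ 2 * d ≤ (1 + 3 * ε) * d := mul_le_mul_of_nonneg_right this hd0
    nlinarith
  set E := c₀ + c₁ * ((1 + ε⁻¹) * D ^ 2) + c₁ * S.σ ^ 2 * (4 * η)⁻¹ with hE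
  refine isGeometricallyErgodic_of_bounds hσ hσε hpr (w := fun x => x ^ 2)
    (f := fun y => ENNReal.ofReal c₀ + ENNReal.ofReal c₁ * ENNReal.ofReal (y ^ 2))
    (lam := lam) (C := n * E)
    (by fun_prop) (fun x hx => by positivity) (by fun_prop) (by positivity) hl1 (by positivity)
    (fun y hy => ?_) (fun V => ?_) fun T => ?_
  · have hB := postB_pos hσ hpr hy
    have h1 := lintegral_rpow_gigLaw_of_proper (s := 2) (GIGProper.of_pos S.postP hA hB)
      (GIGProper.of_pos _ hA hB)
    simp only [Real.rpow_two] at h1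
    rw [h1, ← ENNReal.ofReal_mul hc₁0.le, ← ENNReal.ofReal_add hc₀0 (by positivity)]
    refine ENNReal.ofReal_le_ofReal ?_
    have h2 := gigSecondMoment_le S.postP hA hB
    have h3 := mul_le_mul_of_nonneg_left (gigMean_le S.postP hA hB) hG
    have h4 := Real.sq_sqrt (show 0 ≤ S.postB y / S.postA by positivity)
    set X := √(S.postB y / S.postA)
    -- Young's inequality moves the linear term of the second moment into the factor `1 + ε` of
    -- `c₁`.
    have h5 : G * X ≤ ε * X ^ 2 + G ^ 2 / (4 * ε) := by
      have e : ε * X ^ 2 + G ^ 2 / (4 * ε) - G * X = (2 * ε * X - G) ^ 2 / (4 * ε) := by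
        field_simp
        ring
      have : 0 ≤ (2 * ε * X - G) ^ 2 / (4 * ε) := by positivity
      linarith
    have h6 : S.postB y / S.postA = S.b * S.σ ^ 2 / S.μ ^ 2 + y ^ 2 / S.μ ^ 2 := by
      rw [hAe, postB]
      field_simp
    calc _ ≤ (1 + ε) * X ^ 2 + G ^ 2 / (4 * ε) + G ^ 2 := by rw [h4]; nlinarith
      _ = _ := by rw [h4, h6, hc₀, hc₁]; ring
  · set x := (ridge S.ρ S.B V.toVec)⁻¹ *ᵥ v
    have hx : ∑ i, x i ^ 2 ≤ d * ∑ i, (V i : ℝ) ^ 2 :=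
      sum_sq_ridge_inv_le (B := S.B) (ρ_pos hσ hσε).le (toVec_pos V) v
    refine sum_le_ofReal_of_forall_le (g := fun i => (1 + ε) ^ 2 * x i ^ 2 + ε * (V i : ℝ) ^ 2 + E)
      (fun i => ?_) (fun i => by positivity) ?_
    · have hv := condVar_pos hσ hσε V i
      rw [lintegral_add_left measurable_const, lintegral_const, measure_univ, mul_one,
        lintegral_const_mul _ (by fun_prop), lintegral_sq_gaussianReal _ hv.le,
        ← ENNReal.ofReal_mul hc₁0.le, ← ENNReal.ofReal_add hc₀0 (by positivity)]
      refine ENNReal.ofReal_le_ofReal ?_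
      have h1 : S.condVar V i ≤ S.σ ^ 2 * (η * (V i : ℝ) ^ 2 + (4 * η)⁻¹) :=
        (condVar_le hσ hσε V i).trans
          (mul_le_mul_of_nonneg_left (le_mul_sq_add hη0 _) (by positivity))
      have h2 : S.condMean V i ^ 2 ≤ (1 + ε) * (S.μ ^ 2 * x i ^ 2) + (1 + ε⁻¹) * D ^ 2 := by
        set t := S.condMean V i - S.μ * x i with ht
        have ht2 : t ^ 2 ≤ D ^ 2 := by
          rw [← sq_abs t]
          exact pow_le_pow_left₀ (abs_nonneg _) (hm V i) 2
        have e : (1 + ε) * (S.μ * x i) ^ 2 + (1 + ε⁻¹) * t ^ 2 - (S.μ * x i + t) ^ 2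
            = (ε * (S.μ * x i) - t) ^ 2 / ε := by
          field_simp
          ring
        have h0 : 0 ≤ (ε * (S.μ * x i) - t) ^ 2 / ε := by positivity
        have h3 : (1 + ε⁻¹) * t ^ 2 ≤ (1 + ε⁻¹) * D ^ 2 := by gcongr
        have e2 : S.condMean V i = S.μ * x i + t := by rw [ht]; ring
        rw [e2]
        linarith
      calc _ ≤ c₀ + c₁ * (((1 + ε) * (S.μ ^ 2 * x i ^ 2) + (1 + ε⁻¹) * D ^ 2)
            + S.σ ^ 2 * (η * (V i : ℝ) ^ 2 + (4 * η)⁻¹)) := by gcongr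
        _ = c₁ * S.μ ^ 2 * (1 + ε) * x i ^ 2 + c₁ * S.σ ^ 2 * η * (V i : ℝ) ^ 2 + E := by
            rw [hE]; ring
        _ = _ := by
            rw [hηe, hc₁, div_mul_cancel₀ _ hμ2.ne']; ring
    · rw [Finset.sum_add_distrib, Finset.sum_add_distrib, ← Finset.mul_sum, ← Finset.mul_sum,
        Finset.sum_const, Finset.card_univ, Fintype.card_fin, nsmul_eq_mul]
      have := mul_le_mul_of_nonneg_left hx (sq_nonneg (1 + ε))
      rw [hlam]
      linarith
  · refine ⟨S.b, _, GIGProper.of_pos _ hA hb, fun y hy h => ⟨le_postB y,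
      postB_le_of_abs_le hσ (abs_le_of_mul_rpow_le (q := 2) hc₁0 two_pos
        (mul_abs_rpow_le_of_le hc₁0.le hy ?_ h))⟩⟩
    rw [ofReal_mul_abs_rpow hc₁0.le hy, Real.rpow_two, sq_abs, ENNReal.ofReal_mul hc₁0.le]
    exact le_add_self

end LLnGM

end

theorem theorem2p8 {n m q : ℕ} (S : LLnGM n m q) (hσ : 0 < S.σ) (hσε : 0 < S.σε)
    (hK : IsUnit S.K.det)
    (hreg :
      (0 < S.a ∧ 0 < S.b) ∨
      (0 < S.a ∧ S.b = 0 ∧ 1 / 2 < S.p) ∨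
      (0 < S.a ∧ S.b = 0 ∧ 0 < S.p ∧ S.p ≤ 1 / 2 ∧ S.NullSmallness) ∨
      (S.a = 0 ∧ 0 < S.b ∧ S.p < 0 ∧ S.μ = 0) ∨
      (S.a = 0 ∧ 0 < S.b ∧ S.p < 0 ∧ S.μ ≠ 0 ∧ S.NullSmallness)) :
    IsGeometricallyErgodic S.gibbsKernel S.posterior := by
  rcases hreg with ⟨ha, hb⟩ | ⟨ha, hb, hp⟩ | ⟨ha, hb, hp, hp2, -⟩ | ⟨ha, hb, hp, hμ⟩ |
    ⟨ha, hb, hp, hμ, hnull⟩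
  · exact LLnGM.isGeometricallyErgodic_of_a_pos hσ hσε ha (GIGProper.of_pos _ ha hb) (Or.inl hb)
  · exact LLnGM.isGeometricallyErgodic_of_a_pos hσ hσε ha
      ⟨ha.le, hb.ge, Or.inl ha, Or.inr (by linarith)⟩ (Or.inr hp)
  · exact LLnGM.isGeometricallyErgodic_of_b_eq_zero hσ hσε ha hb hp hp2
  · exact LLnGM.isGeometricallyErgodic_of_a_eq_zero_of_μ_eq_zero hσ hσε ha hb hp hμ
  · exact LLnGM.isGeometricallyErgodic_of_a_eq_zero_of_nullSmallness hσ hσε hK ha hb hp hμ hnull
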